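/- **Conventions.** Manifolds are smooth, Hausdorff and modelled on real Banach spaces. A weak symplectic form on $\mathcal G$ is a smooth closed 2-form $\omega$ such that $v\mapsto\omega_x(v,\cdot)$ is injective on $T_x\mathcal G$ for every $x$; $\overline{\mathcal G}$ denotes $(\mathcal G,-\omega)$. A subset $A$ of a manifold $X$ is an *immersed submanifold* if there are a manifold $N$ and an immersion $\varphi:N\to X$ with $\varphi(N)=A$ such that $N$ covers $A$ in the following sense: every smooth map $f$ from an open subset of a Banach space to $X$ with values in $A$ lifts near each point $p$ to a smooth map to $N$, with any prescribed value in $\varphi^{-1}(f(p))$ at $p$. It is *Lagrangian* if $W=W^\perp$ for every image $W=T\varphi(T_yN)$. Relations $R\colon X\nrightarrow Y$ are subsets of $X\times Y$, composed as sets by $S\circ R=\{(x,z):\exists y,\ (x,y)\in R,\ (y,z)\in S\}$; subsets of $X$ are regarded as relations $*\nrightarrow X$, maps as their graphs, $R^\dagger$ is the transpose, and $T(x,y)=(y,x)$. A *relational symplectic groupoid* $(\mathcal G,L,I)$ consists of a weak symplectic Banach manifold $(\mathcal G,\omega)$, an immersed Lagrangian submanifold $L\subset\mathcal G^3$ and an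 antisymplectomorphism $I$ of $\mathcal G$ such that: * (A.1) $(x,y,z)\in L\Rightarrow(y,z,x)\in L$; (A.2) $I^2=\mathrm{Id}$; * (A.3) with $L$ regarded as a relation $\mathcal G^2\nrightarrow\mathcal G$, the relations $L_3:=I\circ L$ and $L\circ T\circ(I\times I)$ are immersed Lagrangian submanifolds of $\overline{\mathcal G^2}\times\mathcal G$, and they are equal; * (A.4) $L_3\circ(L_3\times\mathrm{Id})$ and $L_3\circ(\mathrm{Id}\times L_3)$ are immersed Lagrangian submanifolds of $\overline{\mathcal G^3}\times\mathcal G$, and they are equal; * (A.5) with $L_I\subset\mathcal G^2$ the graph of $I$, the sets $L_1:=L_3\circ L_I$ and $L_3\circ(L_1\times L_1)$ are immersed Lagrangian submanifolds of $\mathcal G$, and they are equal; * (A.6) $L_2:=L_3\circ(L_1\times\mathrm{Id})$ and $L_3\circ(\mathrm{Id}\times L_1)$ are immersed Lagrangian submanifolds of $\overline{\mathcal G}\times\mathcal G$ and are equal; moreover $L_2\circ L_1=L_1$, $L_2\circ L_3=L_3\circ(L_2\times L_2)=L_3$, $I\circ L_2=L_2\circ I$ and $L_2^\dagger=L_2$.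 It is *regular* if: * (A.7) $C:=L_2\circ\mathcal G=\{y:\exists x,\ (x,y)\in L_2\}$ is an immersed submanifold of $\mathcal G$; * (A.8) the quotient $M:=L_1/L_2$ is a finite-dimensional smooth manifold, the projection $L_1\to M$ being a submersion; * (A.9) $S:=\{(c,[l])\in C\times M:\exists\, l'\in[l],\ g\in\mathcal G,\ (l',c,g)\in L_3\}$ is an immersed submanifold of $\mathcal G\times M$, the relation $TS\colon T\mathcal G\nrightarrow TM$ is surjective at every point of $S$, and $(S\times S)\circ L_2=\Delta_M$, with $L_2$ regarded as a subset of $C\times C$. Let $T_M:=\{(c,[l])\in C\times M:\exists\, l'\in[l],\ g\in\mathcal G,\ (c,l',g)\in L_3\}$. The relations $S$ and $T_M$ are the graphs of maps $s,t\colon C\to M$ (where $C$ carries the manifold structure given by its immersion $\varphi_C$ into $\mathcal G$, and $s,t$ are regarded as functions on the parametrizing manifold); $s$ is assumed to be smooth. Let $\omega_C=\varphi_C^*\omega$. A *Poisson structure* on $M$ is a smooth bivector field $\Pi$ such that $\{f,g\}=\Pi(df,dg)$ satisfies the Jacobi identity. A smooth map $f\colon C\to M$ is a *forward-Dirac map*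 from $(C,\omega_C)$ to $(M,\Pi)$ if for all $c\in C$ $$\{(\Pi(\alpha,\cdot),\alpha):\alpha\in T^*_{f(c)}M\}=\{(df_c(X),\beta): X\in T_cC,\ \beta\in T^*_{f(c)}M,\ \omega_C(X,\cdot)=\beta\circ df_c\}.$$ **Theorem.** Let $(\mathcal G,L,I)$ be a regular relational symplectic groupoid, with $M=L_1/L_2$, and assume that the $s$-fibers $s^{-1}(m)$, $m\in M$, are connected. Then there is a unique Poisson structure $\Pi$ on $M$ such that $s\colon C\to M$ is a forward-Dirac map, and there is a unique Poisson structure on $M$ such that $t\colon C\to M$ is a forward-Dirac map. The two determine each other: for every Poisson structure $\Pi$ on $M$, the map $s$ is forward-Dirac for $\Pi$ if and only if $t$ is forward-Dirac for $-\Pi$. -/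

import Mathlib

open scoped Manifold ContDiff Topology

universe u

noncomputable section

namespace RSG

/-! ### Banach manifolds and immersed submanifolds -/

/-- A smooth (Hausdorff, boundaryless) manifold modelled on a real Banach space. -/
structure BanachManifold : Type (u + 1) where
  model : Type u
  [normed : NormedAddCommGroup model]
  [space : NormedSpace ℝ model]
  [complete : CompleteSpace model]
  carrier : Type u
  [topology : TopologicalSpace carrier]
  [hausdorff : T2Space carrier]
  [charted : ChartedSpace model carrier]
  [smooth : IsManifold 𝓘(ℝ, model) ∞ carrier]

attribute [instance] BanachManifold.normed BanachManifold.space BanachManifold.complete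
  BanachManifold.topology BanachManifold.hausdorff BanachManifold.charted BanachManifold.smooth

section Immersed

variable {E : Type u} [NormedAddCommGroup E] [NormedSpace ℝ E] {H : Type u} [TopologicalSpace H]
  (J : ModelWithCorners ℝ E H) {X : Type u} [TopologicalSpace X] [ChartedSpace H X]

/-- The pair `(N, φ)` exhibits the set `A ⊆ X` as an immersed submanifold of `X`: the map
`φ : N → X` is an immersion with image `A`, and `N` covers `A`, in the sense that a smooth map
into `X` with values in `A` lifts locally and smoothly to `N`, through any prescribed point of `N`.
An embedded or weakly embedded (initial) submanifold has this property, and so has a manifold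
that covers such a submanifold. -/
structure IsImmersedSubmanifold (N : BanachManifold.{u}) (φ : N.carrier → X) (A : Set X) :
    Prop where
  immersion : ∀ y, Manifold.IsImmersionAt 𝓘(ℝ, N.model) J ∞ φ y
  range_eq : Set.range φ = A
  lift : ∀ (P : Type u) [NormedAddCommGroup P] [NormedSpace ℝ P] [CompleteSpace P]
    (U : Set P) (f : P → X), IsOpen U → ContMDiffOn 𝓘(ℝ, P) J ∞ f U → Set.MapsTo f U A →
    ∀ p ∈ U, ∀ y : N.carrier, φ y = f p →
      ∃ g : P → N.carrier, ContMDiffAt 𝓘(ℝ, P) 𝓘(ℝ, N.model) ∞ g p ∧ g p = y ∧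
        ∀ᶠ q in 𝓝 p, φ (g q) = f q

end Immersed

/-! ### Two-forms and Lagrangian submanifolds -/

section Forms

/-- Fields of continuous alternating bilinear forms on the tangent spaces of `X`
(no regularity in the base point is imposed here). -/
abbrev TwoForm {E : Type u} [NormedAddCommGroup E] [NormedSpace ℝ E] {H : Type u}
    [TopologicalSpace H] (J : ModelWithCorners ℝ E H) (X : Type u) [TopologicalSpace X]
    [ChartedSpace H X] : Type u :=
  ∀ x : X, TangentSpace J x [⋀^Fin 2]→L[ℝ] ℝ

variable {E : Type u} [NormedAddCommGroup E] [NormedSpace ℝ E] {H : Type u} [TopologicalSpace H]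
  {J : ModelWithCorners ℝ E H} {X : Type u} [TopologicalSpace X] [ChartedSpace H X]
  {E' : Type u} [NormedAddCommGroup E'] [NormedSpace ℝ E'] {H' : Type u} [TopologicalSpace H']
  {J' : ModelWithCorners ℝ E' H'} {Y : Type u} [TopologicalSpace Y] [ChartedSpace H' Y]

/-- The pullback `f^* σ`. -/
def pullbackForm (J : ModelWithCorners ℝ E H) (J' : ModelWithCorners ℝ E' H')
    (f : X → Y) (σ : TwoForm J' Y) : TwoForm J X :=
  fun x => (σ (f x)).compContinuousLinearMap (mfderiv J J' f x)

/-- The form `pr₁^* σ + pr₂^* σ'` on `X × Y`. -/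
def prodForm (σ : TwoForm J X) (σ' : TwoForm J' Y) : TwoForm (J.prod J') (X × Y) :=
  pullbackForm (J.prod J') J Prod.fst σ + pullbackForm (J.prod J') J' Prod.snd σ'

/-- A subspace `W` is Lagrangian if it equals its own orthogonal `W^⊥`. -/
def IsLagrangianSubspace {V : Type*} [AddCommGroup V] [Module ℝ V] [TopologicalSpace V]
    (Ω : V [⋀^Fin 2]→L[ℝ] ℝ) (W : Submodule ℝ V) : Prop :=
  ∀ v : V, v ∈ W ↔ ∀ w ∈ W, Ω ![v, w] = 0

/-- The set `A ⊆ X` is an immersed Lagrangian submanifold of `(X, Ω)`. -/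
def IsImmersedLagrangian (J : ModelWithCorners ℝ E H) (Ω : TwoForm J X) (A : Set X) : Prop :=
  ∃ (N : BanachManifold.{u}) (φ : N.carrier → X), IsImmersedSubmanifold J N φ A ∧
    ∀ y, IsLagrangianSubspace (Ω (φ y))
      (LinearMap.range (mfderiv 𝓘(ℝ, N.model) J φ y).toLinearMap)

/-- The local representative of a two-form in the chart at `x₀`. -/
def chartForm {X : Type u} [TopologicalSpace X] [ChartedSpace E X] (σ : TwoForm 𝓘(ℝ, E) X)
    (x₀ : X) : E → E [⋀^Fin 2]→L[ℝ] ℝ :=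
  fun a => pullbackForm 𝓘(ℝ, E) 𝓘(ℝ, E) (chartAt E x₀).symm σ a

/-- A weak symplectic form: a smooth closed two-form `σ` such that `v ↦ σ(v, ·)` is injective
on every tangent space. -/
structure IsWeakSymplectic {X : Type u} [TopologicalSpace X] [ChartedSpace E X]
    (σ : TwoForm 𝓘(ℝ, E) X) : Prop where
  smooth : ∀ x₀ : X, ContDiffOn ℝ ∞ (chartForm σ x₀) (chartAt E x₀).target
  closed : ∀ x₀ : X, ∀ a ∈ (chartAt E x₀).target, extDeriv (chartForm σ x₀) a = 0
  nondegenerate : ∀ (x : X) (v : TangentSpace 𝓘(ℝ, E) x), (∀ w, σ x ![v, w] = 0) → v = 0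

end Forms

/-! ### Relations -/

section Relations

variable {α β γ δ : Type*}

/-- The product of two relations. -/
def prodRel (R : SetRel α β) (S : SetRel γ δ) : SetRel (α × γ) (β × δ) :=
  {p | (p.1.1, p.2.1) ∈ R ∧ (p.1.2, p.2.2) ∈ S}

/-- For a subset `A` of `β`, seen as a relation from a point to `β`, the relation
`A × Id` from `α` to `β × α`. -/
def leftUnitRel (α : Type*) (A : Set β) : SetRel α (β × α) := {p | p.2.1 ∈ A ∧ p.2.2 = p.1}

/-- For a subset `A` of `β`, seen as a relation from a point to `β`, the relation
`Id × A` from `α` to `α × β`. -/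
def rightUnitRel (α : Type*) (A : Set β) : SetRel α (α × β) := {p | p.2.1 = p.1 ∧ p.2.2 ∈ A}

end Relations

/-! ### Relational symplectic groupoids

Relations are composed from left to right: `R.comp S` relates `a` to `c` if `a R b` and `b S c`
for some `b`. A relation from a point to `X` is a subset of `X`, and its composition with a
relation `R` starting at `X` is the image `R.image A`. -/

open scoped SetRel

variable {E : Type u} [NormedAddCommGroup E] [NormedSpace ℝ E] [CompleteSpace E]
  {𝒢 : Type u} [TopologicalSpace 𝒢] [T2Space 𝒢] [ChartedSpace E 𝒢]

variable (E 𝒢) in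
/-- The data `(𝒢, σ, L, I)` underlying a relational symplectic groupoid. -/
structure RelData : Type u where
  σ : TwoForm 𝓘(ℝ, E) 𝒢
  L : SetRel (𝒢 × 𝒢) 𝒢
  I : 𝒢 → 𝒢

namespace RelData

variable (D : RelData E 𝒢)

/-- `L₃ = I ∘ L`. -/
def L₃ : SetRel (𝒢 × 𝒢) 𝒢 := D.L.comp (Function.graph D.I)

/-- `L ∘ T ∘ (I × I)`, where `T` is the transposition. -/
def L₃' : SetRel (𝒢 × 𝒢) 𝒢 :=
  ((prodRel (Function.graph D.I) (Function.graph D.I)).comp (Function.graph Prod.swap)).comp D.L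

/-- `L₃ ∘ (L₃ × Id)`. -/
def assocLeft : SetRel ((𝒢 × 𝒢) × 𝒢) 𝒢 := (prodRel D.L₃ (Function.graph id)).comp D.L₃

/-- `L₃ ∘ (Id × L₃)`. -/
def assocRight : SetRel ((𝒢 × 𝒢) × 𝒢) 𝒢 :=
  ((Function.graph (Equiv.prodAssoc 𝒢 𝒢 𝒢)).comp (prodRel (Function.graph id) D.L₃)).comp D.L₃

/-- `L₁ = L₃ ∘ L_I`, where `L_I` is the graph of `I`. -/
def L₁ : Set 𝒢 := D.L₃.image (Function.graph D.I)

/-- `L₂ = L₃ ∘ (L₁ × Id)`. -/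
def L₂ : SetRel 𝒢 𝒢 := (leftUnitRel 𝒢 D.L₁).comp D.L₃

/-- `L₃ ∘ (Id × L₁)`. -/
def L₂' : SetRel 𝒢 𝒢 := (rightUnitRel 𝒢 D.L₁).comp D.L₃

/-- `C = L₂ ∘ 𝒢`. -/
def C : Set 𝒢 := D.L₂.image Set.univ

/-- The set `M = L₁ / (L₂ ∩ L₁ × L₁)`. It carries no topology a priori. -/
def Base : Type u := Quot (fun a b : D.L₁ => ((a : 𝒢), (b : 𝒢)) ∈ D.L₂)

/-- The class `[l]` of `l ∈ L₁`. -/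
def cls (l : D.L₁) : D.Base := Quot.mk _ l

/-- The source relation: `(c, [l]) ∈ S` iff `(l', c, g) ∈ L₃` for some `l' ∈ [l]` and `g`. -/
def S : SetRel 𝒢 D.Base :=
  {p | p.1 ∈ D.C ∧ ∃ l : D.L₁, D.cls l = p.2 ∧ ∃ g, (((l : 𝒢), p.1), g) ∈ D.L₃}

/-- The target relation: `(c, [l]) ∈ T` iff `(c, l', g) ∈ L₃` for some `l' ∈ [l]` and `g`. -/
def T : SetRel 𝒢 D.Base :=
  {p | p.1 ∈ D.C ∧ ∃ l : D.L₁, D.cls l = p.2 ∧ ∃ g, ((p.1, (l : 𝒢)), g) ∈ D.L₃}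

/-- The axioms of a relational symplectic groupoid. -/
structure IsRelationalSymplecticGroupoid : Prop where
  weakSymplectic : IsWeakSymplectic D.σ
  lagrangian_L : IsImmersedLagrangian ((𝓘(ℝ, E).prod 𝓘(ℝ, E)).prod 𝓘(ℝ, E))
    (prodForm (prodForm D.σ D.σ) D.σ) D.L
  smooth_I : ContMDiff 𝓘(ℝ, E) 𝓘(ℝ, E) ∞ D.I
  antisymplectic_I : pullbackForm 𝓘(ℝ, E) 𝓘(ℝ, E) D.I D.σ = -D.σ
  /-- A.1: `L` is cyclically symmetric. -/
  cyclic : ∀ x y z, ((x, y), z) ∈ D.L → ((y, z), x) ∈ D.L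
  /-- A.2: `I` is an involution. -/
  involutive : Function.Involutive D.I
  /-- A.3. -/
  lagrangian_L₃ : IsImmersedLagrangian ((𝓘(ℝ, E).prod 𝓘(ℝ, E)).prod 𝓘(ℝ, E))
    (prodForm (-prodForm D.σ D.σ) D.σ) D.L₃
  lagrangian_L₃' : IsImmersedLagrangian ((𝓘(ℝ, E).prod 𝓘(ℝ, E)).prod 𝓘(ℝ, E))
    (prodForm (-prodForm D.σ D.σ) D.σ) D.L₃'
  L₃_eq : D.L₃ = D.L₃'
  /-- A.4. -/
  lagrangian_assocLeft :
    IsImmersedLagrangian (((𝓘(ℝ, E).prod 𝓘(ℝ, E)).prod 𝓘(ℝ, E)).prod 𝓘(ℝ, E))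
      (prodForm (-prodForm (prodForm D.σ D.σ) D.σ) D.σ) D.assocLeft
  lagrangian_assocRight :
    IsImmersedLagrangian (((𝓘(ℝ, E).prod 𝓘(ℝ, E)).prod 𝓘(ℝ, E)).prod 𝓘(ℝ, E))
      (prodForm (-prodForm (prodForm D.σ D.σ) D.σ) D.σ) D.assocRight
  assoc : D.assocLeft = D.assocRight
  /-- A.5. -/
  lagrangian_L₁ : IsImmersedLagrangian 𝓘(ℝ, E) D.σ D.L₁
  lagrangian_L₁_mul : IsImmersedLagrangian 𝓘(ℝ, E) D.σ (D.L₃.image (D.L₁ ×ˢ D.L₁))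
  L₁_mul : D.L₃.image (D.L₁ ×ˢ D.L₁) = D.L₁
  /-- A.6. -/
  lagrangian_L₂ : IsImmersedLagrangian (𝓘(ℝ, E).prod 𝓘(ℝ, E)) (prodForm (-D.σ) D.σ) D.L₂
  lagrangian_L₂' : IsImmersedLagrangian (𝓘(ℝ, E).prod 𝓘(ℝ, E)) (prodForm (-D.σ) D.σ) D.L₂'
  L₂_eq : D.L₂ = D.L₂'
  L₂_L₁ : D.L₂.image D.L₁ = D.L₁
  L₂_L₃ : D.L₃.comp D.L₂ = D.L₃
  L₃_L₂ : (prodRel D.L₂ D.L₂).comp D.L₃ = D.L₃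
  I_L₂ : D.L₂.comp (Function.graph D.I) = (Function.graph D.I).comp D.L₂
  L₂_inv : D.L₂.inv = D.L₂

/-- The axioms of regularity, for the immersed submanifold structure `φ : N → 𝒢` on `C` and a
finite-dimensional manifold structure on `M = L₁ / L₂`. -/
structure IsRegular (N : BanachManifold.{u}) (φ : N.carrier → 𝒢)
    (EM : Type u) [NormedAddCommGroup EM] [NormedSpace ℝ EM]
    [TopologicalSpace D.Base] [ChartedSpace EM D.Base] : Prop where
  /-- A.7: `C` is an immersed submanifold. -/
  immersed_C : IsImmersedSubmanifold 𝓘(ℝ, E) N φ D.C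
  /-- A.8: `M` is finite-dimensional and has the quotient manifold structure, that is, the
  projection `L₁ → M` is a (surjective) submersion. -/
  finiteDimensional : FiniteDimensional ℝ EM
  quotient : ∃ (N₁ : BanachManifold.{u}) (ψ : N₁.carrier → 𝒢) (q : N₁.carrier → D.Base),
    IsImmersedSubmanifold 𝓘(ℝ, E) N₁ ψ D.L₁ ∧
    (∀ (y : N₁.carrier) (hy : ψ y ∈ D.L₁), q y = D.cls ⟨ψ y, hy⟩) ∧
    ContMDiff 𝓘(ℝ, N₁.model) 𝓘(ℝ, EM) ∞ q ∧
    ∀ y, Function.Surjective (mfderiv 𝓘(ℝ, N₁.model) 𝓘(ℝ, EM) q y)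
  /-- A.9: `(S × S) ∘ L₂` is the diagonal of `M`, the relation `S` is an immersed submanifold
  of `𝒢 × M`, and `TS`, as a relation from `T𝒢` to `TM`, is surjective. -/
  S_diagonal : (prodRel D.S D.S).image D.L₂ = Set.diagonal D.Base
  immersed_S : ∃ (NS : BanachManifold.{u}) (ψ : NS.carrier → 𝒢 × D.Base),
    IsImmersedSubmanifold (𝓘(ℝ, E).prod 𝓘(ℝ, EM)) NS ψ D.S ∧
    ∀ y, Function.Surjective
      (mfderiv 𝓘(ℝ, NS.model) 𝓘(ℝ, EM) (fun z => (ψ z).2) y)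

end RelData

/-! ### Poisson structures and forward-Dirac maps -/

section Poisson

variable {EM : Type u} [NormedAddCommGroup EM] [NormedSpace ℝ EM]

variable (EM) in
/-- Fields of bivectors on `M`, seen as alternating bilinear forms on the cotangent spaces
(no regularity in the base point is imposed here). -/
abbrev Bivector (M : Type u) [TopologicalSpace M] [ChartedSpace EM M] : Type u :=
  ∀ m : M, (TangentSpace 𝓘(ℝ, EM) m →L[ℝ] ℝ) [⋀^Fin 2]→L[ℝ] ℝ

variable {M : Type u} [TopologicalSpace M] [ChartedSpace EM M]

/-- The bracket `{f, g} = P(df, dg)`. -/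
def bracket (P : Bivector EM M) (f g : M → ℝ) : M → ℝ :=
  fun m => P m ![(mfderiv 𝓘(ℝ, EM) 𝓘(ℝ, ℝ) f m : TangentSpace 𝓘(ℝ, EM) m →L[ℝ] ℝ),
    (mfderiv 𝓘(ℝ, EM) 𝓘(ℝ, ℝ) g m : TangentSpace 𝓘(ℝ, EM) m →L[ℝ] ℝ)]

/-- A Poisson structure: a bivector field whose components in charts are smooth and whose bracket
satisfies the Jacobi identity. (The bracket is automatically bilinear, skew-symmetric and a
derivation in each argument.) -/
structure IsPoisson (P : Bivector EM M) : Prop where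
  smooth : ∀ (m₀ : M) (α β : EM →L[ℝ] ℝ),
    ContDiffOn ℝ ∞ (fun a : EM =>
      P ((chartAt EM m₀).symm a)
        ![α.comp (mfderiv 𝓘(ℝ, EM) 𝓘(ℝ, EM) (chartAt EM m₀) ((chartAt EM m₀).symm a)),
          β.comp (mfderiv 𝓘(ℝ, EM) 𝓘(ℝ, EM) (chartAt EM m₀) ((chartAt EM m₀).symm a))])
      (chartAt EM m₀).target
  jacobi : ∀ f g h : M → ℝ, ContMDiff 𝓘(ℝ, EM) 𝓘(ℝ, ℝ) ∞ f → ContMDiff 𝓘(ℝ, EM) 𝓘(ℝ, ℝ) ∞ g →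
    ContMDiff 𝓘(ℝ, EM) 𝓘(ℝ, ℝ) ∞ h →
    bracket P f (bracket P g h) + bracket P g (bracket P h f) + bracket P h (bracket P f g) = 0

variable {V W : Type*} [AddCommGroup V] [Module ℝ V] [TopologicalSpace V]
  [AddCommGroup W] [Module ℝ W] [TopologicalSpace W]

/-- The linear Dirac structure `{(v, σ(v, ·))}` of a two-form. -/
def diracOfForm (σ : V [⋀^Fin 2]→L[ℝ] ℝ) : Set (V × (V →L[ℝ] ℝ)) :=
  {p | ∀ w, p.2 w = σ ![p.1, w]}

/-- The linear Dirac structure `{(π(α, ·), α)}` of a bivector, where `π(α, ·)` is the vector `v`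
with `β v = π(α, β)` for all `β`. -/
def diracOfBivector (π : (V →L[ℝ] ℝ) [⋀^Fin 2]→L[ℝ] ℝ) : Set (V × (V →L[ℝ] ℝ)) :=
  {p | ∀ β, β p.1 = π ![p.2, β]}

/-- The forward image `{(f v, β) | (v, f^* β) ∈ 𝓛}`. -/
def forwardImage (f : V →L[ℝ] W) (𝓛 : Set (V × (V →L[ℝ] ℝ))) : Set (W × (W →L[ℝ] ℝ)) :=
  {p | ∃ v, f v = p.1 ∧ (v, p.2.comp f) ∈ 𝓛}

/-- The map `s` from the presymplectic manifold `(N, σ)` to `(M, P)` is a forward-Dirac map: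
it is smooth, and at each point the Dirac structure of `P` is the forward image of that of `σ`. -/
def IsForwardDirac (N : BanachManifold.{u}) (σ : TwoForm 𝓘(ℝ, N.model) N.carrier)
    (P : Bivector EM M) (s : N.carrier → M) : Prop :=
  ContMDiff 𝓘(ℝ, N.model) 𝓘(ℝ, EM) ∞ s ∧
  ∀ c : N.carrier, diracOfBivector (P (s c)) =
    forwardImage (mfderiv 𝓘(ℝ, N.model) 𝓘(ℝ, EM) s c) (diracOfForm (σ c))

end Poisson

end RSG

end

open scoped Manifold ContDiff Topology SetRel

noncomputable section

namespace RSG.RelData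

section Algebra

variable {E : Type u} [NormedAddCommGroup E] [NormedSpace ℝ E]
  {𝒢 : Type u} [TopologicalSpace 𝒢] [ChartedSpace E 𝒢]
  {D : RelData E 𝒢}

/-! ### The algebra of the multiplication relation -/

/-! Read `L₃` as a partial, multivalued multiplication on `C` modulo `L₂`, with units `L₁` and
inversion `I`. Every `c` in `C` has a left unit `l` over `s c`, with `(l, c, c)` in `L₃`
(`mem_S_iff`), and a triple `(x, y, z)` in `L₃` satisfies `s z = s x` and `t x = s y`, by
associativity. Combined with the Lagrangian property of `L₃` at `(l, c, c)`, these facts give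
everything that reduction along `s` needs.

Let `(dg₁, dg₂, dg₃)` denote the tangent vectors of `L₃` there. If `v` is tangent to the `s`-fibre,
then `(0, v, v)` is tangent to `L₃`, so by isotropy `v` is orthogonal to every difference `dg₃ -
dg₂`. Conversely, a `v` orthogonal to all these differences makes `(0, v, v)` orthogonal to `TL₃`,
hence tangent to it, and `t x = s y` gives `ds v = 0`. The functionals `σ(dg₃ - dg₂, ·)` therefore
descend to the tangent space of `M` and separate its points. That space is finite-dimensional, so
they exhaust its dual: every covector `β` has a Hamiltonian vector `X` with `σ_C(X, ·) = β ∘ ds`,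
depending smoothly on the point (`exists_hamiltonian`). This avoids double orthogonals, which a weak
symplectic form does not control.

If `X` at `l` and `Z` at `c` are Hamiltonian for the same `β`, then `s z = s x` makes `(X, 0, Z)`
orthogonal to `TL₃`, so it is tangent and `ds X = ds Z`. Comparison of all points of a fibre with
one unit shows that `P(β, γ) = γ(ds X_β)` is well defined on `M`. Smoothness follows along local
sections of `s`, and the Jacobi identity from the closedness of `σ_C` (`jacobi_of_closed`).

A bivector on a finite-dimensional space is determined by its graph, and `s` is surjective; this
gives uniqueness. Finally `t` is locally `s` composed with a lift of the antisymplectic map `I`,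
which exchanges the two statements and changes the sign of the bivector. -/

theorem mem_L₃ {x y z : 𝒢} : ((x, y), z) ∈ D.L₃ ↔ ∃ w, ((x, y), w) ∈ D.L ∧ D.I w = z := by
  simp [L₃, SetRel.comp, Function.graph]

theorem mem_L₃' {x y z : 𝒢} : ((x, y), z) ∈ D.L₃' ↔ ((D.I y, D.I x), z) ∈ D.L := by
  simp [L₃', SetRel.comp, Function.graph, prodRel]

theorem mem_L₁ {z : 𝒢} : z ∈ D.L₁ ↔ ∃ x, ((x, D.I x), z) ∈ D.L₃ := by
  simp [L₁, SetRel.image, Function.graph]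

theorem mem_L₂ {x z : 𝒢} : (x, z) ∈ D.L₂ ↔ ∃ l ∈ D.L₁, ((l, x), z) ∈ D.L₃ := by
  simp only [L₂, SetRel.comp, leftUnitRel, Set.mem_ofPred_eq, Prod.exists]
  constructor
  · rintro ⟨a, b, ⟨h, rfl⟩, h'⟩; exact ⟨a, h, h'⟩
  · rintro ⟨a, h, h'⟩; exact ⟨a, x, ⟨h, rfl⟩, h'⟩

theorem mem_L₂' {x z : 𝒢} : (x, z) ∈ D.L₂' ↔ ∃ l ∈ D.L₁, ((x, l), z) ∈ D.L₃ := by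
  simp only [L₂', SetRel.comp, rightUnitRel, Set.mem_ofPred_eq, Prod.exists]
  constructor
  · rintro ⟨a, b, ⟨rfl, h⟩, h'⟩; exact ⟨b, h, h'⟩
  · rintro ⟨a, h, h'⟩; exact ⟨x, a, ⟨rfl, h⟩, h'⟩

theorem mem_assocLeft {x y z w : 𝒢} :
    (((x, y), z), w) ∈ D.assocLeft ↔ ∃ p, ((x, y), p) ∈ D.L₃ ∧ ((p, z), w) ∈ D.L₃ := by
  simp [assocLeft, SetRel.comp, Function.graph, prodRel]

theorem mem_assocRight {x y z w : 𝒢} :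
    (((x, y), z), w) ∈ D.assocRight ↔ ∃ p, ((y, z), p) ∈ D.L₃ ∧ ((x, p), w) ∈ D.L₃ := by
  simp [assocRight, SetRel.comp, Function.graph, prodRel]

theorem mem_C {y : 𝒢} : y ∈ D.C ↔ ∃ x, (x, y) ∈ D.L₂ := by
  simp [C, SetRel.image]

variable (hD : D.IsRelationalSymplecticGroupoid)
include hD

namespace IsRelationalSymplecticGroupoid

theorem mem_L₃_iff_mem_L {x y z : 𝒢} : ((x, y), z) ∈ D.L₃ ↔ ((x, y), D.I z) ∈ D.L := by
  rw [mem_L₃]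
  constructor
  · rintro ⟨w, h, rfl⟩; rwa [hD.involutive]
  · intro h; exact ⟨_, h, hD.involutive _⟩

theorem L₃_anti {x y z : 𝒢} (h : ((x, y), z) ∈ D.L₃) : ((D.I y, D.I x), D.I z) ∈ D.L₃ := by
  rw [hD.L₃_eq, mem_L₃'] at h
  rwa [hD.mem_L₃_iff_mem_L, hD.involutive]

/-- Left division: `xy = z` gives `x⁻¹z = y`. Cyclic symmetry turns the triple into `z⁻¹x = y⁻¹`,
and inverting this product gives the claim. -/
theorem L₃_div {x y z : 𝒢} (h : ((x, y), z) ∈ D.L₃) : ((D.I x, z), y) ∈ D.L₃ := by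
  have h1 : ((D.I z, x), D.I y) ∈ D.L₃ := by
    rw [hD.mem_L₃_iff_mem_L, hD.involutive]
    rw [hD.mem_L₃_iff_mem_L] at h
    exact hD.cyclic _ _ _ (hD.cyclic _ _ _ h)
  have h2 := hD.L₃_anti h1
  rwa [hD.involutive, hD.involutive] at h2

theorem L₂_symm {x y : 𝒢} (h : (x, y) ∈ D.L₂) : (y, x) ∈ D.L₂ := by
  rw [← hD.L₂_inv]; exact h

theorem L₃_trans_L₂ {p : 𝒢 × 𝒢} {z z' : 𝒢} (h : (p, z) ∈ D.L₃) (h' : (z, z') ∈ D.L₂) :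
    (p, z') ∈ D.L₃ := by
  rw [← hD.L₂_L₃]; exact ⟨z, h, h'⟩

theorem L₂_trans_L₃ {x x' y y' z : 𝒢} (hx : (x, x') ∈ D.L₂) (hy : (y, y') ∈ D.L₂)
    (h : ((x', y'), z) ∈ D.L₃) : ((x, y), z) ∈ D.L₃ := by
  rw [← hD.L₃_L₂]; exact ⟨(x', y'), ⟨hx, hy⟩, h⟩

theorem L₂_trans {x y z : 𝒢} (h : (x, y) ∈ D.L₂) (h' : (y, z) ∈ D.L₂) : (x, z) ∈ D.L₂ := by
  obtain ⟨l, hl, h⟩ := mem_L₂.1 h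
  exact mem_L₂.2 ⟨l, hl, hD.L₃_trans_L₂ h h'⟩

theorem L₂_refl {x : 𝒢} (h : x ∈ D.C) : (x, x) ∈ D.L₂ := by
  obtain ⟨y, h⟩ := mem_C.1 h
  exact hD.L₂_trans (hD.L₂_symm h) h

theorem mem_C_of_L₂ {x y : 𝒢} (h : (x, y) ∈ D.L₂) : x ∈ D.C ∧ y ∈ D.C :=
  ⟨mem_C.2 ⟨_, hD.L₂_symm h⟩, mem_C.2 ⟨_, h⟩⟩

theorem L₃_subset {x y z : 𝒢} (h : ((x, y), z) ∈ D.L₃) : x ∈ D.C ∧ y ∈ D.C ∧ z ∈ D.C := by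
  have h1 := h
  rw [← hD.L₃_L₂] at h
  obtain ⟨⟨x', y'⟩, ⟨hx, hy⟩, -⟩ := h
  rw [← hD.L₂_L₃] at h1
  obtain ⟨z', -, hz⟩ := h1
  exact ⟨(hD.mem_C_of_L₂ hx).1, (hD.mem_C_of_L₂ hy).1, (hD.mem_C_of_L₂ hz).2⟩

theorem L₁_subset_C {l : 𝒢} (hl : l ∈ D.L₁) : l ∈ D.C := by
  rw [← hD.L₂_L₁] at hl
  obtain ⟨x, -, h⟩ := hl
  exact mem_C.2 ⟨x, h⟩

/-- `L₂` is already an equivalence relation on `C`, which contains `L₁`, so passing to the generated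
equivalence adds nothing. -/
theorem cls_eq_iff {l l' : D.L₁} : D.cls l = D.cls l' ↔ ((l : 𝒢), (l' : 𝒢)) ∈ D.L₂ := by
  refine ⟨fun h => ?_, fun h => Quot.sound h⟩
  have key := Quot.eqvGen_exact h
  clear h
  induction key with
  | rel _ _ h => exact h
  | refl x => exact hD.L₂_refl (hD.L₁_subset_C x.2)
  | symm _ _ _ ih => exact hD.L₂_symm ih
  | trans _ _ _ _ _ ih ih' => exact hD.L₂_trans ih ih'

/-- The normal form of the source relation, free of the choices of representative and product.
Invariance under `L₂` replaces the witness `l'` by `l`; the resulting product `g` of `l` and `x` is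
`L₂`-related to `x`, so it can be replaced by `x`. -/
theorem mem_S_iff {x : 𝒢} (l : D.L₁) :
    (x, D.cls l) ∈ D.S ↔ (((l : 𝒢), x), x) ∈ D.L₃ := by
  constructor
  · rintro ⟨hx, l', hl, g, hg⟩
    have h1 := hD.L₂_trans_L₃ (hD.L₂_symm (hD.cls_eq_iff.1 hl)) (hD.L₂_refl hx) hg
    exact hD.L₃_trans_L₂ h1 (hD.L₂_symm (mem_L₂.2 ⟨_, l.2, h1⟩))
  · intro h
    exact ⟨(hD.L₃_subset h).2.1, l, rfl, x, h⟩

theorem mem_T_iff {x : 𝒢} (l : D.L₁) :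
    (x, D.cls l) ∈ D.T ↔ ((x, (l : 𝒢)), x) ∈ D.L₃ := by
  constructor
  · rintro ⟨hx, l', hl, g, hg⟩
    have h1 := hD.L₂_trans_L₃ (hD.L₂_refl hx) (hD.L₂_symm (hD.cls_eq_iff.1 hl)) hg
    refine hD.L₃_trans_L₂ h1 (hD.L₂_symm ?_)
    rw [hD.L₂_eq]
    exact mem_L₂'.2 ⟨_, l.2, h1⟩
  · intro h
    exact ⟨(hD.L₃_subset h).1, l, rfl, x, h⟩

/-- Reflexivity of `L₂` at `l` yields a unit `l'` with `(l', l, l)` in `L₃`. Since `l` is a unit as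
well, the same triple, read with `l` as right unit, shows that `l'` is equivalent to `l`. -/
theorem mem_S_self (l : D.L₁) : ((l : 𝒢), D.cls l) ∈ D.S := by
  have h := hD.L₂_refl (hD.L₁_subset_C l.2)
  obtain ⟨l', hl', h⟩ := mem_L₂.1 h
  have : (l', (l : 𝒢)) ∈ D.L₂ := by rw [hD.L₂_eq]; exact mem_L₂'.2 ⟨_, l.2, h⟩
  have h2 : D.cls ⟨l', hl'⟩ = D.cls l := hD.cls_eq_iff.2 this
  rw [← h2]
  exact (hD.mem_S_iff _).2 h

/-- A product has the source of its left factor: `(lx)y = l(xy)`, so a left unit of `x` is one of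
`xy`. -/
theorem mem_S_of_L₃ {x y z : 𝒢} (h : ((x, y), z) ∈ D.L₃) {m : D.Base} (hx : (x, m) ∈ D.S) :
    (z, m) ∈ D.S := by
  obtain ⟨l, rfl⟩ := Quot.exists_rep m
  have h1 := (hD.mem_S_iff l).1 hx
  have h2 : ((((l : 𝒢), x), y), z) ∈ D.assocLeft := mem_assocLeft.2 ⟨x, h1, h⟩
  rw [hD.assoc, mem_assocRight] at h2
  obtain ⟨p, -, hp⟩ := h2
  have hpz : (p, z) ∈ D.L₂ := mem_L₂.2 ⟨l, l.2, hp⟩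
  exact (hD.mem_S_iff l).2
    (hD.L₂_trans_L₃ (hD.L₂_refl (hD.L₁_subset_C l.2)) (hD.L₂_symm hpz) hp)

/-- Composability forces target and source to match: since `(xl)y = x(ly)`, the product of `l` and
`y` exists. -/
theorem mem_S_of_L₃_of_mem_T {x y z : 𝒢} (h : ((x, y), z) ∈ D.L₃) {m : D.Base}
    (hx : (x, m) ∈ D.T) : (y, m) ∈ D.S := by
  obtain ⟨l, rfl⟩ := Quot.exists_rep m
  have h1 := (hD.mem_T_iff l).1 hx
  have h2 : (((x, (l : 𝒢)), y), z) ∈ D.assocLeft := mem_assocLeft.2 ⟨x, h1, h⟩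
  rw [hD.assoc, mem_assocRight] at h2
  obtain ⟨p, hp, -⟩ := h2
  exact ⟨(hD.L₃_subset h).2.1, l, rfl, p, hp⟩

theorem I_mem_L₁ {l : 𝒢} (hl : l ∈ D.L₁) : D.I l ∈ D.L₁ := by
  obtain ⟨x, hx⟩ := mem_L₁.1 hl
  have := hD.L₃_anti hx
  rw [hD.involutive] at this
  exact mem_L₁.2 ⟨x, this⟩

/-- A unit is equivalent to its inverse: dividing `l · l = l` on the left by `l` exhibits `l` as a
right translate of `I l` by a unit. Hence inversion acts trivially on the base and exchanges source
and target. -/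
theorem I_L₂_self (l : D.L₁) : (D.I l, (l : 𝒢)) ∈ D.L₂ := by
  have h := (hD.mem_S_iff l).1 (hD.mem_S_self l)
  rw [hD.L₂_eq]
  exact mem_L₂'.2 ⟨l, l.2, hD.L₃_div h⟩

theorem mem_S_I_of_mem_T {x : 𝒢} {m : D.Base} (h : (x, m) ∈ D.T) : (D.I x, m) ∈ D.S := by
  obtain ⟨l, rfl⟩ := Quot.exists_rep m
  have h1 := hD.L₃_anti ((hD.mem_T_iff l).1 h)
  refine (hD.mem_S_iff l).2 ?_
  exact hD.L₂_trans_L₃ (hD.L₂_symm (hD.I_L₂_self l)) (hD.L₂_refl (hD.L₃_subset h1).2.1) h1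

theorem mem_T_of_mem_S_I {x : 𝒢} {m : D.Base} (h : (D.I x, m) ∈ D.S) : (x, m) ∈ D.T := by
  obtain ⟨l, rfl⟩ := Quot.exists_rep m
  have h1 := hD.L₃_anti ((hD.mem_S_iff l).1 h)
  rw [hD.involutive] at h1
  refine (hD.mem_T_iff l).2 ?_
  exact hD.L₂_trans_L₃ (hD.L₂_refl (hD.L₃_subset h1).1) (hD.L₂_symm (hD.I_L₂_self l)) h1

theorem mem_T_self (l : D.L₁) : ((l : 𝒢), D.cls l) ∈ D.T := by
  refine hD.mem_T_of_mem_S_I ?_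
  have h : D.cls ⟨D.I l, hD.I_mem_L₁ l.2⟩ = D.cls l := hD.cls_eq_iff.2 (hD.I_L₂_self l)
  rw [← h]
  exact hD.mem_S_self ⟨D.I l, hD.I_mem_L₁ l.2⟩

theorem I_mem_C {x : 𝒢} (hx : x ∈ D.C) : D.I x ∈ D.C := by
  have h : (x, D.I x) ∈ D.L₂.comp (Function.graph D.I) := ⟨x, hD.L₂_refl hx, rfl⟩
  rw [hD.I_L₂] at h
  obtain ⟨y, hy, h⟩ := h
  have hy : D.I x = y := hy
  rw [hy]; exact (hD.mem_C_of_L₂ h).1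

end IsRelationalSymplecticGroupoid
end Algebra
end RSG.RelData

namespace RSG

section Calculus

variable {F : Type*} [NormedAddCommGroup F] [NormedSpace ℝ F]

/-! ### Calculus in Banach spaces -/

variable (F) in
/-- An alternating form of degree two as a bilinear form. -/
def bilinOfForm : (F [⋀^Fin 2]→L[ℝ] ℝ) →L[ℝ] F →L[ℝ] F →L[ℝ] ℝ :=
  (ContinuousLinearMap.compL ℝ F (F [⋀^Fin 1]→L[ℝ] ℝ) (F →L[ℝ] ℝ)
    (ContinuousAlternatingMap.ofSubsingletonLIE (𝕜 := ℝ) (E := F) (F := ℝ) (0 : Fin 1)).symm.toContinuousLinearEquiv) ∘L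
  (ContinuousAlternatingMap.curryLeftLI (𝕜 := ℝ) (E := F) (F := ℝ) (n := 1)).toContinuousLinearMap

@[simp]
theorem bilinOfForm_apply (σ : F [⋀^Fin 2]→L[ℝ] ℝ) (v w : F) : bilinOfForm F σ v w = σ ![v, w] := by
  change σ (Matrix.vecCons v fun _ => w) = σ ![v, w]
  congr 1
  ext i; fin_cases i <;> rfl

theorem hasFDerivAt_bilinOfForm {E : Type*} [NormedAddCommGroup E] [NormedSpace ℝ E]
    {σ : E → F [⋀^Fin 2]→L[ℝ] ℝ} {x : E} (hσ : DifferentiableAt ℝ σ x) :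
    HasFDerivAt (fun y => bilinOfForm F (σ y)) (bilinOfForm F ∘L fderiv ℝ σ x) x :=
  have h : HasFDerivAt (bilinOfForm F) (bilinOfForm F) (σ x) := ContinuousLinearMap.hasFDerivAt _
  HasFDerivAt.comp (𝕜 := ℝ) (F := F [⋀^Fin 2]→L[ℝ] ℝ) (G := F →L[ℝ] F →L[ℝ] ℝ) x h hσ.hasFDerivAt

theorem contDiffAt_bilinOfForm {E : Type*} [NormedAddCommGroup E] [NormedSpace ℝ E]
    {σ : E → F [⋀^Fin 2]→L[ℝ] ℝ} {x : E} {n : WithTop ℕ∞} (hσ : ContDiffAt ℝ n σ x) :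
    ContDiffAt ℝ n (fun y => bilinOfForm F (σ y)) x :=
  have h : ContDiff ℝ n (bilinOfForm F) := ContinuousLinearMap.contDiff _
  ContDiffAt.comp (𝕜 := ℝ) (F := F [⋀^Fin 2]→L[ℝ] ℝ) (G := F →L[ℝ] F →L[ℝ] ℝ) x h.contDiffAt hσ

theorem form_swap {V : Type*} [AddCommGroup V] [Module ℝ V] [TopologicalSpace V]
    (σ : V [⋀^Fin 2]→L[ℝ] ℝ) (v w : V) : σ ![v, w] = -σ ![w, v] := by
  have := σ.toAlternatingMap.map_swap ![w, v] (i := 0) (j := 1) (by decide)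
  rw [← ContinuousAlternatingMap.coe_toAlternatingMap, ← this]
  congr 1
  ext i; fin_cases i <;> simp

/-- Differentiating `σ(Xᵢ, ·) = dfᵢ` expresses each double bracket through `Dσ` and second
derivatives of the `fᵢ`. In the cyclic sum the latter cancel by symmetry and the former add up to
`dσ(X₀, X₁, X₂)`. No Lie bracket and no nondegeneracy enters, so presymplectic forms are allowed. -/
theorem jacobi_of_closed {σ : F → F [⋀^Fin 2]→L[ℝ] ℝ} {x : F} (hσ : DifferentiableAt ℝ σ x)
    (hd : extDeriv σ x = 0) {f : Fin 3 → F → ℝ} {X : Fin 3 → F → F}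
    (hf : ∀ i, ContDiffAt ℝ 2 (f i) x) (hX : ∀ i, DifferentiableAt ℝ (X i) x)
    (h : ∀ i, ∀ᶠ y in 𝓝 x, ∀ v, σ y ![X i y, v] = fderiv ℝ (f i) y v) :
    fderiv ℝ (fun y => fderiv ℝ (f 2) y (X 1 y)) x (X 0 x) +
      fderiv ℝ (fun y => fderiv ℝ (f 0) y (X 2 y)) x (X 1 x) +
      fderiv ℝ (fun y => fderiv ℝ (f 1) y (X 0 y)) x (X 2 x) = 0 := by
  have hf' : ∀ i, DifferentiableAt ℝ (fderiv ℝ (f i)) x := fun i =>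
    ((hf i).fderiv_right (m := 1) (by norm_num)).differentiableAt (by norm_num)
  have hsymm : ∀ i u v, fderiv ℝ (fderiv ℝ (f i)) x u v = fderiv ℝ (fderiv ℝ (f i)) x v u :=
    fun i u v => ((hf i).isSymmSndFDerivAt (by simp)).eq u v
  set B : F → F →L[ℝ] F →L[ℝ] ℝ := fun y => bilinOfForm F (σ y) with hB
  have hBd : HasFDerivAt B ((bilinOfForm F) ∘L fderiv ℝ σ x) x :=
    hasFDerivAt_bilinOfForm hσ
  have hx : ∀ i v, σ x ![X i x, v] = fderiv ℝ (f i) x v := fun i => (h i).self_of_nhds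
  have key : ∀ i u w, fderiv ℝ σ x u ![X i x, w] + σ x ![fderiv ℝ (X i) x u, w] =
      fderiv ℝ (fderiv ℝ (f i)) x u w := by
    intro i u w
    have h1 : HasFDerivAt (fun y => B y (X i y)) _ x := hBd.clm_apply (hX i).hasFDerivAt
    have h2 : (fun y => B y (X i y)) =ᶠ[𝓝 x] fderiv ℝ (f i) := by
      filter_upwards [h i] with y hy
      ext v
      simpa [hB] using hy v
    have h3 := (h1.congr_of_eventuallyEq h2.symm).unique (hf' i).hasFDerivAt
    have := congrArg (fun T => T u w) h3
    simpa [hB, add_comm] using this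
  have key2 : ∀ i j k, fderiv ℝ (fun y => fderiv ℝ (f i) y (X j y)) x (X k x) =
      fderiv ℝ σ x (X k x) ![X j x, X i x] - fderiv ℝ (fderiv ℝ (f j)) x (X k x) (X i x) +
        fderiv ℝ (fderiv ℝ (f i)) x (X k x) (X j x) := by
    intro i j k
    have h1 := ((hf' i).hasFDerivAt.clm_apply (hX j).hasFDerivAt).fderiv
    rw [h1]
    simp only [add_apply, ContinuousLinearMap.comp_apply,
      ContinuousLinearMap.flip_apply]
    rw [← key j, ← hx i, form_swap _ (X i x)]
    ring
  have h4 : fderiv ℝ σ x (X 0 x) ![X 1 x, X 2 x] + fderiv ℝ σ x (X 1 x) ![X 2 x, X 0 x] +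
      fderiv ℝ σ x (X 2 x) ![X 0 x, X 1 x] = 0 := by
    have := congrArg (fun T => T ![X 0 x, X 1 x, X 2 x]) hd
    simp only [extDeriv, ContinuousAlternatingMap.alternatizeUncurryFin_apply] at this
    replace this := (Fin.sum_univ_three fun i : Fin 3 => (-1) ^ (i : ℕ) •
      fderiv ℝ σ x (![X 0 x, X 1 x, X 2 x] i) (i.removeNth ![X 0 x, X 1 x, X 2 x])).symm.trans this
    have e0 : (Fin.removeNth 0 ![X 0 x, X 1 x, X 2 x]) = ![X 1 x, X 2 x] := by
      ext i; fin_cases i <;> rfl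
    have e1 : (Fin.removeNth 1 ![X 0 x, X 1 x, X 2 x]) = ![X 0 x, X 2 x] := by
      ext i; fin_cases i <;> rfl
    have e2 : (Fin.removeNth 2 ![X 0 x, X 1 x, X 2 x]) = ![X 0 x, X 1 x] := by
      ext i; fin_cases i <;> rfl
    rw [e0, e1, e2] at this
    rw [form_swap _ (X 2 x) (X 0 x)]
    simpa using this
  rw [key2, key2, key2, hsymm 1 (X 0 x), hsymm 2 (X 1 x), hsymm 0 (X 2 x)]
  linear_combination h4

theorem range_eq_top_of_separating {V P : Type*} [AddCommGroup V] [Module ℝ V]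
    [FiniteDimensional ℝ V] [AddCommGroup P] [Module ℝ P] (Γ : P →ₗ[ℝ] Module.Dual ℝ V)
    (h : ∀ w, (∀ ξ, Γ ξ w = 0) → w = 0) : Function.Surjective Γ := by
  rw [← LinearMap.range_eq_top]
  have h1 : (LinearMap.range Γ).dualCoannihilator = ⊥ := by
    rw [eq_bot_iff]
    intro w hw
    rw [Submodule.mem_dualCoannihilator] at hw
    exact h w fun ξ => hw _ ⟨ξ, rfl⟩
  rw [← Subspace.dualCoannihilator_dualAnnihilator_eq (W := LinearMap.range Γ), h1]
  simp

/-- The vectors `d x ξ` supply functionals that vanish on `ker S x`; at `x₀` they separate points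
modulo that kernel, hence give all functionals on `V`. Solvability at `x₀` persists nearby, and
smoothly so, because invertible operators form an open set on which inversion is smooth. -/
theorem exists_hamiltonian [CompleteSpace F] {V P : Type*} [NormedAddCommGroup V]
    [NormedSpace ℝ V] [FiniteDimensional ℝ V] [NormedAddCommGroup P] [NormedSpace ℝ P]
    {σ : F → F →L[ℝ] F →L[ℝ] ℝ} {d : F → P →L[ℝ] F} {S : F → F →L[ℝ] V} {x₀ : F}
    (hσ : ContDiffAt ℝ ∞ σ x₀) (hd : ContDiffAt ℝ ∞ d x₀) (hS : ContDiffAt ℝ ∞ S x₀)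
    (hsurj : Function.Surjective (S x₀))
    (hker : ∀ᶠ x in 𝓝 x₀, ∀ ξ v, S x v = 0 → σ x (d x ξ) v = 0)
    (hker' : ∀ v, (∀ ξ, σ x₀ (d x₀ ξ) v = 0) → S x₀ v = 0) :
    ∃ X : F → (V →L[ℝ] ℝ) →L[ℝ] F, ContDiffAt ℝ ∞ X x₀ ∧
      ∀ᶠ x in 𝓝 x₀, ∀ α v, σ x (X x α) v = α (S x v) := by
  obtain ⟨R, hR⟩ : ∃ R : V →L[ℝ] F, S x₀ ∘L R = ContinuousLinearMap.id ℝ V := by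
    obtain ⟨r, hr⟩ := (S x₀).toLinearMap.exists_rightInverse_of_surjective
      (LinearMap.range_eq_top.2 hsurj)
    refine ⟨LinearMap.toContinuousLinearMap r, ?_⟩
    ext v
    exact LinearMap.congr_fun hr v
  have hR' : ∀ w, S x₀ (R w) = w := fun w => DFunLike.congr_fun hR w
  let Γ : P →ₗ[ℝ] Module.Dual ℝ V :=
    { toFun := fun ξ => ((σ x₀ (d x₀ ξ)) ∘L R).toLinearMap
      map_add' := fun a b => by ext; simp
      map_smul' := fun a b => by ext; simp }
  have hΓ : Function.Surjective Γ := by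
    refine range_eq_top_of_separating Γ fun w hw => ?_
    rw [← hR' w]
    exact hker' _ hw
  obtain ⟨ξ₀, hξ₀⟩ := Γ.exists_rightInverse_of_surjective (LinearMap.range_eq_top.2 hΓ)
  let Ξ : (V →L[ℝ] ℝ) →L[ℝ] P := LinearMap.toContinuousLinearMap
    (ξ₀ ∘ₗ (LinearMap.toContinuousLinearMap (𝕜 := ℝ) (E := V) (F' := ℝ)).symm.toLinearMap)
  have hΞ : ∀ β w, σ x₀ (d x₀ (Ξ β)) (R w) = β w := fun β w =>
    DFunLike.congr_fun (LinearMap.congr_fun hξ₀ β.toLinearMap) w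
  -- `A x` records the functional produced by `Ξ β` on the fixed complement `range R` of `ker S x₀`.
  -- It is the identity at `x₀`, so it can be inverted nearby.
  let A : F → (V →L[ℝ] ℝ) →L[ℝ] (V →L[ℝ] ℝ) := fun x =>
    (ContinuousLinearMap.compL ℝ V F ℝ).flip R ∘L σ x ∘L d x ∘L Ξ
  have hA : ContDiffAt ℝ ∞ A x₀ :=
    contDiffAt_const.clm_comp (hσ.clm_comp (hd.clm_comp contDiffAt_const))
  have hA1 : A x₀ = 1 := by
    ext β w
    simpa [A] using hΞ β w
  -- Away from `x₀` the map `R` is no longer a right inverse of `S x`; the invertible `K x` measures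
  -- the defect, and the functional to be matched on `range R` is `α ∘ K x`.
  let K : F → V →L[ℝ] V := fun x => S x ∘L R
  have hK : ContDiffAt ℝ ∞ K x₀ := hS.clm_comp contDiffAt_const
  have hK1 : K x₀ = 1 := hR
  have hinv : ContDiffAt ℝ ∞ (fun x => Ring.inverse (A x)) x₀ := by
    have : ContDiffAt ℝ ∞ Ring.inverse (A x₀) := by
      rw [hA1]
      exact contDiffAt_ringInverse ℝ (R := (V →L[ℝ] ℝ) →L[ℝ] (V →L[ℝ] ℝ)) 1
    exact this.comp x₀ hA
  have hAu : ∀ᶠ x in 𝓝 x₀, IsUnit (A x) :=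
    hA.continuousAt (by
      rw [hA1]; exact (Units.isOpen (R := (V →L[ℝ] ℝ) →L[ℝ] (V →L[ℝ] ℝ))).mem_nhds isUnit_one)
  have hKu : ∀ᶠ x in 𝓝 x₀, IsUnit (K x) :=
    hK.continuousAt (by
      rw [hK1]; exact (Units.isOpen (R := V →L[ℝ] V)).mem_nhds isUnit_one)
  refine ⟨fun x => d x ∘L Ξ ∘L Ring.inverse (A x) ∘L (ContinuousLinearMap.compL ℝ V V ℝ).flip (K x),
    hd.clm_comp (contDiffAt_const.clm_comp (hinv.clm_comp ?_)), ?_⟩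
  · exact (ContinuousLinearMap.contDiff _).contDiffAt.comp x₀ hK
  filter_upwards [hker, hAu, hKu] with x hx hxA hxK α v
  set Y := (d x ∘L Ξ ∘L Ring.inverse (A x) ∘L (ContinuousLinearMap.compL ℝ V V ℝ).flip (K x)) α
    with hY
  have h1 : ∀ w, σ x Y (R w) = α (S x (R w)) := by
    intro w
    have h2 : A x (Ring.inverse (A x) (α ∘L K x)) = α ∘L K x := by
      have := Ring.mul_inverse_cancel _ hxA
      exact DFunLike.congr_fun this (α ∘L K x)
    exact DFunLike.congr_fun h2 w
  -- Invertibility of `K x` makes `range R` a complement of `ker S x`. The identity is known on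
  -- `range R`, and both sides vanish on the kernel.
  obtain ⟨k, hk⟩ := hxK.exists_right_inv
  have h3 : S x (R (k (S x v))) = S x v := DFunLike.congr_fun hk (S x v)
  have h4 : σ x Y (v - R (k (S x v))) = 0 := hx _ _ (by rw [map_sub, h3, sub_self])
  rw [map_sub, sub_eq_zero, h1, h3] at h4
  exact h4

/-- The inverse function theorem is applied to `q` restricted to a finite-dimensional affine slice
through `x₀` that is transverse to the fibre. -/
theorem exists_local_section [CompleteSpace F] {V : Type*} [NormedAddCommGroup V]
    [NormedSpace ℝ V] [FiniteDimensional ℝ V] {q : F → V} {U : Set F} (hU : IsOpen U)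
    (hq : ContDiffOn ℝ ∞ q U) {x₀ : F} (hx₀ : x₀ ∈ U) (hsurj : Function.Surjective (fderiv ℝ q x₀)) :
    ∃ (r : V → F) (W : Set V), IsOpen W ∧ q x₀ ∈ W ∧ ContDiffOn ℝ ∞ r W ∧ r (q x₀) = x₀ ∧
      ∀ a ∈ W, r a ∈ U ∧ q (r a) = a := by
  have : CompleteSpace V := FiniteDimensional.complete ℝ V
  obtain ⟨ρ, hρ⟩ := (fderiv ℝ q x₀).toLinearMap.exists_rightInverse_of_surjective
    (LinearMap.range_eq_top.2 hsurj)
  let R : V →L[ℝ] F := LinearMap.toContinuousLinearMap ρ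
  let ι : V → F := fun a => x₀ + R a
  have hι : ContDiff ℝ ∞ ι := contDiff_const.add R.contDiff
  have hι0 : ι 0 = x₀ := by simp [ι]
  let Θ : V → V := fun a => q (ι a)
  let U' : Set V := ι ⁻¹' U
  have hU' : IsOpen U' := hU.preimage hι.continuous
  have h0 : (0 : V) ∈ U' := by simpa [U', hι0] using hx₀
  have hΘ : ContDiffOn ℝ ∞ Θ U' := hq.comp hι.contDiffOn (fun _ h => h)
  have hΘ0 : fderiv ℝ Θ 0 = 1 := by
    have h1 : HasFDerivAt q (fderiv ℝ q x₀) (ι 0) := by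
      rw [hι0]
      exact ((hq.contDiffAt (hU.mem_nhds hx₀)).differentiableAt (by simp)).hasFDerivAt
    have h2 : HasFDerivAt ι R 0 := R.hasFDerivAt.const_add x₀
    rw [show fderiv ℝ Θ 0 = _ from (h1.comp (0 : V) h2).fderiv]
    ext v
    exact LinearMap.congr_fun hρ v
  have hdc : ContinuousOn (fderiv ℝ Θ) U' := hΘ.continuousOn_fderiv_of_isOpen hU' (by simp)
  -- Restricting to points with invertible derivative makes the inverse smooth on the whole
  -- neighbourhood `W` and not only at the base point.
  let U'' : Set V := U' ∩ fderiv ℝ Θ ⁻¹' {T | IsUnit T}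
  have hU'' : IsOpen U'' := hdc.isOpen_inter_preimage hU' Units.isOpen
  have h0'' : (0 : V) ∈ U'' := ⟨h0, by simp [hΘ0]⟩
  have hat : ∀ a ∈ U', ContDiffAt ℝ ∞ Θ a := fun a ha => hΘ.contDiffAt (hU'.mem_nhds ha)
  have hder : HasFDerivAt Θ ((ContinuousLinearEquiv.refl ℝ V : V ≃L[ℝ] V) : V →L[ℝ] V) 0 := by
    have := ((hat 0 h0).differentiableAt (by simp)).hasFDerivAt
    rw [hΘ0] at this
    exact this
  let e := (hat 0 h0).toOpenPartialHomeomorph Θ hder (by simp)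
  have hecoe : (e : V → V) = Θ := rfl
  have he0 : (0 : V) ∈ e.source := (hat 0 h0).mem_toOpenPartialHomeomorph_source hder (by simp)
  let W : Set V := e.target ∩ e.symm ⁻¹' U''
  have hW : IsOpen W := e.isOpen_inter_preimage_symm hU''
  have hsymm0 : e.symm (q x₀) = 0 := by
    have : q x₀ = e 0 := by rw [hecoe]; simp [Θ, hι0]
    rw [this, e.left_inv he0]
  refine ⟨fun a => ι (e.symm a), W, hW, ⟨?_, ?_⟩, ?_, ?_, ?_⟩
  · have := e.map_source he0
    rwa [hecoe, show Θ 0 = q x₀ by simp [Θ, hι0]] at this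
  · simp only [Set.mem_preimage, hsymm0]; exact h0''
  · intro a ha
    refine ContDiffAt.contDiffWithinAt ?_
    refine hι.contDiffAt.comp a ?_
    obtain ⟨T, hT⟩ := ha.2.2
    have hT' : HasFDerivAt e
        ((ContinuousLinearEquiv.unitsEquiv ℝ V T : V ≃L[ℝ] V) : V →L[ℝ] V) (e.symm a) := by
      have := ((hat _ ha.2.1).differentiableAt (by simp)).hasFDerivAt
      rw [← hT] at this
      exact this
    exact e.contDiffAt_symm ha.1 hT' (hat _ ha.2.1)
  · simp only [hsymm0, hι0]
  · intro a ha
    exact ⟨ha.2.1, e.right_inv ha.1⟩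

end Calculus
end RSG

namespace RSG

section Manifolds

variable {E : Type u} [NormedAddCommGroup E] [NormedSpace ℝ E]
  {𝒢 : Type u} [TopologicalSpace 𝒢] [ChartedSpace E 𝒢]

/-! ### Charts, lifts and pullbacks on Banach manifolds -/

theorem two_le_infty : (2 : WithTop ℕ∞) ≤ ∞ :=
  WithTop.coe_le_coe.2 (le_top : (2 : ℕ∞) ≤ ⊤)

theorem contMDiffAt_chart_symm {X : Type*} [TopologicalSpace X] [ChartedSpace E X]
    [IsManifold 𝓘(ℝ, E) ∞ X] (y : X) {x : E} (hx : x ∈ (chartAt E y).target) :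
    ContMDiffAt 𝓘(ℝ, E) 𝓘(ℝ, E) ∞ (chartAt E y).symm x :=
  contMDiffOn_chart_symm.contMDiffAt ((chartAt E y).open_target.mem_nhds hx)

theorem contMDiffAt_chart {X : Type*} [TopologicalSpace X] [ChartedSpace E X]
    [IsManifold 𝓘(ℝ, E) ∞ X] (y : X) {x : X} (hx : x ∈ (chartAt E y).source) :
    ContMDiffAt 𝓘(ℝ, E) 𝓘(ℝ, E) ∞ (chartAt E y) x :=
  contMDiffOn_chart.contMDiffAt ((chartAt E y).open_source.mem_nhds hx)

omit [NormedSpace ℝ E] in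
theorem chart_mem_target {X : Type*} [TopologicalSpace X] [ChartedSpace E X] (y : X) :
    chartAt E y y ∈ (chartAt E y).target :=
  (chartAt E y).map_source (mem_chart_source E y)

omit [NormedSpace ℝ E] in
theorem chart_symm_chart {X : Type*} [TopologicalSpace X] [ChartedSpace E X] (y : X) :
    (chartAt E y).symm (chartAt E y y) = y :=
  (chartAt E y).left_inv (mem_chart_source E y)

theorem surjective_mfderiv_chart_symm {X : Type*} [TopologicalSpace X] [ChartedSpace E X]
    [IsManifold 𝓘(ℝ, E) ∞ X] (y : X) {x : E} (hx : x ∈ (chartAt E y).target) :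
    Function.Surjective (mfderiv 𝓘(ℝ, E) 𝓘(ℝ, E) (chartAt E y).symm x) :=
  haveI : IsManifold 𝓘(ℝ, E) 1 X := IsManifold.of_le (n := ∞) (by simp)
  (mdifferentiable_chart (I := 𝓘(ℝ, E)) y).symm.mfderiv_surjective hx

theorem surjective_mfderiv_chart {X : Type*} [TopologicalSpace X] [ChartedSpace E X]
    [IsManifold 𝓘(ℝ, E) ∞ X] (y : X) {x : X} (hx : x ∈ (chartAt E y).source) :
    Function.Surjective (mfderiv 𝓘(ℝ, E) 𝓘(ℝ, E) (chartAt E y) x) :=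
  haveI : IsManifold 𝓘(ℝ, E) 1 X := IsManifold.of_le (n := ∞) (by simp)
  (mdifferentiable_chart (I := 𝓘(ℝ, E)) y).mfderiv_surjective hx

variable {N : BanachManifold.{u}} {φ : N.carrier → 𝒢}

theorem codChart_apply_of_isImmersionAt {y : N.carrier}
    (h : Manifold.IsImmersionAt 𝓘(ℝ, N.model) 𝓘(ℝ, E) ∞ φ y) {c : N.carrier}
    (hc : c ∈ h.domChart.source) : h.codChart (φ c) = h.equiv (h.domChart c, 0) := by
  have hc' : h.domChart c ∈ (h.domChart.extend 𝓘(ℝ, N.model)).target := by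
    simpa using h.domChart.map_source hc
  have := h.writtenInCharts hc'
  simpa [h.domChart.left_inv hc] using this

theorem exists_injOn_of_isImmersionAt {y : N.carrier}
    (h : Manifold.IsImmersionAt 𝓘(ℝ, N.model) 𝓘(ℝ, E) ∞ φ y) :
    ∃ U ∈ 𝓝 y, Set.InjOn φ U := by
  refine ⟨h.domChart.source, h.domChart.open_source.mem_nhds h.mem_domChart_source, ?_⟩
  intro a ha b hb hab
  have key := fun c hc => codChart_apply_of_isImmersionAt h (c := c) hc
  have h1 : h.equiv (h.domChart a, 0) = h.equiv (h.domChart b, 0) := by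
    rw [← key a ha, ← key b hb, hab]
  exact h.domChart.injOn ha hb (Prod.ext_iff.1 (h.equiv.injective h1)).1

theorem injective_mfderiv_of_isImmersionAt {y : N.carrier}
    (h : Manifold.IsImmersionAt 𝓘(ℝ, N.model) 𝓘(ℝ, E) ∞ φ y) :
    Function.Injective (mfderiv 𝓘(ℝ, N.model) 𝓘(ℝ, E) φ y) := by
  have key := fun c hc => codChart_apply_of_isImmersionAt h (c := c) hc
  let p : E → N.model := fun e => (h.equiv.symm e).1
  have hp : ContMDiff 𝓘(ℝ, E) 𝓘(ℝ, N.model) ∞ p :=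
    (ContinuousLinearMap.contDiff
      (ContinuousLinearMap.fst ℝ N.model h.complement ∘L
        (h.equiv.symm : E →L[ℝ] N.model × h.complement))).contMDiff
  have hφ : ContMDiffAt 𝓘(ℝ, N.model) 𝓘(ℝ, E) ∞ φ y := h.contMDiffAt
  have h1 : ContMDiffAt 𝓘(ℝ, E) 𝓘(ℝ, E) ∞ h.codChart (φ y) :=
    contMDiffAt_of_mem_maximalAtlas h.codChart_mem_maximalAtlas h.mem_codChart_source
  have hpφ : p (h.codChart (φ y)) = h.domChart y := by
    simp [p, key y h.mem_domChart_source]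
  have h2 : ContMDiffAt 𝓘(ℝ, N.model) 𝓘(ℝ, N.model) ∞ h.domChart.symm (p (h.codChart (φ y))) := by
    rw [hpφ]
    exact contMDiffAt_symm_of_mem_maximalAtlas h.domChart_mem_maximalAtlas
      (h.domChart.map_source h.mem_domChart_source)
  -- In adapted charts `φ` is the inclusion of a factor; projecting back gives a smooth local left
  -- inverse, whose derivative inverts that of `φ` on the left.
  let r : 𝒢 → N.carrier := fun x => h.domChart.symm (p (h.codChart x))
  have hr : ContMDiffAt 𝓘(ℝ, E) 𝓘(ℝ, N.model) ∞ r (φ y) :=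
    ContMDiffAt.comp (φ y) h2 (hp.contMDiffAt.comp (φ y) h1)
  have hid : (r ∘ φ) =ᶠ[𝓝 y] id := by
    filter_upwards [h.domChart.open_source.mem_nhds h.mem_domChart_source] with c hc
    simp [r, p, key c hc, h.domChart.left_inv hc]
  have h3 : mfderiv 𝓘(ℝ, N.model) 𝓘(ℝ, N.model) (r ∘ φ) y = ContinuousLinearMap.id ℝ _ := by
    rw [hid.mfderiv_eq]; exact mfderiv_id
  rw [mfderiv_comp y (hr.mdifferentiableAt (by simp)) (hφ.mdifferentiableAt (by simp))] at h3
  intro a b hab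
  have h4 : ∀ v, (mfderiv 𝓘(ℝ, E) 𝓘(ℝ, N.model) r (φ y))
      (mfderiv 𝓘(ℝ, N.model) 𝓘(ℝ, E) φ y v) = v := fun v => DFunLike.congr_fun h3 v
  rw [← h4 a, ← h4 b, hab]

/-- Lifts of maps with values in an immersed submanifold, in the chart of the prescribed value. -/
theorem IsImmersedSubmanifold.exists_lift {E' H' : Type u} [NormedAddCommGroup E']
    [NormedSpace ℝ E'] [TopologicalSpace H'] {J : ModelWithCorners ℝ E' H'} {X : Type u}
    [TopologicalSpace X] [ChartedSpace H' X] {φ : N.carrier → X} {A : Set X}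
    (h : IsImmersedSubmanifold J N φ A) {P : Type u} [NormedAddCommGroup P] [NormedSpace ℝ P]
    [CompleteSpace P] {U : Set P} {f : P → X} (hU : IsOpen U)
    (hf : ContMDiffOn 𝓘(ℝ, P) J ∞ f U) (hfA : Set.MapsTo f U A) {p : P} (hp : p ∈ U)
    {y : N.carrier} (hy : φ y = f p) :
    ∃ g : P → N.model, ContDiffAt ℝ ∞ g p ∧ g p = chartAt N.model y y ∧
      ∀ᶠ q in 𝓝 p, g q ∈ (chartAt N.model y).target ∧ φ ((chartAt N.model y).symm (g q)) = f q := by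
  obtain ⟨g, hg, hgp, hφg⟩ := h.lift P U f hU hf hfA p hp y hy
  refine ⟨fun q => chartAt N.model y (g q), ?_, by simp only [hgp], ?_⟩
  · rw [← contMDiffAt_iff_contDiffAt]
    have h1 := contMDiffAt_chart y (mem_chart_source N.model y)
    rw [← hgp] at h1
    rw [← hgp]
    exact ContMDiffAt.comp p h1 hg
  · have := hg.continuousAt.preimage_mem_nhds
      ((chartAt N.model y).open_source.mem_nhds (by rw [hgp]; exact mem_chart_source _ y))
    filter_upwards [hφg, this] with q hq hq'
    exact ⟨(chartAt N.model y).map_source hq', by rw [(chartAt N.model y).left_inv hq', hq]⟩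

theorem IsImmersedSubmanifold.contMDiff {E' H' : Type u} [NormedAddCommGroup E']
    [NormedSpace ℝ E'] [TopologicalSpace H'] {J : ModelWithCorners ℝ E' H'} {X : Type u}
    [TopologicalSpace X] [ChartedSpace H' X] {φ : N.carrier → X} {A : Set X}
    (h : IsImmersedSubmanifold J N φ A) : ContMDiff 𝓘(ℝ, N.model) J ∞ φ :=
  fun y => (h.immersion y).contMDiffAt

variable (EM : Type u) [NormedAddCommGroup EM] [NormedSpace ℝ EM] {M : Type u}
  [TopologicalSpace M] [ChartedSpace EM M]

/-- A map in the charts at the points `y` and `m`. -/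
def locRep (q : N.carrier → M) (y : N.carrier) (m : M) : N.model → EM :=
  fun x => chartAt EM m (q ((chartAt N.model y).symm x))

/-- The domain of definition of `locRep EM q y m`. -/
def locDom (q : N.carrier → M) (y : N.carrier) (m : M) : Set N.model :=
  (chartAt N.model y).target ∩ (chartAt N.model y).symm ⁻¹' (q ⁻¹' (chartAt EM m).source)

variable {EM}

section LocRep

variable [IsManifold 𝓘(ℝ, EM) ∞ M] {q : N.carrier → M}
  (hq : ContMDiff 𝓘(ℝ, N.model) 𝓘(ℝ, EM) ∞ q) {y : N.carrier} {m : M}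
include hq

omit [IsManifold 𝓘(ℝ, EM) ∞ M] in
theorem isOpen_locDom : IsOpen (locDom EM q y m) :=
  (chartAt N.model y).isOpen_inter_preimage_symm
    ((chartAt EM m).open_source.preimage hq.continuous)

omit hq [IsManifold 𝓘(ℝ, EM) ∞ M] [NormedSpace ℝ EM] in
theorem chart_mem_locDom (hy : q y ∈ (chartAt EM m).source) :
    chartAt N.model y y ∈ locDom EM q y m :=
  ⟨chart_mem_target y, by simpa [chart_symm_chart] using hy⟩

theorem contMDiffAt_locRep {x : N.model} (hx : x ∈ locDom EM q y m) :
    ContMDiffAt 𝓘(ℝ, N.model) 𝓘(ℝ, EM) ∞ (locRep EM q y m) x :=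
  ContMDiffAt.comp x (contMDiffAt_chart m hx.2)
    (ContMDiffAt.comp x hq.contMDiffAt (contMDiffAt_chart_symm y hx.1))

theorem contDiffAt_locRep {x : N.model} (hx : x ∈ locDom EM q y m) :
    ContDiffAt ℝ ∞ (locRep EM q y m) x :=
  contMDiffAt_iff_contDiffAt.1 (contMDiffAt_locRep hq hx)

theorem fderiv_locRep {x : N.model} (hx : x ∈ locDom EM q y m) (v : N.model) :
    fderiv ℝ (locRep EM q y m) x v =
      mfderiv 𝓘(ℝ, EM) 𝓘(ℝ, EM) (chartAt EM m) (q ((chartAt N.model y).symm x))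
        (mfderiv 𝓘(ℝ, N.model) 𝓘(ℝ, EM) q ((chartAt N.model y).symm x)
          (mfderiv 𝓘(ℝ, N.model) 𝓘(ℝ, N.model) (chartAt N.model y).symm x v)) := by
  have h1 : MDifferentiableAt 𝓘(ℝ, N.model) 𝓘(ℝ, N.model) (chartAt N.model y).symm x :=
    (contMDiffAt_chart_symm y hx.1).mdifferentiableAt (by simp)
  have h2 : MDifferentiableAt 𝓘(ℝ, N.model) 𝓘(ℝ, EM) q ((chartAt N.model y).symm x) :=
    hq.contMDiffAt.mdifferentiableAt (by simp)
  have h3 : MDifferentiableAt 𝓘(ℝ, EM) 𝓘(ℝ, EM) (chartAt EM m) (q ((chartAt N.model y).symm x)) :=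
    (contMDiffAt_chart m hx.2).mdifferentiableAt (by simp)
  rw [← mfderiv_eq_fderiv]
  have h4 := mfderiv_comp x (h3 : MDifferentiableAt 𝓘(ℝ, EM) 𝓘(ℝ, EM) (chartAt EM m)
    ((q ∘ (chartAt N.model y).symm) x)) (h2.comp x h1)
  have h5 := mfderiv_comp x h2 h1
  change mfderiv 𝓘(ℝ, N.model) 𝓘(ℝ, EM) (chartAt EM m ∘ (q ∘ (chartAt N.model y).symm)) x v = _
  rw [h4, h5]
  rfl

theorem surjective_fderiv_locRep {x : N.model} (hx : x ∈ locDom EM q y m)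
    (hsurj : Function.Surjective
      (mfderiv 𝓘(ℝ, N.model) 𝓘(ℝ, EM) q ((chartAt N.model y).symm x))) :
    Function.Surjective (fderiv ℝ (locRep EM q y m) x) := by
  intro w
  obtain ⟨a, ha⟩ := surjective_mfderiv_chart m (x := q ((chartAt N.model y).symm x)) hx.2 w
  obtain ⟨b, hb⟩ := hsurj a
  obtain ⟨v, hv⟩ := surjective_mfderiv_chart_symm y hx.1 b
  exact ⟨v, (fderiv_locRep hq hx v).trans (by rw [hv, hb, ha])⟩

/-- Smooth local sections of a submersion onto a finite-dimensional manifold. -/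
theorem exists_section [FiniteDimensional ℝ EM] (hy : q y ∈ (chartAt EM m).source)
    (hsurj : Function.Surjective (mfderiv 𝓘(ℝ, N.model) 𝓘(ℝ, EM) q y)) :
    ∃ (r : EM → N.model) (W : Set EM), IsOpen W ∧ chartAt EM m (q y) ∈ W ∧ ContDiffOn ℝ ∞ r W ∧
      r (chartAt EM m (q y)) = chartAt N.model y y ∧
      ∀ a ∈ W, r a ∈ locDom EM q y m ∧ locRep EM q y m (r a) = a := by
  have h0 := chart_mem_locDom hy
  have h1 := exists_local_section (isOpen_locDom (m := m) (y := y) hq)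
    (fun x hx => (contDiffAt_locRep hq hx).contDiffWithinAt) h0
    (surjective_fderiv_locRep hq h0 (by rw [chart_symm_chart]; exact hsurj))
  have h2 : locRep EM q y m (chartAt N.model y y) = chartAt EM m (q y) := by
    simp [locRep]
  rwa [h2] at h1

end LocRep

section Pullback

variable {P : Type u} [NormedAddCommGroup P] [NormedSpace ℝ P] {H : Type u} [TopologicalSpace H]
  {J : ModelWithCorners ℝ P H} {X : Type u} [TopologicalSpace X] [ChartedSpace H X]
  {Q : Type u} [NormedAddCommGroup Q] [NormedSpace ℝ Q] {H' : Type u} [TopologicalSpace H']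
  {J' : ModelWithCorners ℝ Q H'} {Y : Type u} [TopologicalSpace Y] [ChartedSpace H' Y]

theorem pullbackForm_apply (σ : TwoForm J' Y) (f : X → Y) (x : X) (v w : TangentSpace J x) :
    pullbackForm J J' f σ x ![v, w] = σ (f x) ![mfderiv J J' f x v, mfderiv J J' f x w] := by
  simp only [pullbackForm, ContinuousAlternatingMap.compContinuousLinearMap_apply]
  congr 1
  ext i; fin_cases i <;> rfl

theorem pullbackForm_congr (σ : TwoForm J' Y) {f f' : X → Y} {x : X} (h : f =ᶠ[𝓝 x] f') :
    pullbackForm J J' f σ x = pullbackForm J J' f' σ x := by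
  have key : ∀ (y y' : Y) (T T' : P →L[ℝ] Q), y = y' → T = T' →
      ((σ y : Q [⋀^Fin 2]→L[ℝ] ℝ)).compContinuousLinearMap T =
        ((σ y' : Q [⋀^Fin 2]→L[ℝ] ℝ)).compContinuousLinearMap T' := by
    rintro y _ T _ rfl rfl; rfl
  exact key _ _ _ _ h.eq_of_nhds h.mfderiv_eq

theorem pullbackForm_comp {P' : Type u} [NormedAddCommGroup P'] [NormedSpace ℝ P'] {H'' : Type u}
    [TopologicalSpace H''] {J'' : ModelWithCorners ℝ P' H''} {X' : Type u}
    [TopologicalSpace X'] [ChartedSpace H'' X'] (σ : TwoForm J' Y) {f : X → Y} {g : X' → X}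
    {x : X'} (hg : MDifferentiableAt J'' J g x)
    (hf : MDifferentiableAt J J' f (g x)) :
    pullbackForm J'' J' (f ∘ g) σ x =
      (pullbackForm J J' f σ (g x)).compContinuousLinearMap
        (mfderiv J'' J g x) := by
  unfold pullbackForm
  rw [mfderiv_comp x hf hg]
  rfl

end Pullback

section PullbackSymplectic

/-- The pullback of a two-form to a Banach space, as a differential form. -/
def pullbackLocal {P : Type u} [NormedAddCommGroup P] [NormedSpace ℝ P] (f : P → 𝒢)
    (σ : TwoForm 𝓘(ℝ, E) 𝒢) : P → P [⋀^Fin 2]→L[ℝ] ℝ :=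
  fun x => pullbackForm 𝓘(ℝ, P) 𝓘(ℝ, E) f σ x

variable [IsManifold 𝓘(ℝ, E) ∞ 𝒢] {σ : TwoForm 𝓘(ℝ, E) 𝒢} (hσ : IsWeakSymplectic σ)
  {P : Type u} [NormedAddCommGroup P] [NormedSpace ℝ P] {f : P → 𝒢} {p : P}
  (hf : ContMDiffAt 𝓘(ℝ, P) 𝓘(ℝ, E) ∞ f p)
include hf

theorem contDiffAt_chart_comp : ContDiffAt ℝ ∞ (fun x => chartAt E (f p) (f x)) p :=
  contMDiffAt_iff_contDiffAt.1
    (ContMDiffAt.comp p (contMDiffAt_chart (f p) (mem_chart_source E (f p))) hf)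

/-- Smoothness and closedness of `σ` are known for its chart representatives. One chart at `f p`
serves all points near `p`, so both properties pass to the pullback. -/
theorem pullbackLocal_eventuallyEq (σ : TwoForm 𝓘(ℝ, E) 𝒢) :
    pullbackLocal f σ =ᶠ[𝓝 p] fun x =>
      (chartForm σ (f p) (chartAt E (f p) (f x))).compContinuousLinearMap
        (fderiv ℝ (fun x => chartAt E (f p) (f x)) x) := by
  have h1 : ∀ᶠ x in 𝓝 p, f x ∈ (chartAt E (f p)).source :=
    hf.continuousAt.preimage_mem_nhds
      ((chartAt E (f p)).open_source.mem_nhds (mem_chart_source E (f p)))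
  have h2 : ∀ᶠ x in 𝓝 p, ContDiffAt ℝ 1 (fun x => chartAt E (f p) (f x)) x :=
    ((contDiffAt_chart_comp hf).of_le (m := 1) (by simp)).eventually (by simp)
  filter_upwards [h1.eventually_nhds, h2] with x hx hx2
  have hx1 := hx.self_of_nhds
  have h3 : f =ᶠ[𝓝 x] (chartAt E (f p)).symm ∘ (fun x => chartAt E (f p) (f x)) := by
    filter_upwards [hx] with z hz
    exact ((chartAt E (f p)).left_inv hz).symm
  change pullbackForm 𝓘(ℝ, P) 𝓘(ℝ, E) f σ x = _
  rw [pullbackForm_congr σ h3, pullbackForm_comp σ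
    (mdifferentiableAt_iff_differentiableAt.2 (hx2.differentiableAt (by simp)))
    ((contMDiffAt_chart_symm (f p) ((chartAt E (f p)).map_source hx1)).mdifferentiableAt
      (by simp)), mfderiv_eq_fderiv]
  rfl

omit [IsManifold 𝓘(ℝ, E) ∞ 𝒢] [NormedAddCommGroup P] [NormedSpace ℝ P] hf in
include hσ in
theorem contDiffAt_chartForm : ContDiffAt ℝ ∞ (chartForm σ (f p)) (chartAt E (f p) (f p)) :=
  (hσ.smooth (f p)).contDiffAt ((chartAt E (f p)).open_target.mem_nhds (chart_mem_target (f p)))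

include hσ

theorem contDiffAt_bilin_pullbackLocal :
    ContDiffAt ℝ ∞ (fun x => bilinOfForm P (pullbackLocal f σ x)) p := by
  have h1 := contDiffAt_bilinOfForm (contDiffAt_chartForm (f := f) (p := p) hσ)
  have h2 : ContDiffAt ℝ ∞ _ p :=
    ContDiffAt.comp p (f := fun x => chartAt E (f p) (f x)) h1 (contDiffAt_chart_comp hf)
  have h3 : ContDiffAt ℝ ∞ (fderiv ℝ (fun x => chartAt E (f p) (f x))) p :=
    (contDiffAt_chart_comp hf).fderiv_right (m := ∞) (by simp)
  have h4 : ContDiffAt ℝ ∞ (fun x =>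
      (ContinuousLinearMap.compL ℝ P E ℝ).flip (fderiv ℝ (fun x => chartAt E (f p) (f x)) x) ∘L
        (bilinOfForm E (chartForm σ (f p) (chartAt E (f p) (f x)))) ∘L
        (fderiv ℝ (fun x => chartAt E (f p) (f x)) x)) p :=
    ((ContinuousLinearMap.contDiff _).contDiffAt.comp p h3).clm_comp (h2.clm_comp h3)
  refine h4.congr_of_eventuallyEq ?_
  filter_upwards [pullbackLocal_eventuallyEq hf σ] with x hx
  rw [hx]
  ext v w
  simp only [bilinOfForm_apply, ContinuousAlternatingMap.compContinuousLinearMap_apply,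
    ContinuousLinearMap.comp_apply, ContinuousLinearMap.flip_apply,
    ContinuousLinearMap.compL_apply]
  congr 1
  ext i; fin_cases i <;> rfl

theorem differentiableAt_pullbackLocal :
    DifferentiableAt ℝ (pullbackLocal f σ) p := by
  have h1 : DifferentiableAt ℝ (fun x => chartForm σ (f p) (chartAt E (f p) (f x))) p :=
    DifferentiableAt.comp p (f := fun x => chartAt E (f p) (f x)) ((contDiffAt_chartForm (f := f) (p := p) hσ).differentiableAt (by simp))
      ((contDiffAt_chart_comp hf).differentiableAt (by simp))
  have h3 : ContDiffAt ℝ ∞ (fderiv ℝ (fun x => chartAt E (f p) (f x))) p :=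
    (contDiffAt_chart_comp hf).fderiv_right (m := ∞) (by simp)
  exact (DifferentiableAt.continuousAlternatingMapCompContinuousLinearMap h1
    (h3.differentiableAt (by simp))).congr_of_eventuallyEq
      (pullbackLocal_eventuallyEq hf σ)

theorem extDeriv_pullbackLocal :
    extDeriv (pullbackLocal f σ) p = 0 := by
  rw [Filter.EventuallyEq.extDeriv_eq (pullbackLocal_eventuallyEq hf σ),
    extDeriv_pullback (f := fun x => chartAt E (f p) (f x)) ((contDiffAt_chartForm (f := f) (p := p) hσ).differentiableAt (by simp))
      (contDiffAt_chart_comp hf) (by simpa using two_le_infty), hσ.closed (f p) _ (chart_mem_target (f p))]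
  rfl

end PullbackSymplectic

end Manifolds
end RSG

namespace RSG

/-! ### Hamiltonian vectors from the multiplication relation at a unit -/

section LocalModel

variable {F : Type u} [NormedAddCommGroup F] [NormedSpace ℝ F]
  {V : Type u} [NormedAddCommGroup V] [NormedSpace ℝ V]

/-- The multiplication relation near a triple `(l, c, c)` whose first entry is a unit, in charts
`w₀`, `x₀`, `x₀` of the coisotropic submanifold: a parametrization `(g₁, g₂, g₃)` of the relation,
and a lift `h` of the diagonal `c' ↦ (l(c'), c', c')`, where the unit `l(c')` depends only on the
source of `c'`. -/
structure LocalModel (σl σc : F → F [⋀^Fin 2]→L[ℝ] ℝ) (sl tl sc : F → V) (w₀ x₀ : F) where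
  P : Type u
  [normed : NormedAddCommGroup P]
  [space : NormedSpace ℝ P]
  z₀ : P
  g₁ : P → F
  g₂ : P → F
  g₃ : P → F
  h : F → P
  u : V → F
  smooth_g₁ : ContDiffAt ℝ ∞ g₁ z₀
  smooth_g₂ : ContDiffAt ℝ ∞ g₂ z₀
  smooth_g₃ : ContDiffAt ℝ ∞ g₃ z₀
  smooth_h : ContDiffAt ℝ ∞ h x₀
  smooth_u : ContDiffAt ℝ ∞ u (sc x₀)
  g₁_z₀ : g₁ z₀ = w₀
  g₂_z₀ : g₂ z₀ = x₀
  g₃_z₀ : g₃ z₀ = x₀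
  h_x₀ : h x₀ = z₀
  g₁_h : ∀ᶠ x in 𝓝 x₀, g₁ (h x) = u (sc x)
  g₂_h : ∀ᶠ x in 𝓝 x₀, g₂ (h x) = x
  g₃_h : ∀ᶠ x in 𝓝 x₀, g₃ (h x) = x
  source_g : ∀ᶠ z in 𝓝 z₀, sl (g₁ z) = sc (g₃ z)
  target_g : ∀ᶠ z in 𝓝 z₀, tl (g₁ z) = sc (g₂ z)
  isotropic : ∀ᶠ z in 𝓝 z₀, ∀ ξ η,
    -σl (g₁ z) ![fderiv ℝ g₁ z ξ, fderiv ℝ g₁ z η] - σc (g₂ z) ![fderiv ℝ g₂ z ξ, fderiv ℝ g₂ z η] +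
      σc (g₃ z) ![fderiv ℝ g₃ z ξ, fderiv ℝ g₃ z η] = 0
  maximal : ∀ X Y Z, (∀ ξ, -σl w₀ ![X, fderiv ℝ g₁ z₀ ξ] - σc x₀ ![Y, fderiv ℝ g₂ z₀ ξ] +
      σc x₀ ![Z, fderiv ℝ g₃ z₀ ξ] = 0) →
    ∃ ξ, fderiv ℝ g₁ z₀ ξ = X ∧ fderiv ℝ g₂ z₀ ξ = Y ∧ fderiv ℝ g₃ z₀ ξ = Z

attribute [instance] LocalModel.normed LocalModel.space

namespace LocalModel

theorem form_zero_left (σ : F [⋀^Fin 2]→L[ℝ] ℝ) (v : F) : σ ![0, v] = 0 := by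
  simp [← bilinOfForm_apply]

theorem form_zero_right (σ : F [⋀^Fin 2]→L[ℝ] ℝ) (v : F) : σ ![v, 0] = 0 := by
  simp [← bilinOfForm_apply]

theorem form_sub_left (σ : F [⋀^Fin 2]→L[ℝ] ℝ) (v v' w : F) :
    σ ![v - v', w] = σ ![v, w] - σ ![v', w] := by
  simp [← bilinOfForm_apply]

theorem eventually_differentiableAt {G H : Type*} [NormedAddCommGroup G] [NormedSpace ℝ G]
    [NormedAddCommGroup H] [NormedSpace ℝ H] {f : G → H} {x : G} (hf : ContDiffAt ℝ ∞ f x) :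
    ∀ᶠ y in 𝓝 x, DifferentiableAt ℝ f y := by
  filter_upwards [(hf.of_le (m := 1) (by simp)).eventually (by simp)] with y hy
  exact hy.differentiableAt (by simp)

variable {σl σc : F → F [⋀^Fin 2]→L[ℝ] ℝ} {sl tl sc : F → V} {w₀ x₀ : F}
  (𝓜 : LocalModel σl σc sl tl sc w₀ x₀)

theorem fderiv_source (hsl : DifferentiableAt ℝ sl w₀) (hsc : DifferentiableAt ℝ sc x₀) (ξ : 𝓜.P) :
    fderiv ℝ sl w₀ (fderiv ℝ 𝓜.g₁ 𝓜.z₀ ξ) = fderiv ℝ sc x₀ (fderiv ℝ 𝓜.g₃ 𝓜.z₀ ξ) := by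
  have h1 : fderiv ℝ (fun z => sl (𝓜.g₁ z)) 𝓜.z₀ = fderiv ℝ (fun z => sc (𝓜.g₃ z)) 𝓜.z₀ :=
    Filter.EventuallyEq.fderiv_eq 𝓜.source_g
  have h2 := fderiv_fun_comp 𝓜.z₀ (g := sl) (by rw [𝓜.g₁_z₀]; exact hsl)
    (𝓜.smooth_g₁.differentiableAt (by simp))
  have h3 := fderiv_fun_comp 𝓜.z₀ (g := sc) (by rw [𝓜.g₃_z₀]; exact hsc)
    (𝓜.smooth_g₃.differentiableAt (by simp))
  rw [h2, h3, 𝓜.g₁_z₀, 𝓜.g₃_z₀] at h1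
  exact DFunLike.congr_fun h1 ξ

theorem fderiv_target (htl : DifferentiableAt ℝ tl w₀) (hsc : DifferentiableAt ℝ sc x₀) (ξ : 𝓜.P) :
    fderiv ℝ tl w₀ (fderiv ℝ 𝓜.g₁ 𝓜.z₀ ξ) = fderiv ℝ sc x₀ (fderiv ℝ 𝓜.g₂ 𝓜.z₀ ξ) := by
  have h1 : fderiv ℝ (fun z => tl (𝓜.g₁ z)) 𝓜.z₀ = fderiv ℝ (fun z => sc (𝓜.g₂ z)) 𝓜.z₀ :=
    Filter.EventuallyEq.fderiv_eq 𝓜.target_g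
  have h2 := fderiv_fun_comp 𝓜.z₀ (g := tl) (by rw [𝓜.g₁_z₀]; exact htl)
    (𝓜.smooth_g₁.differentiableAt (by simp))
  have h3 := fderiv_fun_comp 𝓜.z₀ (g := sc) (by rw [𝓜.g₂_z₀]; exact hsc)
    (𝓜.smooth_g₂.differentiableAt (by simp))
  rw [h2, h3, 𝓜.g₁_z₀, 𝓜.g₂_z₀] at h1
  exact DFunLike.congr_fun h1 ξ

/-- A vector orthogonal to all differences `dg₃ ξ - dg₂ ξ` is tangent to the source fibre. -/
theorem fderiv_sc_eq_zero (htl : DifferentiableAt ℝ tl w₀) (hsc : DifferentiableAt ℝ sc x₀) {v : F}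
    (hv : ∀ ξ, σc x₀ ![fderiv ℝ 𝓜.g₃ 𝓜.z₀ ξ - fderiv ℝ 𝓜.g₂ 𝓜.z₀ ξ, v] = 0) :
    fderiv ℝ sc x₀ v = 0 := by
  -- The triple `(0, v, v)` is orthogonal to the relation, hence tangent to it, and the target of
  -- its first entry is the source of its second.
  obtain ⟨ξ, h1, h2, -⟩ := 𝓜.maximal 0 v v fun ξ => by
    have := hv ξ
    rw [form_sub_left] at this
    rw [form_zero_left, form_swap _ v, form_swap _ v]
    linarith
  rw [← h2, ← 𝓜.fderiv_target htl hsc, h1, map_zero]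

/-- Close to the base point, differences `dg₃ ξ - dg₂ ξ` are orthogonal to the source fibres. -/
theorem eventually_orthogonal (hsc : ContDiffAt ℝ ∞ sc x₀) :
    ∀ᶠ x in 𝓝 x₀, ∀ ξ v, fderiv ℝ sc x v = 0 →
      σc x ![fderiv ℝ 𝓜.g₃ (𝓜.h x) ξ - fderiv ℝ 𝓜.g₂ (𝓜.h x) ξ, v] = 0 := by
  have hh : Filter.Tendsto 𝓜.h (𝓝 x₀) (𝓝 𝓜.z₀) := by
    have := 𝓜.smooth_h.continuousAt.tendsto
    rwa [𝓜.h_x₀] at this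
  filter_upwards [hh.eventually 𝓜.isotropic, hh.eventually (eventually_differentiableAt 𝓜.smooth_g₁),
    hh.eventually (eventually_differentiableAt 𝓜.smooth_g₂),
    hh.eventually (eventually_differentiableAt 𝓜.smooth_g₃),
    eventually_differentiableAt 𝓜.smooth_h, eventually_differentiableAt hsc,
    hsc.continuousAt.eventually (eventually_differentiableAt 𝓜.smooth_u),
    𝓜.g₁_h.eventually_nhds, 𝓜.g₂_h.eventually_nhds, 𝓜.g₃_h.eventually_nhds]
    with x hiso h1 h2 h3 hhx hscx hux e1 e2 e3 ξ v hv
  -- Along a source fibre the unit in the diagonal lift is constant, so `dh v` maps to the triple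
  -- `(0, v, v)`, to which isotropy is applied.
  have d1 : fderiv ℝ 𝓜.g₁ (𝓜.h x) (fderiv ℝ 𝓜.h x v) = 0 := by
    have := Filter.EventuallyEq.fderiv_eq (𝕜 := ℝ) e1
    rw [fderiv_fun_comp x h1 hhx, fderiv_fun_comp x hux hscx] at this
    have := DFunLike.congr_fun this v
    simpa [hv] using this
  have d2 : fderiv ℝ 𝓜.g₂ (𝓜.h x) (fderiv ℝ 𝓜.h x v) = v := by
    have := Filter.EventuallyEq.fderiv_eq (𝕜 := ℝ) e2
    rw [fderiv_fun_comp x h2 hhx] at this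
    have := DFunLike.congr_fun this v
    simpa using this
  have d3 : fderiv ℝ 𝓜.g₃ (𝓜.h x) (fderiv ℝ 𝓜.h x v) = v := by
    have := Filter.EventuallyEq.fderiv_eq (𝕜 := ℝ) e3
    rw [fderiv_fun_comp x h3 hhx] at this
    have := DFunLike.congr_fun this v
    simpa using this
  have := hiso ξ (fderiv ℝ 𝓜.h x v)
  rw [d1, d2, d3, e2.self_of_nhds, e3.self_of_nhds, form_zero_right] at this
  rw [form_sub_left]
  linarith

include 𝓜

theorem exists_hamiltonian [CompleteSpace F] [FiniteDimensional ℝ V]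
    (hσ : ContDiffAt ℝ ∞ (fun x => bilinOfForm F (σc x)) x₀)
    (htl : DifferentiableAt ℝ tl w₀) (hsc : ContDiffAt ℝ ∞ sc x₀)
    (hsurj : Function.Surjective (fderiv ℝ sc x₀)) :
    ∃ X : F → (V →L[ℝ] ℝ) →L[ℝ] F, ContDiffAt ℝ ∞ X x₀ ∧
      ∀ᶠ x in 𝓝 x₀, ∀ α v, σc x ![X x α, v] = α (fderiv ℝ sc x v) := by
  have hd : ∀ g : 𝓜.P → F, ContDiffAt ℝ ∞ g 𝓜.z₀ →
      ContDiffAt ℝ ∞ (fun x => fderiv ℝ g (𝓜.h x)) x₀ := by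
    intro g hg
    refine ContDiffAt.comp x₀ (g := fderiv ℝ g) ?_ 𝓜.smooth_h
    rw [𝓜.h_x₀]
    exact hg.fderiv_right (by simp)
  have := RSG.exists_hamiltonian (d := fun x => fderiv ℝ 𝓜.g₃ (𝓜.h x) - fderiv ℝ 𝓜.g₂ (𝓜.h x)) hσ
    ((hd _ 𝓜.smooth_g₃).sub (hd _ 𝓜.smooth_g₂)) (hsc.fderiv_right (m := ∞) (by simp)) hsurj
    (by simpa using 𝓜.eventually_orthogonal hsc)
    (fun v hv => 𝓜.fderiv_sc_eq_zero htl (hsc.differentiableAt (by simp)) fun ξ => by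
      simpa [𝓜.h_x₀] using hv ξ)
  simpa using this

/-- Hamiltonian vectors at the unit and at the point have the same projection to the base. -/
theorem fderiv_eq_of_hamiltonian (hsl : DifferentiableAt ℝ sl w₀) (hsc : DifferentiableAt ℝ sc x₀)
    {β : V →L[ℝ] ℝ} {X Z : F} (hX : ∀ v, σl w₀ ![X, v] = β (fderiv ℝ sl w₀ v))
    (hZ : ∀ v, σc x₀ ![Z, v] = β (fderiv ℝ sc x₀ v)) :
    fderiv ℝ sl w₀ X = fderiv ℝ sc x₀ Z := by
  -- The contributions of `X` and `Z` cancel because first and third entries have equal source; thus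
  -- `(X, 0, Z)` is tangent to the relation.
  obtain ⟨ξ, h1, -, h3⟩ := 𝓜.maximal X 0 Z fun ξ => by
    rw [form_zero_left, hX, hZ, 𝓜.fderiv_source hsl hsc]
    ring
  rw [← h1, ← h3, 𝓜.fderiv_source hsl hsc]

end LocalModel
end LocalModel
end RSG

namespace RSG

/-! ### Tangent vectors and forms on products -/

section Product

variable {E : Type u} [NormedAddCommGroup E] [NormedSpace ℝ E] {H : Type u} [TopologicalSpace H]
  {J : ModelWithCorners ℝ E H} {X : Type u} [TopologicalSpace X] [ChartedSpace H X]
  {E' : Type u} [NormedAddCommGroup E'] [NormedSpace ℝ E'] {H' : Type u} [TopologicalSpace H']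
  {J' : ModelWithCorners ℝ E' H'} {Y : Type u} [TopologicalSpace Y] [ChartedSpace H' Y]

theorem prodForm_apply (σ : TwoForm J X) (σ' : TwoForm J' Y) (p : X × Y)
    (v w : TangentSpace (J.prod J') p) :
    prodForm σ σ' p ![v, w] =
      (σ p.1 : E [⋀^Fin 2]→L[ℝ] ℝ) ![(v : E × E').1, (w : E × E').1] +
      (σ' p.2 : E' [⋀^Fin 2]→L[ℝ] ℝ) ![(v : E × E').2, (w : E × E').2] := by
  change pullbackForm (J.prod J') J Prod.fst σ p ![v, w] +
    pullbackForm (J.prod J') J' Prod.snd σ' p ![v, w] = _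
  rw [pullbackForm_apply, pullbackForm_apply, mfderiv_fst, mfderiv_snd]
  rfl

variable {P : Type u} [NormedAddCommGroup P] [NormedSpace ℝ P]

theorem mfderiv_fst_comp {Φ : P → X × Y} {z : P}
    (h : MDifferentiableAt 𝓘(ℝ, P) (J.prod J') Φ z) (ξ : P) :
    (mfderiv 𝓘(ℝ, P) J (fun x => (Φ x).1) z ξ : E) =
      (mfderiv 𝓘(ℝ, P) (J.prod J') Φ z ξ : E × E').1 := by
  have := mfderiv_comp z (mdifferentiableAt_fst (I := J) (I' := J') (x := Φ z)) h
  change (mfderiv 𝓘(ℝ, P) J (Prod.fst ∘ Φ) z ξ : E) = _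
  rw [this, mfderiv_fst]
  rfl

theorem mfderiv_snd_comp {Φ : P → X × Y} {z : P}
    (h : MDifferentiableAt 𝓘(ℝ, P) (J.prod J') Φ z) (ξ : P) :
    (mfderiv 𝓘(ℝ, P) J' (fun x => (Φ x).2) z ξ : E') =
      (mfderiv 𝓘(ℝ, P) (J.prod J') Φ z ξ : E × E').2 := by
  have := mfderiv_comp z (mdifferentiableAt_snd (I := J) (I' := J') (x := Φ z)) h
  change (mfderiv 𝓘(ℝ, P) J' (Prod.snd ∘ Φ) z ξ : E') = _
  rw [this, mfderiv_snd]
  rfl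

/-- Tangent spaces of an immersed Lagrangian submanifold, in a chart of the parametrization. -/
theorem isLagrangianSubspace_chart {N : BanachManifold.{u}} {φ : N.carrier → X}
    (hφ : ContMDiff 𝓘(ℝ, N.model) J ∞ φ) {Ω : TwoForm J X}
    (h : ∀ y, IsLagrangianSubspace (Ω (φ y))
      (LinearMap.range (mfderiv 𝓘(ℝ, N.model) J φ y).toLinearMap))
    (y : N.carrier) {z : N.model} (hz : z ∈ (chartAt N.model y).target) (v : E) :
    (∃ ξ, mfderiv 𝓘(ℝ, N.model) J (φ ∘ (chartAt N.model y).symm) z ξ = v) ↔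
      ∀ ξ, (Ω (φ ((chartAt N.model y).symm z)) : E [⋀^Fin 2]→L[ℝ] ℝ)
        ![v, (mfderiv 𝓘(ℝ, N.model) J (φ ∘ (chartAt N.model y).symm) z ξ : E)] = 0 := by
  have h1 := mfderiv_comp z (hφ.contMDiffAt.mdifferentiableAt (by simp))
    ((contMDiffAt_chart_symm y hz).mdifferentiableAt (by simp))
  have hsurj := surjective_mfderiv_chart_symm y hz
  have h2 := h ((chartAt N.model y).symm z) v
  rw [h1]
  constructor
  · rintro ⟨ξ, hξ⟩ η
    exact h2.1 ⟨_, hξ⟩ _ ⟨_, rfl⟩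
  · intro h3
    obtain ⟨a, ha⟩ := h2.2 (by
      rintro _ ⟨b, rfl⟩
      obtain ⟨ξ, rfl⟩ := hsurj b
      exact h3 ξ)
    obtain ⟨ξ, rfl⟩ := hsurj a
    exact ⟨ξ, ha⟩

end Product

/-! ### Derivatives of lifts to an immersed submanifold -/

section Lifts

variable {E : Type u} [NormedAddCommGroup E] [NormedSpace ℝ E]
  {𝒢 : Type u} [TopologicalSpace 𝒢] [ChartedSpace E 𝒢] {C : BanachManifold.{u}} {φ : C.carrier → 𝒢}

theorem mfderiv_eq_of_lift {P : Type u} [NormedAddCommGroup P] [NormedSpace ℝ P] {F : Type u}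
    [NormedAddCommGroup F] [NormedSpace ℝ F] {f : P → 𝒢} {ψ : F → 𝒢} {g : P → F} {z : P}
    (h : ψ ∘ g =ᶠ[𝓝 z] f) (hg : DifferentiableAt ℝ g z)
    (hψ : MDifferentiableAt 𝓘(ℝ, F) 𝓘(ℝ, E) ψ (g z)) (ξ : P) :
    (mfderiv 𝓘(ℝ, P) 𝓘(ℝ, E) f z ξ : E) = mfderiv 𝓘(ℝ, F) 𝓘(ℝ, E) ψ (g z) (fderiv ℝ g z ξ) := by
  have h1 : (mfderiv 𝓘(ℝ, P) 𝓘(ℝ, E) f z : P →L[ℝ] E) =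
    mfderiv 𝓘(ℝ, P) 𝓘(ℝ, E) (ψ ∘ g) z := h.symm.mfderiv_eq
  rw [mfderiv_comp z hψ (mdifferentiableAt_iff_differentiableAt.2 hg), mfderiv_eq_fderiv] at h1
  exact DFunLike.congr_fun h1 ξ

theorem form_congr (σ : TwoForm 𝓘(ℝ, E) 𝒢) {a b : 𝒢} (h : a = b) {v v' w w' : E} (hv : v = v')
    (hw : w = w') :
    (σ a : E [⋀^Fin 2]→L[ℝ] ℝ) ![v, w] = (σ b : E [⋀^Fin 2]→L[ℝ] ℝ) ![v', w'] := by
  subst h hv hw; rfl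

theorem pullbackLocal_apply {F : Type u} [NormedAddCommGroup F] [NormedSpace ℝ F]
    (σ : TwoForm 𝓘(ℝ, E) 𝒢) (ψ : F → 𝒢) (x v w : F) :
    pullbackLocal ψ σ x ![v, w] = (σ (ψ x) : E [⋀^Fin 2]→L[ℝ] ℝ)
      ![(mfderiv 𝓘(ℝ, F) 𝓘(ℝ, E) ψ x v : E), (mfderiv 𝓘(ℝ, F) 𝓘(ℝ, E) ψ x w : E)] :=
  pullbackForm_apply σ ψ x v w

variable (hφ : ContMDiff 𝓘(ℝ, C.model) 𝓘(ℝ, E) ∞ φ)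

include hφ in
theorem contMDiffAt_comp_chart_symm (c : C.carrier) {x : C.model}
    (hx : x ∈ (chartAt C.model c).target) :
    ContMDiffAt 𝓘(ℝ, C.model) 𝓘(ℝ, E) ∞ (φ ∘ (chartAt C.model c).symm) x :=
  ContMDiffAt.comp x hφ.contMDiffAt (contMDiffAt_chart_symm c hx)

theorem exists_injOn_comp_chart_symm {c : C.carrier}
    (h : Manifold.IsImmersionAt 𝓘(ℝ, C.model) 𝓘(ℝ, E) ∞ φ c) :
    ∃ U ∈ 𝓝 (chartAt C.model c c), Set.InjOn (φ ∘ (chartAt C.model c).symm) U := by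
  obtain ⟨U, hU, hinj⟩ := exists_injOn_of_isImmersionAt h
  refine ⟨(chartAt C.model c).symm ⁻¹' U ∩ (chartAt C.model c).target, Filter.inter_mem ?_
    ((chartAt C.model c).open_target.mem_nhds (chart_mem_target c)), ?_⟩
  · refine ((chartAt C.model c).continuousAt_symm (chart_mem_target c)).preimage_mem_nhds ?_
    rwa [chart_symm_chart]
  · intro a ha b hb hab
    exact (chartAt C.model c).symm.injOn ha.2 hb.2 (hinj ha.1 hb.1 hab)

theorem injective_mfderiv_comp_chart_symm {c : C.carrier}
    (h : Manifold.IsImmersionAt 𝓘(ℝ, C.model) 𝓘(ℝ, E) ∞ φ c) :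
    Function.Injective (mfderiv 𝓘(ℝ, C.model) 𝓘(ℝ, E) (φ ∘ (chartAt C.model c).symm)
      (chartAt C.model c c)) := by
  have h0 := chart_mem_target (E := C.model) c
  have h1 := injective_mfderiv_of_isImmersionAt h
  have h3 : MDifferentiableAt 𝓘(ℝ, C.model) 𝓘(ℝ, E) φ c := h.contMDiffAt.mdifferentiableAt (by simp)
  have key : ∀ c', c' = c → Function.Injective (mfderiv 𝓘(ℝ, C.model) 𝓘(ℝ, E) φ c') ∧
      MDifferentiableAt 𝓘(ℝ, C.model) 𝓘(ℝ, E) φ c' := by rintro _ rfl; exact ⟨h1, h3⟩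
  obtain ⟨h4, h5⟩ := key _ (chart_symm_chart (E := C.model) c)
  have : IsManifold 𝓘(ℝ, C.model) 1 C.carrier := IsManifold.of_le (n := ∞) (by simp)
  rw [mfderiv_comp _ h5 ((contMDiffAt_chart_symm c h0).mdifferentiableAt (by simp))]
  exact h4.comp ((mdifferentiable_chart (I := 𝓘(ℝ, C.model)) c).symm.mfderiv_injective h0)

end Lifts
end RSG

namespace RSG

/-! ### The local model of a regular relational symplectic groupoid -/

section Construction

set_option linter.unusedSectionVars false

variable {E : Type u} [NormedAddCommGroup E] [NormedSpace ℝ E] [CompleteSpace E]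
  {𝒢 : Type u} [TopologicalSpace 𝒢] [T2Space 𝒢] [ChartedSpace E 𝒢] [IsManifold 𝓘(ℝ, E) ∞ 𝒢]
  {D : RelData E 𝒢} (hD : D.IsRelationalSymplecticGroupoid)
  {EM : Type u} [NormedAddCommGroup EM] [NormedSpace ℝ EM]
  [TopologicalSpace D.Base] [ChartedSpace EM D.Base] [IsManifold 𝓘(ℝ, EM) ∞ D.Base]
  {C : BanachManifold.{u}} {φ : C.carrier → 𝒢} (hC : IsImmersedSubmanifold 𝓘(ℝ, E) C φ D.C)
  {s t : C.carrier → D.Base}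
  (hs : ∀ c m, (φ c, m) ∈ D.S ↔ s c = m) (ht : ∀ c m, (φ c, m) ∈ D.T ↔ t c = m)
  (hs_smooth : ContMDiff 𝓘(ℝ, C.model) 𝓘(ℝ, EM) ∞ s)

include hC in
theorem apply_mem_C (c : C.carrier) : φ c ∈ D.C := hC.range_eq ▸ Set.mem_range_self c

include hC hs hs_smooth in
-- Axiom A.9 speaks of the parametrization of `S`, not of `C`. The first component of that
-- parametrization lifts locally to `C`, so the projection to `M` factors through `s`, and
-- surjectivity passes to `ds`.
theorem surjective_mfderiv_source {NS : BanachManifold.{u}} {ψ : NS.carrier → 𝒢 × D.Base}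
    (hψ : IsImmersedSubmanifold (𝓘(ℝ, E).prod 𝓘(ℝ, EM)) NS ψ D.S)
    (hsurj : ∀ y, Function.Surjective
      (mfderiv 𝓘(ℝ, NS.model) 𝓘(ℝ, EM) (fun z => (ψ z).2) y)) (c : C.carrier) :
    Function.Surjective (mfderiv 𝓘(ℝ, C.model) 𝓘(ℝ, EM) s c) := by
  have hψS : ∀ y, ψ y ∈ D.S := fun y => hψ.range_eq ▸ Set.mem_range_self y
  obtain ⟨y, hy⟩ : (φ c, s c) ∈ Set.range ψ := by rw [hψ.range_eq]; exact (hs c _).2 rfl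
  have hx := chart_mem_target (E := NS.model) y
  have hsm : ContMDiff 𝓘(ℝ, NS.model) 𝓘(ℝ, EM) ∞ (fun z => (ψ z).2) :=
    contMDiff_snd.comp hψ.contMDiff
  obtain ⟨g, hg, hgx, hφg⟩ := hC.exists_lift (f := fun x => (ψ ((chartAt NS.model y).symm x)).1)
    (chartAt NS.model y).open_target
    (contMDiff_fst.comp_contMDiffOn (hψ.contMDiff.comp_contMDiffOn contMDiffOn_chart_symm))
    (fun x _ => (hψS _).1) hx (y := c) (by simp [hy])
  set G : NS.model → C.carrier := fun x => (chartAt C.model c).symm (g x) with hG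
  have hGx : G (chartAt NS.model y y) = c := by simp [hG, hgx]
  have hGd : MDifferentiableAt 𝓘(ℝ, NS.model) 𝓘(ℝ, C.model) G (chartAt NS.model y y) := by
    refine MDifferentiableAt.comp (chartAt NS.model y y) (g := (chartAt C.model c).symm) ?_
      ((contMDiffAt_iff_contDiffAt.2 hg).mdifferentiableAt (by simp))
    rw [hgx]
    exact (contMDiffAt_chart_symm c (chart_mem_target c)).mdifferentiableAt (by simp)
  have heq : s ∘ G =ᶠ[𝓝 (chartAt NS.model y y)] (fun z => (ψ z).2) ∘ (chartAt NS.model y).symm := by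
    filter_upwards [hφg] with x hx
    refine (hs _ _).1 ?_
    rw [show φ (G x) = _ from hx.2]
    exact hψS _
  have h1 := mfderiv_comp (chartAt NS.model y y)
    (hs_smooth.contMDiffAt.mdifferentiableAt (by simp) :
      MDifferentiableAt 𝓘(ℝ, C.model) 𝓘(ℝ, EM) s (G (chartAt NS.model y y))) hGd
  have h2 := mfderiv_comp (chartAt NS.model y y) (hsm.contMDiffAt.mdifferentiableAt (by simp))
    ((contMDiffAt_chart_symm y hx).mdifferentiableAt (by simp))
  have h3 : Function.Surjective
      (mfderiv 𝓘(ℝ, C.model) 𝓘(ℝ, EM) s (G (chartAt NS.model y y))) := by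
    intro w
    obtain ⟨a, ha⟩ := hsurj _ w
    obtain ⟨b, hb⟩ := surjective_mfderiv_chart_symm y hx a
    refine ⟨mfderiv 𝓘(ℝ, NS.model) 𝓘(ℝ, C.model) G (chartAt NS.model y y) b, ?_⟩
    have h4 : (mfderiv 𝓘(ℝ, NS.model) 𝓘(ℝ, EM) (s ∘ G) (chartAt NS.model y y) : NS.model →L[ℝ] EM)
      = _ := heq.mfderiv_eq
    rw [h1, h2] at h4
    refine (DFunLike.congr_fun h4 b).trans ?_
    rw [← ha, ← hb]; rfl
  rwa [hGx] at h3

include hD hC in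
/-- A local lift of the inversion to `C`. -/
theorem exists_lift_I {c c' : C.carrier} (hc : φ c' = D.I (φ c)) :
    ∃ G : C.carrier → C.carrier, ContMDiffAt 𝓘(ℝ, C.model) 𝓘(ℝ, C.model) ∞ G c ∧ G c = c' ∧
      φ ∘ G =ᶠ[𝓝 c] D.I ∘ φ := by
  obtain ⟨g, hg, hgc, hφg⟩ :=
    hC.exists_lift (f := fun x => D.I (φ ((chartAt C.model c).symm x)))
      (chartAt C.model c).open_target
      (hD.smooth_I.comp_contMDiffOn (hC.contMDiff.comp_contMDiffOn contMDiffOn_chart_symm))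
      (fun _ _ => hD.I_mem_C (apply_mem_C hC _)) (chart_mem_target c) (y := c')
      (by simp [hc])
  have h1 : ContMDiffAt 𝓘(ℝ, C.model) 𝓘(ℝ, C.model) ∞ (chartAt C.model c) c :=
    contMDiffAt_chart c (mem_chart_source _ c)
  have h2 : ContMDiffAt 𝓘(ℝ, C.model) 𝓘(ℝ, C.model) ∞ (chartAt C.model c').symm
      (g (chartAt C.model c c)) := by
    rw [hgc]; exact contMDiffAt_chart_symm c' (chart_mem_target c')
  refine ⟨fun a => (chartAt C.model c').symm (g (chartAt C.model c a)),
    ContMDiffAt.comp c h2 (ContMDiffAt.comp c (contMDiffAt_iff_contDiffAt.2 hg) h1),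
    by simp [hgc], ?_⟩
  filter_upwards [h1.continuousAt.eventually hφg,
    (chartAt C.model c).open_source.mem_nhds (mem_chart_source _ c)] with a ha ha'
  change φ ((chartAt C.model c').symm (g (chartAt C.model c a))) = D.I (φ a)
  rw [ha.2, (chartAt C.model c).left_inv ha']

include hD hC in
theorem exists_apply_eq_I (c : C.carrier) : ∃ c' : C.carrier, φ c' = D.I (φ c) := by
  have : D.I (φ c) ∈ Set.range φ := by
    rw [hC.range_eq]; exact hD.I_mem_C (apply_mem_C hC c)
  exact this

include hD hs ht in
theorem target_eq_source {c c' : C.carrier} (h : φ c' = D.I (φ c)) : t c = s c' := by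
  symm
  refine (hs _ _).1 ?_
  rw [h]
  exact hD.mem_S_I_of_mem_T ((ht _ _).2 rfl)

include hD hC hs ht hs_smooth in
-- Near each point `t` is `s` composed with a smooth local lift of the inversion.
theorem contMDiff_target : ContMDiff 𝓘(ℝ, C.model) 𝓘(ℝ, EM) ∞ t := by
  intro c
  obtain ⟨c', hc'⟩ := exists_apply_eq_I hD hC c
  obtain ⟨G, hG, hGc, hφG⟩ := exists_lift_I hD hC hc'
  refine (hs_smooth.contMDiffAt.comp c hG).congr_of_eventuallyEq ?_
  filter_upwards [hφG] with a ha
  exact target_eq_source hD hs ht ha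

include hD hC hs ht hs_smooth in
-- Here the axioms enter the local analysis: all entries of `L₃` lie in `C` and so lift to its
-- charts; units over nearby base points come from a section of the submersion `q`; the covering
-- property of the parametrization of `L₃` lifts the diagonal of triples `(l(c'), c', c')`.
theorem exists_localModel [FiniteDimensional ℝ EM] {N₁ : BanachManifold.{u}} {ψ₁ : N₁.carrier → 𝒢}
    {q : N₁.carrier → D.Base} (hψ₁ : IsImmersedSubmanifold 𝓘(ℝ, E) N₁ ψ₁ D.L₁)
    (hqcls : ∀ (y : N₁.carrier) (hy : ψ₁ y ∈ D.L₁), q y = D.cls ⟨ψ₁ y, hy⟩)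
    (hq : ContMDiff 𝓘(ℝ, N₁.model) 𝓘(ℝ, EM) ∞ q)
    (hqsurj : ∀ y, Function.Surjective (mfderiv 𝓘(ℝ, N₁.model) 𝓘(ℝ, EM) q y))
    {c cl : C.carrier} {y₁ : N₁.carrier} (hcl : φ cl = ψ₁ y₁) (hy₁ : q y₁ = s c) {m₀ : D.Base}
    (hm₀ : s c ∈ (chartAt EM m₀).source) :
    Nonempty (LocalModel (pullbackLocal (φ ∘ (chartAt C.model cl).symm) D.σ)
      (pullbackLocal (φ ∘ (chartAt C.model c).symm) D.σ) (locRep EM s cl m₀) (locRep EM t cl m₀)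
      (locRep EM s c m₀) (chartAt C.model cl cl) (chartAt C.model c c)) := by
  have hφ := hC.contMDiff
  have hL₁ : ∀ y, ψ₁ y ∈ D.L₁ := fun y => hψ₁.range_eq ▸ Set.mem_range_self y
  -- the multiplication relation near `(l, c, c)`
  obtain ⟨N₃, φ₃, hφ₃, hLag⟩ := hD.lagrangian_L₃
  have hL₃ : ∀ y, φ₃ y ∈ D.L₃ := fun y => hφ₃.range_eq ▸ Set.mem_range_self y
  have hunit : ∀ (y : N₁.carrier) (c : C.carrier), q y = s c → ((ψ₁ y, φ c), φ c) ∈ D.L₃ := by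
    intro y c hyc
    rw [hqcls y (hL₁ y)] at hyc
    exact (hD.mem_S_iff ⟨ψ₁ y, hL₁ y⟩).1 ((hs _ _).2 hyc.symm)
  obtain ⟨y₀, hy₀⟩ : ((ψ₁ y₁, φ c), φ c) ∈ Set.range φ₃ := by
    rw [hφ₃.range_eq]; exact hunit y₁ c hy₁
  set z₀ := chartAt N₃.model y₀ y₀ with hz₀
  have hz₀t : z₀ ∈ (chartAt N₃.model y₀).target := chart_mem_target y₀
  set Φ : N₃.model → (𝒢 × 𝒢) × 𝒢 := φ₃ ∘ (chartAt N₃.model y₀).symm with hΦ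
  have hΦz₀ : Φ z₀ = ((ψ₁ y₁, φ c), φ c) := by simp [hΦ, hz₀, hy₀]
  have hΦs : ContMDiffOn 𝓘(ℝ, N₃.model) ((𝓘(ℝ, E).prod 𝓘(ℝ, E)).prod 𝓘(ℝ, E)) ∞ Φ
      (chartAt N₃.model y₀).target := hφ₃.contMDiff.comp_contMDiffOn contMDiffOn_chart_symm
  have hΦL : ∀ z, Φ z ∈ D.L₃ := fun z => hL₃ _
  obtain ⟨g₁, hg₁, hg₁0, hφg₁⟩ := hC.exists_lift (f := fun z => (Φ z).1.1)
    (chartAt N₃.model y₀).open_target (contMDiff_fst.comp_contMDiffOn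
      (contMDiff_fst.comp_contMDiffOn hΦs)) (fun z _ => (hD.L₃_subset (hΦL z)).1) hz₀t
    (y := cl) (by simp only [hΦz₀, hcl])
  obtain ⟨g₂, hg₂, hg₂0, hφg₂⟩ := hC.exists_lift (f := fun z => (Φ z).1.2)
    (chartAt N₃.model y₀).open_target (contMDiff_snd.comp_contMDiffOn
      (contMDiff_fst.comp_contMDiffOn hΦs)) (fun z _ => (hD.L₃_subset (hΦL z)).2.1) hz₀t
    (y := c) (by simp only [hΦz₀])
  obtain ⟨g₃, hg₃, hg₃0, hφg₃⟩ := hC.exists_lift (f := fun z => (Φ z).2)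
    (chartAt N₃.model y₀).open_target
      (contMDiff_snd.comp_contMDiffOn hΦs) (fun z _ => (hD.L₃_subset (hΦL z)).2.2) hz₀t
    (y := c) (by simp only [hΦz₀])
  -- units over a neighbourhood of `s c`
  set x₀ := chartAt C.model c c with hx₀
  set w₀ := chartAt C.model cl cl with hw₀
  have hsc0 : locRep EM s c m₀ x₀ = chartAt EM m₀ (q y₁) := by simp [locRep, hx₀, hy₁]
  obtain ⟨r, W, hW, hW0, hr, hr0, hrW⟩ := exists_section (m := m₀) hq (y := y₁)
    (by rw [hy₁]; exact hm₀) (hqsurj y₁)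
  rw [← hsc0] at hW0 hr0
  have hr' : ContMDiffOn 𝓘(ℝ, EM) 𝓘(ℝ, E) ∞ (fun a => ψ₁ ((chartAt N₁.model y₁).symm (r a))) W :=
    hψ₁.contMDiff.comp_contMDiffOn (contMDiffOn_chart_symm.comp
      (contMDiffOn_iff_contDiffOn.2 hr) fun a ha => (hrW a ha).1.1)
  have : CompleteSpace EM := FiniteDimensional.complete ℝ EM
  obtain ⟨u, hu, hu0, hφu⟩ := hC.exists_lift hW hr' (fun a _ => hD.L₁_subset_C (hL₁ _)) hW0
    (y := cl) (by simp only [hr0, hcl, chart_symm_chart])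
  -- the lift of the diagonal
  have hdom := isOpen_locDom (y := c) (m := m₀) hs_smooth
  have hx₀dom : x₀ ∈ locDom EM s c m₀ := chart_mem_locDom hm₀
  have hsccont : ContinuousOn (locRep EM s c m₀) (locDom EM s c m₀) := fun x hx =>
    (contDiffAt_locRep hs_smooth hx).continuousAt.continuousWithinAt
  set Uh : Set C.model := locDom EM s c m₀ ∩ locRep EM s c m₀ ⁻¹' W with hUh
  have hUhopen : IsOpen Uh := hsccont.isOpen_inter_preimage hdom hW
  have hmulsmooth : ContMDiffOn 𝓘(ℝ, C.model) ((𝓘(ℝ, E).prod 𝓘(ℝ, E)).prod 𝓘(ℝ, E)) ∞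
      (fun x => ((ψ₁ ((chartAt N₁.model y₁).symm (r (locRep EM s c m₀ x))),
        φ ((chartAt C.model c).symm x)), φ ((chartAt C.model c).symm x))) Uh := by
    have h1 : ContMDiffOn 𝓘(ℝ, C.model) 𝓘(ℝ, E) ∞ (fun x => φ ((chartAt C.model c).symm x)) Uh :=
      (hφ.comp_contMDiffOn contMDiffOn_chart_symm).mono fun x hx => hx.1.1
    refine (ContMDiffOn.prodMk ?_ h1).prodMk h1
    exact hr'.comp (fun x hx => (contMDiffAt_locRep hs_smooth hx.1).contMDiffWithinAt)
      fun x hx => hx.2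
  -- `r` is a section of `q`, so the chosen unit lies over the source of the point and the triple
  -- belongs to `L₃`.
  obtain ⟨h, hh, hh0, hφh⟩ := hφ₃.exists_lift hUhopen hmulsmooth (p := x₀) (y := y₀) (by
      intro x hx
      refine hunit _ _ ?_
      have h1 := (hrW _ hx.2).2
      have h2 := (hrW _ hx.2).1
      exact (chartAt EM m₀).injOn h2.2 hx.1.2 h1) ⟨hx₀dom, hW0⟩ (by
      rw [hy₀, hr0, hx₀, chart_symm_chart, chart_symm_chart])
  -- injectivity of the parametrization of `C`
  obtain ⟨Vc, hVc, hVcinj⟩ := exists_injOn_comp_chart_symm (hC.immersion c)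
  obtain ⟨Vl, hVl, hVlinj⟩ := exists_injOn_comp_chart_symm (hC.immersion cl)
  have hht : Filter.Tendsto h (𝓝 x₀) (𝓝 z₀) := by
    have := hh.continuousAt.tendsto; rwa [hh0] at this
  have hg₁t : Filter.Tendsto g₁ (𝓝 z₀) (𝓝 w₀) := by
    have := hg₁.continuousAt.tendsto; rwa [hg₁0] at this
  have hg₂t : Filter.Tendsto g₂ (𝓝 z₀) (𝓝 x₀) := by
    have := hg₂.continuousAt.tendsto; rwa [hg₂0] at this
  have hg₃t : Filter.Tendsto g₃ (𝓝 z₀) (𝓝 x₀) := by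
    have := hg₃.continuousAt.tendsto; rwa [hg₃0] at this
  have hsct : Filter.Tendsto (locRep EM s c m₀) (𝓝 x₀) (𝓝 (locRep EM s c m₀ x₀)) :=
    (contDiffAt_locRep hs_smooth hx₀dom).continuousAt
  have hut : Filter.Tendsto u (𝓝 (locRep EM s c m₀ x₀)) (𝓝 w₀) := by
    have := hu.continuousAt.tendsto; rwa [hu0] at this
  -- tangent vectors to the multiplication relation
  have hψld : ∀ᶠ w in 𝓝 w₀, MDifferentiableAt 𝓘(ℝ, C.model) 𝓘(ℝ, E)
      (φ ∘ (chartAt C.model cl).symm) w := by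
    filter_upwards [(chartAt C.model cl).open_target.mem_nhds (chart_mem_target cl)] with w hw
    exact (contMDiffAt_comp_chart_symm hφ cl hw).mdifferentiableAt (by simp)
  have hψcd : ∀ᶠ w in 𝓝 x₀, MDifferentiableAt 𝓘(ℝ, C.model) 𝓘(ℝ, E)
      (φ ∘ (chartAt C.model c).symm) w := by
    filter_upwards [(chartAt C.model c).open_target.mem_nhds (chart_mem_target c)] with w hw
    exact (contMDiffAt_comp_chart_symm hφ c hw).mdifferentiableAt (by simp)
  have htan : ∀ᶠ z in 𝓝 z₀, z ∈ (chartAt N₃.model y₀).target ∧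
      (φ ((chartAt C.model cl).symm (g₁ z)) = (Φ z).1.1 ∧
        φ ((chartAt C.model c).symm (g₂ z)) = (Φ z).1.2 ∧
        φ ((chartAt C.model c).symm (g₃ z)) = (Φ z).2) ∧
      ∀ ξ : N₃.model, (mfderiv 𝓘(ℝ, N₃.model) ((𝓘(ℝ, E).prod 𝓘(ℝ, E)).prod 𝓘(ℝ, E)) Φ z ξ : (E × E) × E) =
        (((mfderiv 𝓘(ℝ, C.model) 𝓘(ℝ, E) (φ ∘ (chartAt C.model cl).symm) (g₁ z)
            (fderiv ℝ g₁ z ξ) : E),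
          (mfderiv 𝓘(ℝ, C.model) 𝓘(ℝ, E) (φ ∘ (chartAt C.model c).symm) (g₂ z)
            (fderiv ℝ g₂ z ξ) : E)),
          (mfderiv 𝓘(ℝ, C.model) 𝓘(ℝ, E) (φ ∘ (chartAt C.model c).symm) (g₃ z)
            (fderiv ℝ g₃ z ξ) : E)) := by
    filter_upwards [(chartAt N₃.model y₀).open_target.mem_nhds hz₀t, hφg₁.eventually_nhds,
      hφg₂.eventually_nhds, hφg₃.eventually_nhds, hg₁t.eventually hψld, hg₂t.eventually hψcd,
      hg₃t.eventually hψcd, LocalModel.eventually_differentiableAt hg₁,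
      LocalModel.eventually_differentiableAt hg₂, LocalModel.eventually_differentiableAt hg₃]
      with z hz e1 e2 e3 a1 a2 a3 b1 b2 b3
    refine ⟨hz, ⟨e1.self_of_nhds.2, e2.self_of_nhds.2, e3.self_of_nhds.2⟩, fun ξ => ?_⟩
    have hΦd : MDifferentiableAt 𝓘(ℝ, N₃.model) ((𝓘(ℝ, E).prod 𝓘(ℝ, E)).prod 𝓘(ℝ, E)) Φ z :=
      (hΦs.contMDiffAt ((chartAt N₃.model y₀).open_target.mem_nhds hz)).mdifferentiableAt (by simp)
    have hΦd1 : MDifferentiableAt 𝓘(ℝ, N₃.model) (𝓘(ℝ, E).prod 𝓘(ℝ, E)) (fun z => (Φ z).1) z :=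
      hΦd.fst
    rw [← mfderiv_eq_of_lift (ψ := φ ∘ (chartAt C.model cl).symm) (g := g₁) (f := fun z => (Φ z).1.1) (e1.mono fun _ h => h.2) b1 a1,
      ← mfderiv_eq_of_lift (ψ := φ ∘ (chartAt C.model c).symm) (g := g₂) (f := fun z => (Φ z).1.2) (e2.mono fun _ h => h.2) b2 a2,
      ← mfderiv_eq_of_lift (ψ := φ ∘ (chartAt C.model c).symm) (g := g₃) (f := fun z => (Φ z).2) (e3.mono fun _ h => h.2) b3 a3,
      mfderiv_fst_comp hΦd1, mfderiv_snd_comp hΦd1, mfderiv_fst_comp hΦd, mfderiv_snd_comp hΦd]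
    rfl
  have hform : ∀ᶠ z in 𝓝 z₀, ∀ (X Y Z : C.model) (ξ : N₃.model),
      (prodForm (-prodForm D.σ D.σ) D.σ (Φ z) : ((E × E) × E) [⋀^Fin 2]→L[ℝ] ℝ)
        ![(((mfderiv 𝓘(ℝ, C.model) 𝓘(ℝ, E) (φ ∘ (chartAt C.model cl).symm) (g₁ z) X : E),
            (mfderiv 𝓘(ℝ, C.model) 𝓘(ℝ, E) (φ ∘ (chartAt C.model c).symm) (g₂ z) Y : E)),
            (mfderiv 𝓘(ℝ, C.model) 𝓘(ℝ, E) (φ ∘ (chartAt C.model c).symm) (g₃ z) Z : E)),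
          (mfderiv 𝓘(ℝ, N₃.model) ((𝓘(ℝ, E).prod 𝓘(ℝ, E)).prod 𝓘(ℝ, E)) Φ z ξ : (E × E) × E)] =
      -pullbackLocal (φ ∘ (chartAt C.model cl).symm) D.σ (g₁ z) ![X, fderiv ℝ g₁ z ξ] -
        pullbackLocal (φ ∘ (chartAt C.model c).symm) D.σ (g₂ z) ![Y, fderiv ℝ g₂ z ξ] +
        pullbackLocal (φ ∘ (chartAt C.model c).symm) D.σ (g₃ z) ![Z, fderiv ℝ g₃ z ξ] := by
    filter_upwards [htan] with z hz X Y Z ξ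
    obtain ⟨-, ⟨e1, e2, e3⟩, hξ⟩ := hz
    rw [pullbackLocal_apply D.σ (φ ∘ (chartAt C.model cl).symm) (g₁ z) X (fderiv ℝ g₁ z ξ),
      pullbackLocal_apply D.σ (φ ∘ (chartAt C.model c).symm) (g₂ z) Y (fderiv ℝ g₂ z ξ),
      pullbackLocal_apply D.σ (φ ∘ (chartAt C.model c).symm) (g₃ z) Z (fderiv ℝ g₃ z ξ)]
    have h1 := prodForm_apply (J := 𝓘(ℝ, E).prod 𝓘(ℝ, E)) (J' := 𝓘(ℝ, E))
      (-prodForm D.σ D.σ) D.σ (Φ z)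
    have h2 := prodForm_apply (J := 𝓘(ℝ, E)) (J' := 𝓘(ℝ, E)) D.σ D.σ (Φ z).1
    refine (h1 _ _).trans ?_
    refine (congrArg₂ (· + ·) (congrArg Neg.neg (h2 _ _)) rfl).trans ?_
    rw [neg_add, ← sub_eq_add_neg]
    refine congrArg₂ (· + ·) (congrArg₂ (· - ·) (congrArg Neg.neg ?_) ?_) ?_
    · exact form_congr D.σ e1.symm rfl (congrArg (fun v : (E × E) × E => v.1.1) (hξ ξ))
    · exact form_congr D.σ e2.symm rfl (congrArg (fun v : (E × E) × E => v.1.2) (hξ ξ))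
    · exact form_congr D.σ e3.symm rfl (congrArg (fun v : (E × E) × E => v.2) (hξ ξ))
  have hLag' := fun {z : N₃.model} (hz : z ∈ (chartAt N₃.model y₀).target) =>
    isLagrangianSubspace_chart hφ₃.contMDiff hLag y₀ hz
  refine ⟨{
    P := N₃.model, z₀ := z₀, g₁ := g₁, g₂ := g₂, g₃ := g₃, h := h, u := u
    smooth_g₁ := hg₁, smooth_g₂ := hg₂, smooth_g₃ := hg₃, smooth_h := hh, smooth_u := hu
    g₁_z₀ := hg₁0, g₂_z₀ := hg₂0, g₃_z₀ := hg₃0, h_x₀ := hh0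
    g₁_h := ?_, g₂_h := ?_, g₃_h := ?_, source_g := ?_, target_g := ?_
    isotropic := ?_, maximal := ?_ }⟩
  -- The lifts agree after applying `φ`, and `φ` is injective near the base points although it need
  -- not be so globally. The next two goals are treated alike.
  · filter_upwards [hφh, hht.eventually hφg₁, hsct.eventually hφu,
      (hg₁t.comp hht).eventually hVl, (hut.comp hsct).eventually hVl] with x a1 a2 a3 a4 a5
    refine hVlinj a4 a5 ?_
    change φ ((chartAt C.model cl).symm (g₁ (h x))) = φ ((chartAt C.model cl).symm (u _))
    rw [a2.2, a3.2, show Φ (h x) = _ from a1.2]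
  · filter_upwards [hφh, hht.eventually hφg₂, (hg₂t.comp hht).eventually hVc, hVc]
      with x a1 a2 a3 a4
    refine hVcinj a3 a4 ?_
    change φ ((chartAt C.model c).symm (g₂ (h x))) = _
    rw [a2.2, show Φ (h x) = _ from a1.2]; rfl
  · filter_upwards [hφh, hht.eventually hφg₃, (hg₃t.comp hht).eventually hVc, hVc]
      with x a1 a2 a3 a4
    refine hVcinj a3 a4 ?_
    change φ ((chartAt C.model c).symm (g₃ (h x))) = _
    rw [a2.2, show Φ (h x) = _ from a1.2]; rfl
  · filter_upwards [hφg₁, hφg₃] with z a1 a3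
    refine congrArg (chartAt EM m₀) ?_
    symm
    refine (hs _ _).1 ?_
    rw [a3.2]
    have h1 := (hs _ _).2 (Eq.refl (s ((chartAt C.model cl).symm (g₁ z))))
    rw [a1.2] at h1
    exact hD.mem_S_of_L₃ (hΦL z) h1
  · filter_upwards [hφg₁, hφg₂] with z a1 a2
    refine congrArg (chartAt EM m₀) ?_
    symm
    refine (hs _ _).1 ?_
    rw [a2.2]
    have h1 := (ht _ _).2 (Eq.refl (t ((chartAt C.model cl).symm (g₁ z))))
    rw [a1.2] at h1
    exact hD.mem_S_of_L₃_of_mem_T (hΦL z) h1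
  · filter_upwards [htan, hform] with z hz hzf ξ η
    refine (hzf (fderiv ℝ g₁ z ξ) (fderiv ℝ g₂ z ξ) (fderiv ℝ g₃ z ξ) η).symm.trans ?_
    refine (hLag' hz.1 _).1 ⟨ξ, ?_⟩ η
    exact hz.2.2 ξ
  · intro X Y Z hXYZ
    have hz := htan.self_of_nhds
    have hzf := hform.self_of_nhds
    -- The Lagrangian condition lives in the tangent space of `𝒢 × 𝒢 × 𝒢`, so it is applied to the
    -- images of `X`, `Y`, `Z` under the derivative of `φ`; its injectivity recovers the vectors
    -- themselves.
    obtain ⟨ξ, hξ⟩ := (hLag' hz₀t (((mfderiv 𝓘(ℝ, C.model) 𝓘(ℝ, E)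
      (φ ∘ (chartAt C.model cl).symm) (g₁ z₀) X : E), (mfderiv 𝓘(ℝ, C.model) 𝓘(ℝ, E)
      (φ ∘ (chartAt C.model c).symm) (g₂ z₀) Y : E)), (mfderiv 𝓘(ℝ, C.model) 𝓘(ℝ, E)
      (φ ∘ (chartAt C.model c).symm) (g₃ z₀) Z : E))).2 fun ξ => by
        refine (hzf X Y Z ξ).trans ?_
        rw [hg₁0, hg₂0, hg₃0]
        exact hXYZ ξ
    have h1 := (hz.2.2 ξ).symm.trans hξ
    have h2 := Prod.ext_iff.1 h1
    have h3 := Prod.ext_iff.1 h2.1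
    have i1 := injective_mfderiv_comp_chart_symm (hC.immersion cl)
    have i2 := injective_mfderiv_comp_chart_symm (hC.immersion c)
    have j1 := h3.1
    have j2 := h3.2
    have j3 := h2.2
    dsimp only at j1 j2 j3
    rw [hg₁0] at j1
    rw [hg₂0] at j2
    rw [hg₃0] at j3
    exact ⟨ξ, i1 j1, i2 j2, i2 j3⟩

end Construction
end RSG

namespace RSG

/-! ### Descent of a presymplectic form to a bivector on the base -/

section Descent

variable {C : BanachManifold.{u}} {EM : Type u} [NormedAddCommGroup EM] [NormedSpace ℝ EM]
  {M : Type u} [TopologicalSpace M] [ChartedSpace EM M]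

/-- A submersion `s` from a presymplectic manifold `(C, Ω)` along which covectors of the base have
Hamiltonian vectors, depending smoothly on the point, and the projections of these vectors to the
base depend only on the covector. -/
structure IsReduction (Ω : TwoForm 𝓘(ℝ, C.model) C.carrier) (s : C.carrier → M) : Prop where
  differentiableAt : ∀ c, ∀ x ∈ (chartAt C.model c).target, DifferentiableAt ℝ (chartForm Ω c) x
  closed : ∀ c, ∀ x ∈ (chartAt C.model c).target, extDeriv (chartForm Ω c) x = 0
  smooth : ContMDiff 𝓘(ℝ, C.model) 𝓘(ℝ, EM) ∞ s
  surjective : Function.Surjective s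
  submersion : ∀ c, Function.Surjective (mfderiv 𝓘(ℝ, C.model) 𝓘(ℝ, EM) s c)
  hamiltonian : ∀ c m, s c ∈ (chartAt EM m).source →
    ∃ X : C.model → (EM →L[ℝ] ℝ) →L[ℝ] C.model, ContDiffAt ℝ ∞ X (chartAt C.model c c) ∧
      ∀ᶠ x in 𝓝 (chartAt C.model c c), ∀ α v,
        chartForm Ω c x ![X x α, v] = α (fderiv ℝ (locRep EM s c m) x v)
  compatible : ∀ c c', s c' = s c → ∀ (β : EM →L[ℝ] ℝ) (X X' : C.model),
    (∀ v : C.model, (Ω c : C.model [⋀^Fin 2]→L[ℝ] ℝ) ![X, v] =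
      β (mfderiv 𝓘(ℝ, C.model) 𝓘(ℝ, EM) s c v)) →
    (∀ v : C.model, (Ω c' : C.model [⋀^Fin 2]→L[ℝ] ℝ) ![X', v] =
      β (mfderiv 𝓘(ℝ, C.model) 𝓘(ℝ, EM) s c' v)) →
    (mfderiv 𝓘(ℝ, C.model) 𝓘(ℝ, EM) s c X : EM) = mfderiv 𝓘(ℝ, C.model) 𝓘(ℝ, EM) s c' X'

theorem compContinuousLinearMap_apply_two {F G : Type*} [NormedAddCommGroup F] [NormedSpace ℝ F]
    [NormedAddCommGroup G] [NormedSpace ℝ G] (σ : F [⋀^Fin 2]→L[ℝ] ℝ) (T : G →L[ℝ] F) (v w : G) :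
    σ.compContinuousLinearMap T ![v, w] = σ ![T v, T w] := by
  rw [ContinuousAlternatingMap.compContinuousLinearMap_apply]
  congr 1
  ext i; fin_cases i <;> rfl

theorem chartForm_apply (Ω : TwoForm 𝓘(ℝ, C.model) C.carrier) (c : C.carrier) (x v w : C.model) :
    chartForm Ω c x ![v, w] =
      (Ω ((chartAt C.model c).symm x) : C.model [⋀^Fin 2]→L[ℝ] ℝ)
        ![(mfderiv 𝓘(ℝ, C.model) 𝓘(ℝ, C.model) (chartAt C.model c).symm x v : C.model),
          (mfderiv 𝓘(ℝ, C.model) 𝓘(ℝ, C.model) (chartAt C.model c).symm x w : C.model)] :=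
  pullbackForm_apply Ω _ x v w

theorem chartForm_apply_self (Ω : TwoForm 𝓘(ℝ, C.model) C.carrier) (c : C.carrier)
    (v w : C.model) :
    chartForm Ω c (chartAt C.model c c) ![v, w] = (Ω c : C.model [⋀^Fin 2]→L[ℝ] ℝ)
        ![(mfderiv 𝓘(ℝ, C.model) 𝓘(ℝ, C.model) (chartAt C.model c).symm (chartAt C.model c c) v :
            C.model),
          (mfderiv 𝓘(ℝ, C.model) 𝓘(ℝ, C.model) (chartAt C.model c).symm (chartAt C.model c c) w :
            C.model)] := by
  -- The tangent space depends on the base point, so the point is generalized before it is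
  -- identified with `c`.
  have key : ∀ c' (h : (chartAt C.model c).symm (chartAt C.model c c) = c'),
      chartForm Ω c (chartAt C.model c c) ![v, w] = (Ω c' : C.model [⋀^Fin 2]→L[ℝ] ℝ)
        ![(mfderiv 𝓘(ℝ, C.model) 𝓘(ℝ, C.model) (chartAt C.model c).symm (chartAt C.model c c) v :
            C.model),
          (mfderiv 𝓘(ℝ, C.model) 𝓘(ℝ, C.model) (chartAt C.model c).symm (chartAt C.model c c) w :
            C.model)] := by
    rintro _ rfl
    exact chartForm_apply Ω c _ v w
  exact key c (chart_symm_chart c)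

theorem fderiv_locRep_self [IsManifold 𝓘(ℝ, EM) ∞ M] {q : C.carrier → M}
    (hq : ContMDiff 𝓘(ℝ, C.model) 𝓘(ℝ, EM) ∞ q) {c : C.carrier} {m : M}
    (hm : q c ∈ (chartAt EM m).source) (v : C.model) :
    fderiv ℝ (locRep EM q c m) (chartAt C.model c c) v =
      (mfderiv 𝓘(ℝ, EM) 𝓘(ℝ, EM) (chartAt EM m) (q c) : EM →L[ℝ] EM)
        ((mfderiv 𝓘(ℝ, C.model) 𝓘(ℝ, EM) q c : C.model →L[ℝ] EM)
          (mfderiv 𝓘(ℝ, C.model) 𝓘(ℝ, C.model) (chartAt C.model c).symm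
            (chartAt C.model c c) v)) := by
  have key : ∀ c' (h : (chartAt C.model c).symm (chartAt C.model c c) = c'),
      fderiv ℝ (locRep EM q c m) (chartAt C.model c c) v =
      (mfderiv 𝓘(ℝ, EM) 𝓘(ℝ, EM) (chartAt EM m) (q c') : EM →L[ℝ] EM)
        ((mfderiv 𝓘(ℝ, C.model) 𝓘(ℝ, EM) q c' : C.model →L[ℝ] EM)
          (mfderiv 𝓘(ℝ, C.model) 𝓘(ℝ, C.model) (chartAt C.model c).symm
            (chartAt C.model c c) v)) := by
    rintro _ rfl
    exact fderiv_locRep hq (chart_mem_locDom hm) v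
  exact key c (chart_symm_chart c)

theorem exists_mfderiv_chart_symm_eq (c : C.carrier) (X : C.model) : ∃ Z : C.model,
    (mfderiv 𝓘(ℝ, C.model) 𝓘(ℝ, C.model) (chartAt C.model c).symm (chartAt C.model c c) Z :
      C.model) = X :=
  surjective_mfderiv_chart_symm c (chart_mem_target c) X

/-- Being Hamiltonian can be checked in a chart. -/
theorem hamiltonian_of_chart {Ω : TwoForm 𝓘(ℝ, C.model) C.carrier} {s : C.carrier → M}
    {c : C.carrier} {x X : C.model} (hx : x ∈ (chartAt C.model c).target) {β : EM →L[ℝ] ℝ}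
    (h : ∀ v, chartForm Ω c x ![X, v] =
      β (mfderiv 𝓘(ℝ, C.model) 𝓘(ℝ, EM) s ((chartAt C.model c).symm x)
        (mfderiv 𝓘(ℝ, C.model) 𝓘(ℝ, C.model) (chartAt C.model c).symm x v))) (w : C.model) :
    (Ω ((chartAt C.model c).symm x) : C.model [⋀^Fin 2]→L[ℝ] ℝ)
      ![(mfderiv 𝓘(ℝ, C.model) 𝓘(ℝ, C.model) (chartAt C.model c).symm x X : C.model), w] =
      β (mfderiv 𝓘(ℝ, C.model) 𝓘(ℝ, EM) s ((chartAt C.model c).symm x) w) := by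
  obtain ⟨v, hv⟩ := surjective_mfderiv_chart_symm c hx w
  have h1 := (chartForm_apply Ω c x X v).symm.trans (h v)
  rw [← hv]
  exact h1

theorem exists_comp_mfderiv_chart [IsManifold 𝓘(ℝ, EM) ∞ M] (m₀ : M) {m : M}
    (hm : m ∈ (chartAt EM m₀).source) :
    ∃ T : EM →L[ℝ] EM, ∀ v : EM, T (mfderiv 𝓘(ℝ, EM) 𝓘(ℝ, EM) (chartAt EM m₀) m v) = v := by
  have : IsManifold 𝓘(ℝ, EM) 1 M := IsManifold.of_le (n := ∞) (by simp)
  have h := (mdifferentiable_chart (I := 𝓘(ℝ, EM)) m₀).symm_comp_deriv hm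
  exact ⟨mfderiv 𝓘(ℝ, EM) 𝓘(ℝ, EM) (chartAt EM m₀).symm (chartAt EM m₀ m),
    fun v => DFunLike.congr_fun h v⟩

namespace IsReduction

variable [IsManifold 𝓘(ℝ, EM) ∞ M] {Ω : TwoForm 𝓘(ℝ, C.model) C.carrier} {s : C.carrier → M}
  (h : IsReduction (EM := EM) Ω s)
include h

/-- Hamiltonian vectors can be chosen linearly at each point. -/
theorem exists_linear (c : C.carrier) : ∃ X : (EM →L[ℝ] ℝ) →L[ℝ] C.model, ∀ β (v : C.model),
    (Ω c : C.model [⋀^Fin 2]→L[ℝ] ℝ) ![X β, v] =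
      β (mfderiv 𝓘(ℝ, C.model) 𝓘(ℝ, EM) s c v) := by
  obtain ⟨X, -, hX⟩ := h.hamiltonian c (s c) (mem_chart_source EM (s c))
  obtain ⟨T, hT⟩ := exists_comp_mfderiv_chart (EM := EM) (s c) (mem_chart_source EM (s c))
  have h1 := hX.self_of_nhds
  have key : ∀ (β : EM →L[ℝ] ℝ) (v : C.model), (Ω c : C.model [⋀^Fin 2]→L[ℝ] ℝ)
      ![(mfderiv 𝓘(ℝ, C.model) 𝓘(ℝ, C.model) (chartAt C.model c).symm (chartAt C.model c c)
        (X (chartAt C.model c c) (β.comp T)) : C.model), v] =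
      β (mfderiv 𝓘(ℝ, C.model) 𝓘(ℝ, EM) s c v) := by
    intro β v
    obtain ⟨w, rfl⟩ := exists_mfderiv_chart_symm_eq c v
    rw [← chartForm_apply_self, h1, fderiv_locRep_self h.smooth (mem_chart_source EM (s c))]
    exact congrArg β (hT _)
  exact ⟨(mfderiv 𝓘(ℝ, C.model) 𝓘(ℝ, C.model) (chartAt C.model c).symm (chartAt C.model c c) :
      C.model →L[ℝ] C.model) ∘L X (chartAt C.model c c) ∘L
      (ContinuousLinearMap.compL ℝ EM EM ℝ).flip T, key⟩

/-- The reduced bivector. -/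
theorem exists_bivector : ∃ P : Bivector EM M, ∀ c (β γ : EM →L[ℝ] ℝ) (X : C.model),
    (∀ v : C.model, (Ω c : C.model [⋀^Fin 2]→L[ℝ] ℝ) ![X, v] =
      β (mfderiv 𝓘(ℝ, C.model) 𝓘(ℝ, EM) s c v)) →
    (P (s c) : (EM →L[ℝ] ℝ) [⋀^Fin 2]→L[ℝ] ℝ) ![β, γ] =
      γ (mfderiv 𝓘(ℝ, C.model) 𝓘(ℝ, EM) s c X) := by
  have : ∀ m, ∃ π : (EM →L[ℝ] ℝ) [⋀^Fin 2]→L[ℝ] ℝ, ∀ c, s c = m → ∀ (β γ : EM →L[ℝ] ℝ)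
      (X : C.model), (∀ v : C.model, (Ω c : C.model [⋀^Fin 2]→L[ℝ] ℝ) ![X, v] =
        β (mfderiv 𝓘(ℝ, C.model) 𝓘(ℝ, EM) s c v)) →
      π ![β, γ] = γ (mfderiv 𝓘(ℝ, C.model) 𝓘(ℝ, EM) s c X) := by
    intro m
    obtain ⟨c₀, rfl⟩ := h.surjective m
    obtain ⟨Y, hY⟩ := h.exists_linear c₀
    -- The sign: `-Ω(Yβ, Yγ) = Ω(Yγ, Yβ) = γ(ds Yβ)`. Writing the bivector as a pulled back form
    -- makes it alternating and continuous at once.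
    refine ⟨-(Ω c₀ : C.model [⋀^Fin 2]→L[ℝ] ℝ).compContinuousLinearMap Y,
      fun c hc β γ X hX => ?_⟩
    rw [← h.compatible c₀ c hc β (Y β) X (hY β) hX, ← hY γ]
    exact (congrArg Neg.neg (compContinuousLinearMap_apply_two (F := C.model)
      (Ω c₀ : C.model [⋀^Fin 2]→L[ℝ] ℝ) Y β γ)).trans (form_swap _ _ _).symm
  choose P hP using this
  exact ⟨P, fun c => hP _ c rfl⟩

end IsReduction

section Bivector

variable [IsManifold 𝓘(ℝ, EM) ∞ M]
  {Ω : TwoForm 𝓘(ℝ, C.model) C.carrier} {s : C.carrier → M}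
  (h : IsReduction (EM := EM) Ω s) {P : Bivector EM M}
  (hP : ∀ c (β γ : EM →L[ℝ] ℝ) (X : C.model),
    (∀ v : C.model, (Ω c : C.model [⋀^Fin 2]→L[ℝ] ℝ) ![X, v] =
      β (mfderiv 𝓘(ℝ, C.model) 𝓘(ℝ, EM) s c v)) →
    (P (s c) : (EM →L[ℝ] ℝ) [⋀^Fin 2]→L[ℝ] ℝ) ![β, γ] =
      γ (mfderiv 𝓘(ℝ, C.model) 𝓘(ℝ, EM) s c X))
include h hP

/-- Pairing with all covectors `γ` identifies the vector that `P` attaches to `β` with the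
projection of any Hamiltonian vector of `β`, as covectors separate points. -/
theorem isForwardDirac_of_bivector : IsForwardDirac C Ω P s := by
  refine ⟨h.smooth, fun c => ?_⟩
  ext ⟨v, β⟩
  constructor
  · intro hv
    obtain ⟨X, hX⟩ := h.exists_linear c
    refine ⟨X β, ?_, fun w => (hX β w).symm⟩
    by_contra hne
    obtain ⟨γ, hγ⟩ := SeparatingDual.exists_separating_of_ne (R := ℝ) (V := EM) hne
    exact hγ ((hP c β γ (X β) (hX β)).symm.trans (hv γ).symm)
  · rintro ⟨X, hX, hβ⟩ γ
    refine Eq.trans ?_ (hP c β γ X fun v => (hβ v).symm).symm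
    exact congrArg γ hX.symm

/-- `P` can be evaluated at any point of the fibre, in particular along a smooth local section of
`s`, where the smooth family of Hamiltonian vectors is available. -/
theorem contDiffOn_bivector [FiniteDimensional ℝ EM] (m₀ : M) (α β : EM →L[ℝ] ℝ) :
    ContDiffOn ℝ ∞ (fun a : EM =>
      P ((chartAt EM m₀).symm a)
        ![α.comp (mfderiv 𝓘(ℝ, EM) 𝓘(ℝ, EM) (chartAt EM m₀) ((chartAt EM m₀).symm a)),
          β.comp (mfderiv 𝓘(ℝ, EM) 𝓘(ℝ, EM) (chartAt EM m₀) ((chartAt EM m₀).symm a))])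
      (chartAt EM m₀).target := by
  intro a ha
  refine ContDiffAt.contDiffWithinAt ?_
  obtain ⟨c, hc⟩ := h.surjective ((chartAt EM m₀).symm a)
  have hcm : s c ∈ (chartAt EM m₀).source := hc ▸ (chartAt EM m₀).map_target ha
  obtain ⟨X, hXs, hX⟩ := h.hamiltonian c m₀ hcm
  obtain ⟨r, W, hW, haW, hr, hr0, hrW⟩ := exists_section h.smooth hcm (h.submersion c)
  have hca : chartAt EM m₀ (s c) = a := by rw [hc, (chartAt EM m₀).right_inv ha]
  rw [hca] at haW hr0
  have hra : ContDiffAt ℝ ∞ r a := hr.contDiffAt (hW.mem_nhds haW)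
  have hrt : Filter.Tendsto r (𝓝 a) (𝓝 (chartAt C.model c c)) := by
    have := hra.continuousAt.tendsto; rwa [hr0] at this
  have h1 : ContDiffAt ℝ ∞ (fun a => β (fderiv ℝ (locRep EM s c m₀) (r a) (X (r a) α))) a := by
    refine β.contDiff.contDiffAt.comp a (ContDiffAt.clm_apply ?_ (ContDiffAt.clm_apply ?_
      contDiffAt_const))
    · refine ContDiffAt.comp a ?_ hra
      rw [hr0]
      exact (contDiffAt_locRep h.smooth (chart_mem_locDom hcm)).fderiv_right (by simp)
    · exact ContDiffAt.comp a (by rw [hr0]; exact hXs) hra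
  refine h1.congr_of_eventuallyEq ?_
  filter_upwards [hW.mem_nhds haW, hrt.eventually hX, (chartAt EM m₀).open_target.mem_nhds ha]
    with b hb hXb hbt
  obtain ⟨hdom, hloc⟩ := hrW b hb
  have hsb : s ((chartAt C.model c).symm (r b)) = (chartAt EM m₀).symm b := by
    conv_rhs => rw [← hloc]
    exact ((chartAt EM m₀).left_inv hdom.2).symm
  have key : ∀ m, s ((chartAt C.model c).symm (r b)) = m → ∀ A : EM →L[ℝ] EM,
      A = mfderiv 𝓘(ℝ, EM) 𝓘(ℝ, EM) (chartAt EM m₀) m →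
      (P m : (EM →L[ℝ] ℝ) [⋀^Fin 2]→L[ℝ] ℝ) ![α.comp A, β.comp A] =
        β (fderiv ℝ (locRep EM s c m₀) (r b) (X (r b) α)) := by
    rintro _ rfl A rfl
    refine (hP _ _ _ _ (hamiltonian_of_chart hdom.1 (X := X (r b) α) fun v => ?_)).trans ?_
    · rw [hXb, fderiv_locRep h.smooth hdom]
      rfl
    · rw [fderiv_locRep h.smooth hdom]
      rfl
  exact key _ hsb _ rfl

end Bivector
end Descent
end RSG

namespace RSG

/-! ### The Jacobi identity on the base -/

section Jacobi

variable {C : BanachManifold.{u}} {EM : Type u} [NormedAddCommGroup EM] [NormedSpace ℝ EM]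
  {M : Type u} [TopologicalSpace M] [ChartedSpace EM M] [IsManifold 𝓘(ℝ, EM) ∞ M]
  {Ω : TwoForm 𝓘(ℝ, C.model) C.carrier} {s : C.carrier → M}
  (h : IsReduction (EM := EM) Ω s) {P : Bivector EM M}
  (hP : ∀ c (β γ : EM →L[ℝ] ℝ) (X : C.model),
    (∀ v : C.model, (Ω c : C.model [⋀^Fin 2]→L[ℝ] ℝ) ![X, v] =
      β (mfderiv 𝓘(ℝ, C.model) 𝓘(ℝ, EM) s c v)) →
    (P (s c) : (EM →L[ℝ] ℝ) [⋀^Fin 2]→L[ℝ] ℝ) ![β, γ] =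
      γ (mfderiv 𝓘(ℝ, C.model) 𝓘(ℝ, EM) s c X))
include h

omit [IsManifold 𝓘(ℝ, EM) ∞ M] in
theorem fderiv_comp_chart_symm {f : M → ℝ} {c : C.carrier} {x : C.model}
    (hx : x ∈ (chartAt C.model c).target)
    (hf : MDifferentiableAt 𝓘(ℝ, EM) 𝓘(ℝ, ℝ) f (s ((chartAt C.model c).symm x))) (v : C.model) :
    fderiv ℝ (fun x => f (s ((chartAt C.model c).symm x))) x v =
      (mfderiv 𝓘(ℝ, EM) 𝓘(ℝ, ℝ) f (s ((chartAt C.model c).symm x)) : EM →L[ℝ] ℝ)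
        (mfderiv 𝓘(ℝ, C.model) 𝓘(ℝ, EM) s ((chartAt C.model c).symm x)
          (mfderiv 𝓘(ℝ, C.model) 𝓘(ℝ, C.model) (chartAt C.model c).symm x v)) := by
  have h1 : MDifferentiableAt 𝓘(ℝ, C.model) 𝓘(ℝ, C.model) (chartAt C.model c).symm x :=
    (contMDiffAt_chart_symm c hx).mdifferentiableAt (by simp)
  have h2 : MDifferentiableAt 𝓘(ℝ, C.model) 𝓘(ℝ, EM) s ((chartAt C.model c).symm x) :=
    h.smooth.contMDiffAt.mdifferentiableAt (by simp)
  have h4 := mfderiv_comp x (hf : MDifferentiableAt 𝓘(ℝ, EM) 𝓘(ℝ, ℝ) f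
    ((s ∘ (chartAt C.model c).symm) x)) (h2.comp x h1)
  have h5 := mfderiv_comp x h2 h1
  rw [← mfderiv_eq_fderiv]
  change mfderiv 𝓘(ℝ, C.model) 𝓘(ℝ, ℝ) (f ∘ (s ∘ (chartAt C.model c).symm)) x v = _
  rw [h4, h5]
  rfl

include hP

theorem bracket_source {f g : M → ℝ} {c : C.carrier} {x X : C.model}
    (hx : x ∈ (chartAt C.model c).target)
    (hf : MDifferentiableAt 𝓘(ℝ, EM) 𝓘(ℝ, ℝ) f (s ((chartAt C.model c).symm x)))
    (hg : MDifferentiableAt 𝓘(ℝ, EM) 𝓘(ℝ, ℝ) g (s ((chartAt C.model c).symm x)))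
    (hX : ∀ v, chartForm Ω c x ![X, v] =
      fderiv ℝ (fun x => f (s ((chartAt C.model c).symm x))) x v) :
    bracket P f g (s ((chartAt C.model c).symm x)) =
      fderiv ℝ (fun x => g (s ((chartAt C.model c).symm x))) x X := by
  rw [fderiv_comp_chart_symm h hx hg]
  refine hP _ _ _ _ (hamiltonian_of_chart hx fun v => ?_)
  rw [hX, fderiv_comp_chart_symm h hx hf]
  rfl

/-- Pulled back along `s`, brackets become derivatives along Hamiltonian vector fields in a chart of
`C`, and the identity is that of a closed form. -/
theorem bracket_jacobi [FiniteDimensional ℝ EM] (f : Fin 3 → M → ℝ)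
    (hf : ∀ i, ContMDiff 𝓘(ℝ, EM) 𝓘(ℝ, ℝ) ∞ (f i)) (m : M) :
    bracket P (f 0) (bracket P (f 1) (f 2)) m + bracket P (f 1) (bracket P (f 2) (f 0)) m +
      bracket P (f 2) (bracket P (f 0) (f 1)) m = 0 := by
  obtain ⟨c, rfl⟩ := h.surjective m
  have hcm : s c ∈ (chartAt EM (s c)).source := mem_chart_source EM (s c)
  obtain ⟨X, hXs, hX⟩ := h.hamiltonian c (s c) hcm
  obtain ⟨r, W, hW, hW0, hr, hr0, hrW⟩ := exists_section h.smooth hcm (h.submersion c)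
  have hx₀ := chart_mem_locDom (y := c) (q := s) hcm
  have hdomnhds := (isOpen_locDom (y := c) (m := s c) h.smooth).mem_nhds hx₀
  have hmd : ∀ i a, MDifferentiableAt 𝓘(ℝ, EM) 𝓘(ℝ, ℝ) (f i) a := fun i a =>
    (hf i).contMDiffAt.mdifferentiableAt (by simp)
  -- the functions and their Hamiltonian vector fields in the chart
  let F : Fin 3 → C.model → ℝ := fun i x => f i (s ((chartAt C.model c).symm x))
  let fhat : Fin 3 → EM → ℝ := fun i a => f i ((chartAt EM (s c)).symm a)
  let Y : Fin 3 → C.model → C.model := fun i x =>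
    X x (fderiv ℝ (fhat i) (locRep EM s c (s c) x))
  have hfhat : ∀ i, ∀ x ∈ locDom EM s c (s c),
      ContDiffAt ℝ ∞ (fhat i) (locRep EM s c (s c) x) := fun i x hx =>
    contMDiffAt_iff_contDiffAt.1 (ContMDiffAt.comp _ (hf i).contMDiffAt
      (contMDiffAt_chart_symm (s c) ((chartAt EM (s c)).map_source hx.2)))
  have hFeq : ∀ i, ∀ x ∈ locDom EM s c (s c), F i =ᶠ[𝓝 x] fhat i ∘ locRep EM s c (s c) := by
    intro i x hx
    filter_upwards [(isOpen_locDom (y := c) (m := s c) h.smooth).mem_nhds hx] with z hz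
    exact congrArg (f i) ((chartAt EM (s c)).left_inv hz.2).symm
  have hF : ∀ i, ContDiffAt ℝ ∞ (F i) (chartAt C.model c c) := fun i =>
    ((hfhat i _ hx₀).comp _ (contDiffAt_locRep h.smooth hx₀)).congr_of_eventuallyEq (hFeq i _ hx₀)
  have hY : ∀ i, ContDiffAt ℝ ∞ (Y i) (chartAt C.model c c) := fun i =>
    hXs.clm_apply (ContDiffAt.comp _ ((hfhat i _ hx₀).fderiv_right (m := ∞) (by simp))
      (contDiffAt_locRep h.smooth hx₀))
  have hham : ∀ i, ∀ᶠ x in 𝓝 (chartAt C.model c c), ∀ v,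
      chartForm Ω c x ![Y i x, v] = fderiv ℝ (F i) x v := by
    intro i
    filter_upwards [hX, hdomnhds] with x hx hxd v
    rw [hx, (hFeq i x hxd).fderiv_eq, fderiv_comp x ((hfhat i x hxd).differentiableAt (by simp))
      ((contDiffAt_locRep h.smooth hxd).differentiableAt (by simp))]
    rfl
  -- brackets in the chart
  have hbr : ∀ i j, ∀ᶠ x in 𝓝 (chartAt C.model c c),
      bracket P (f i) (f j) (s ((chartAt C.model c).symm x)) = fderiv ℝ (F j) x (Y i x) := by
    intro i j
    filter_upwards [hham i, hdomnhds] with x hx hxd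
    exact bracket_source h hP hxd.1 (hmd i _) (hmd j _) hx
  have hrc : ContDiffAt ℝ ∞ r (chartAt EM (s c) (s c)) := hr.contDiffAt (hW.mem_nhds hW0)
  -- The outer bracket differentiates the inner one on `M`, so the latter must be differentiable
  -- there and not only after composition with `s`; a local section of `s` brings this down.
  have hbd : ∀ i j, MDifferentiableAt 𝓘(ℝ, EM) 𝓘(ℝ, ℝ) (bracket P (f i) (f j)) (s c) := by
    intro i j
    have h1 : ContDiffAt ℝ ∞ (fun a => fderiv ℝ (F j) (r a) (Y i (r a)))
        (chartAt EM (s c) (s c)) :=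
      ContDiffAt.comp (chartAt EM (s c) (s c)) (g := fun x => fderiv ℝ (F j) x (Y i x))
        (by rw [hr0]; exact ((hF j).fderiv_right (m := ∞) (by simp)).clm_apply (hY i)) hrc
    have hch : ContMDiffAt 𝓘(ℝ, EM) 𝓘(ℝ, EM) ∞ (chartAt EM (s c)) (s c) :=
      contMDiffAt_chart (s c) hcm
    have h2 := (contMDiffAt_iff_contDiffAt.2 h1).comp (s c) hch
    refine (h2.congr_of_eventuallyEq ?_).mdifferentiableAt (by simp)
    have hrt : Filter.Tendsto r (𝓝 (chartAt EM (s c) (s c))) (𝓝 (chartAt C.model c c)) := by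
      have := hrc.continuousAt.tendsto; rwa [hr0] at this
    filter_upwards [(chartAt EM (s c)).open_source.mem_nhds hcm,
      hch.continuousAt.eventually (hrt.eventually (hbr i j)),
      hch.continuousAt.preimage_mem_nhds (hW.mem_nhds hW0)] with a ha hb haW
    obtain ⟨hdom, hloc⟩ := hrW _ haW
    have hsa : s ((chartAt C.model c).symm (r (chartAt EM (s c) a))) = a :=
      (chartAt EM (s c)).injOn hdom.2 ha hloc
    rw [hsa] at hb
    exact hb
  have hbb : ∀ i j k, bracket P (f i) (bracket P (f j) (f k)) (s c) =
      fderiv ℝ (fun x => fderiv ℝ (F k) x (Y j x)) (chartAt C.model c c)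
        (Y i (chartAt C.model c c)) := by
    intro i j k
    have hs : s ((chartAt C.model c).symm (chartAt C.model c c)) = s c := by
      rw [chart_symm_chart]
    have := bracket_source h hP (g := bracket P (f j) (f k)) hx₀.1 (hmd i _)
      (by rw [hs]; exact hbd j k) (hham i).self_of_nhds
    rw [Filter.EventuallyEq.fderiv_eq (hbr j k), hs] at this
    exact this
  rw [hbb, hbb, hbb]
  exact jacobi_of_closed (h.differentiableAt c _ hx₀.1) (h.closed c _ hx₀.1)
    (fun i => (hF i).of_le two_le_infty) (fun i => (hY i).differentiableAt (by simp)) hham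

omit hP in
theorem IsReduction.exists_isPoisson [FiniteDimensional ℝ EM] :
    ∃ P : Bivector EM M, IsPoisson P ∧ IsForwardDirac C Ω P s := by
  obtain ⟨P, hP⟩ := h.exists_bivector
  refine ⟨P, ⟨contDiffOn_bivector h hP, fun f g k hf hg hk => ?_⟩,
    isForwardDirac_of_bivector h hP⟩
  funext m
  exact bracket_jacobi h hP ![f, g, k] (by
    intro i; fin_cases i
    exacts [hf, hg, hk]) m

end Jacobi

/-! ### Uniqueness and change of sign -/

section Uniqueness

variable {C : BanachManifold.{u}} {EM : Type u} [NormedAddCommGroup EM] [NormedSpace ℝ EM]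
  {M : Type u} [TopologicalSpace M] [ChartedSpace EM M] {Ω : TwoForm 𝓘(ℝ, C.model) C.carrier}

/-- By reflexivity of a finite-dimensional space, every covector `α` occurs in the graph, paired
with the vector representing `π(α, ·)`; so the graph determines all values of `π`. -/
theorem eq_of_diracOfBivector_eq [FiniteDimensional ℝ EM]
    {π π' : (EM →L[ℝ] ℝ) [⋀^Fin 2]→L[ℝ] ℝ} (h : diracOfBivector π = diracOfBivector π') :
    π = π' := by
  have key : ∀ α, ∃ v : EM, ∀ β : EM →L[ℝ] ℝ, β v = π ![α, β] := by
    intro α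
    obtain ⟨v, hv⟩ := (Module.evalEquiv ℝ EM).surjective
      ((bilinOfForm _ π α).toLinearMap ∘ₗ LinearMap.toContinuousLinearMap.toLinearMap)
    refine ⟨v, fun β => ?_⟩
    have h1 := LinearMap.congr_fun hv β.toLinearMap
    have h2 : LinearMap.toContinuousLinearMap (β : EM →ₗ[ℝ] ℝ) = β := rfl
    simpa [bilinOfForm_apply, h2] using h1
  ext w
  obtain ⟨v, hv⟩ := key (w 0)
  have h1 : (v, w 0) ∈ diracOfBivector π' := h ▸ hv
  have h2 : w = ![w 0, w 1] := by ext i; fin_cases i <;> rfl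
  rw [h2, ← hv, h1]

theorem IsForwardDirac.unique [FiniteDimensional ℝ EM] {s : C.carrier → M}
    (hs : Function.Surjective s) {P P' : Bivector EM M} (h : IsForwardDirac C Ω P s)
    (h' : IsForwardDirac C Ω P' s) : P = P' := by
  funext m
  obtain ⟨c, rfl⟩ := hs m
  exact eq_of_diracOfBivector_eq (EM := EM) ((h.2 c).trans (h'.2 c).symm)

theorem form_neg_right {V : Type*} [NormedAddCommGroup V] [NormedSpace ℝ V]
    (σ : V [⋀^Fin 2]→L[ℝ] ℝ) (v w : V) : σ ![v, -w] = -σ ![v, w] := by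
  simp [← bilinOfForm_apply]

theorem bracket_neg_right (P : Bivector EM M) (f g : M → ℝ) :
    bracket P f (-g) = -bracket P f g := by
  funext m
  have h1 : (mfderiv 𝓘(ℝ, EM) 𝓘(ℝ, ℝ) (-g) m : EM →L[ℝ] ℝ) =
    -(mfderiv 𝓘(ℝ, EM) 𝓘(ℝ, ℝ) g m : EM →L[ℝ] ℝ) := mfderiv_neg
  have h2 := form_neg_right (V := EM →L[ℝ] ℝ) (P m) (mfderiv 𝓘(ℝ, EM) 𝓘(ℝ, ℝ) f m)
    (mfderiv 𝓘(ℝ, EM) 𝓘(ℝ, ℝ) g m)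
  exact (congrArg (fun β : EM →L[ℝ] ℝ => (P m : (EM →L[ℝ] ℝ) [⋀^Fin 2]→L[ℝ] ℝ)
    ![(mfderiv 𝓘(ℝ, EM) 𝓘(ℝ, ℝ) f m : EM →L[ℝ] ℝ), β]) h1).trans h2

/-- The Jacobi identity is quadratic in the bivector. -/
theorem IsPoisson.neg [IsManifold 𝓘(ℝ, EM) ∞ M] {P : Bivector EM M} (h : IsPoisson P) :
    IsPoisson (-P) := by
  have hn : ∀ f g, bracket (-P) f g = -bracket P f g := fun f g => rfl
  refine ⟨fun m₀ α β => (h.smooth m₀ α β).neg, fun f g k hf hg hk => ?_⟩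
  simp only [hn, bracket_neg_right, neg_neg]
  exact h.jacobi f g k hf hg hk

end Uniqueness
end RSG

namespace RSG

/-! ### Reduction of `C` along the source map -/

section Reduction

set_option linter.unusedSectionVars false

variable {E : Type u} [NormedAddCommGroup E] [NormedSpace ℝ E] [CompleteSpace E]
  {𝒢 : Type u} [TopologicalSpace 𝒢] [T2Space 𝒢] [ChartedSpace E 𝒢] [IsManifold 𝓘(ℝ, E) ∞ 𝒢]
  {D : RelData E 𝒢} (hD : D.IsRelationalSymplecticGroupoid)
  {EM : Type u} [NormedAddCommGroup EM] [NormedSpace ℝ EM]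
  [TopologicalSpace D.Base] [ChartedSpace EM D.Base] [IsManifold 𝓘(ℝ, EM) ∞ D.Base]
  {C : BanachManifold.{u}} {φ : C.carrier → 𝒢}
  {s t : C.carrier → D.Base}
  (hs : ∀ c m, (φ c, m) ∈ D.S ↔ s c = m) (ht : ∀ c m, (φ c, m) ∈ D.T ↔ t c = m)
  (hs_smooth : ContMDiff 𝓘(ℝ, C.model) 𝓘(ℝ, EM) ∞ s)

theorem chartForm_pullbackForm {φ : C.carrier → 𝒢} (hφ : ContMDiff 𝓘(ℝ, C.model) 𝓘(ℝ, E) ∞ φ)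
    (σ : TwoForm 𝓘(ℝ, E) 𝒢) (c : C.carrier) {x : C.model} (hx : x ∈ (chartAt C.model c).target) :
    chartForm (pullbackForm 𝓘(ℝ, C.model) 𝓘(ℝ, E) φ σ) c x =
      pullbackLocal (φ ∘ (chartAt C.model c).symm) σ x :=
  (pullbackForm_comp σ ((contMDiffAt_chart_symm c hx).mdifferentiableAt (by simp))
    (hφ.contMDiffAt.mdifferentiableAt (by simp))).symm

include hD hs ht hs_smooth in
/-- The coisotropic submanifold `C` of a regular relational symplectic groupoid reduces to the
base along the source map. -/
theorem isReduction_source [FiniteDimensional ℝ EM]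
    (hC : IsImmersedSubmanifold 𝓘(ℝ, E) C φ D.C) {N₁ : BanachManifold.{u}} {ψ₁ : N₁.carrier → 𝒢}
    {q : N₁.carrier → D.Base} (hψ₁ : IsImmersedSubmanifold 𝓘(ℝ, E) N₁ ψ₁ D.L₁)
    (hqcls : ∀ (y : N₁.carrier) (hy : ψ₁ y ∈ D.L₁), q y = D.cls ⟨ψ₁ y, hy⟩)
    (hq : ContMDiff 𝓘(ℝ, N₁.model) 𝓘(ℝ, EM) ∞ q)
    (hqsurj : ∀ y, Function.Surjective (mfderiv 𝓘(ℝ, N₁.model) 𝓘(ℝ, EM) q y))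
    (hssub : ∀ c, Function.Surjective (mfderiv 𝓘(ℝ, C.model) 𝓘(ℝ, EM) s c)) :
    IsReduction (EM := EM) (pullbackForm 𝓘(ℝ, C.model) 𝓘(ℝ, E) φ D.σ) s := by
  have hφ := hC.contMDiff
  have ht_smooth := contMDiff_target hD hC hs ht hs_smooth
  have hL₁ : ∀ y, ψ₁ y ∈ D.L₁ := fun y => hψ₁.range_eq ▸ Set.mem_range_self y
  have hcf := fun c x hx => chartForm_pullbackForm hφ D.σ c (x := x) hx
  have hev : ∀ c, ∀ x ∈ (chartAt C.model c).target,
      chartForm (pullbackForm 𝓘(ℝ, C.model) 𝓘(ℝ, E) φ D.σ) c =ᶠ[𝓝 x]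
        pullbackLocal (φ ∘ (chartAt C.model c).symm) D.σ := by
    intro c x hx
    filter_upwards [(chartAt C.model c).open_target.mem_nhds hx] with z hz using hcf c z hz
  -- units over a point of the base
  have hunit : ∀ m : D.Base, ∃ (y : N₁.carrier) (cl : C.carrier), φ cl = ψ₁ y ∧ q y = m ∧
      s cl = m ∧ t cl = m := by
    intro m
    obtain ⟨l, rfl⟩ := Quot.exists_rep m
    obtain ⟨y, hy⟩ : (l : 𝒢) ∈ Set.range ψ₁ := by rw [hψ₁.range_eq]; exact l.2
    obtain ⟨cl, hcl⟩ : (l : 𝒢) ∈ Set.range φ := by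
      rw [hC.range_eq]; exact hD.L₁_subset_C l.2
    refine ⟨y, cl, hcl.trans hy.symm, ?_, ?_, ?_⟩
    · rw [hqcls y (hL₁ y)]; exact congrArg D.cls (Subtype.ext hy)
    · refine (hs _ _).1 ?_
      rw [hcl]; exact hD.mem_S_self l
    · refine (ht _ _).1 ?_
      rw [hcl]; exact hD.mem_T_self l
  have hmodel := fun {c cl : C.carrier} {y₁ : N₁.carrier} (h1 : φ cl = ψ₁ y₁) (h2 : q y₁ = s c)
    {m₀ : D.Base} (h3 : s c ∈ (chartAt EM m₀).source) =>
      exists_localModel hD hC hs ht hs_smooth hψ₁ hqcls hq hqsurj h1 h2 h3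
  have hham : ∀ c m, s c ∈ (chartAt EM m).source →
      ∃ X : C.model → (EM →L[ℝ] ℝ) →L[ℝ] C.model, ContDiffAt ℝ ∞ X (chartAt C.model c c) ∧
      ∀ᶠ x in 𝓝 (chartAt C.model c c), ∀ α v,
        chartForm (pullbackForm 𝓘(ℝ, C.model) 𝓘(ℝ, E) φ D.σ) c x ![X x α, v] =
          α (fderiv ℝ (locRep EM s c m) x v) := by
    intro c m hm
    obtain ⟨y, cl, h1, h2, h3, h4⟩ := hunit (s c)
    obtain ⟨𝓜⟩ := hmodel h1 h2 hm
    have hx := chart_mem_locDom (y := c) (q := s) hm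
    obtain ⟨X, hX, hXe⟩ := 𝓜.exists_hamiltonian
      (contDiffAt_bilin_pullbackLocal hD.weakSymplectic
        (contMDiffAt_comp_chart_symm hφ c hx.1))
      ((contDiffAt_locRep ht_smooth (chart_mem_locDom (by rwa [h4]))).differentiableAt (by simp))
      (contDiffAt_locRep hs_smooth hx)
      (surjective_fderiv_locRep hs_smooth hx (hssub _))
    refine ⟨X, hX, ?_⟩
    filter_upwards [hXe, (chartAt C.model c).open_target.mem_nhds hx.1] with x h5 h6 α v
    rw [hcf c x h6, h5]
  -- comparison of Hamiltonian vectors at a point and at a unit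
  have hcomp : ∀ c cl y₁, φ cl = ψ₁ y₁ → q y₁ = s c → s cl = s c → ∀ (β : EM →L[ℝ] ℝ)
      (X Z : C.model),
      (∀ v : C.model, chartForm (pullbackForm 𝓘(ℝ, C.model) 𝓘(ℝ, E) φ D.σ) cl
        (chartAt C.model cl cl) ![X, v] = β (fderiv ℝ (locRep EM s cl (s c)) (chartAt C.model cl cl) v)) →
      (∀ v : C.model, chartForm (pullbackForm 𝓘(ℝ, C.model) 𝓘(ℝ, E) φ D.σ) c
        (chartAt C.model c c) ![Z, v] = β (fderiv ℝ (locRep EM s c (s c)) (chartAt C.model c c) v)) →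
      fderiv ℝ (locRep EM s cl (s c)) (chartAt C.model cl cl) X =
        fderiv ℝ (locRep EM s c (s c)) (chartAt C.model c c) Z := by
    intro c cl y₁ h1 h2 h3 β X Z hX hZ
    obtain ⟨𝓜⟩ := hmodel h1 h2 (mem_chart_source EM (s c))
    refine 𝓜.fderiv_eq_of_hamiltonian
      ((contDiffAt_locRep hs_smooth (chart_mem_locDom (by
        rw [h3]; exact mem_chart_source EM (s c)))).differentiableAt (by simp))
      ((contDiffAt_locRep hs_smooth (chart_mem_locDom
        (mem_chart_source EM (s c)))).differentiableAt (by simp)) (β := β) ?_ ?_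
    · intro v; rw [← hcf cl _ (chart_mem_target cl)]; exact hX v
    · intro v; rw [← hcf c _ (chart_mem_target c)]; exact hZ v
  -- Two points of a source fibre are both compared with the same unit `cl` and the same Hamiltonian
  -- vector at it.
  have hcompat : ∀ c c', s c' = s c → ∀ (β : EM →L[ℝ] ℝ) (Z Z' : C.model),
      (∀ v : C.model, chartForm (pullbackForm 𝓘(ℝ, C.model) 𝓘(ℝ, E) φ D.σ) c
        (chartAt C.model c c) ![Z, v] =
          β (fderiv ℝ (locRep EM s c (s c)) (chartAt C.model c c) v)) →
      (∀ v : C.model, chartForm (pullbackForm 𝓘(ℝ, C.model) 𝓘(ℝ, E) φ D.σ) c'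
        (chartAt C.model c' c') ![Z', v] =
          β (fderiv ℝ (locRep EM s c' (s c)) (chartAt C.model c' c') v)) →
      fderiv ℝ (locRep EM s c (s c)) (chartAt C.model c c) Z =
        fderiv ℝ (locRep EM s c' (s c)) (chartAt C.model c' c') Z' := by
    intro c c' hcc β Z Z' hZ hZ'
    obtain ⟨y, cl, h1, h2, h3, -⟩ := hunit (s c)
    obtain ⟨X, -, hX⟩ := hham cl (s c) (by rw [h3]; exact mem_chart_source EM (s c))
    have e1 := hcomp c cl y h1 h2 h3 β _ Z (hX.self_of_nhds β) hZ
    have e2 := hcomp c' cl y h1 (h2.trans hcc.symm) (h3.trans hcc.symm) β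
      (X (chartAt C.model cl cl) β) Z' (by rw [hcc]; exact hX.self_of_nhds β) (by rw [hcc]; exact hZ')
    rw [hcc] at e2
    exact e1.symm.trans e2
  refine ⟨fun c x hx => ?_, fun c x hx => ?_, hs_smooth, fun m => ?_, hssub, hham, ?_⟩
  · exact (differentiableAt_pullbackLocal hD.weakSymplectic
      (contMDiffAt_comp_chart_symm hφ c hx)).congr_of_eventuallyEq (hev c x hx)
  · rw [Filter.EventuallyEq.extDeriv_eq (hev c x hx)]
    exact extDeriv_pullbackLocal hD.weakSymplectic (contMDiffAt_comp_chart_symm hφ c hx)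
  · obtain ⟨-, cl, -, -, h, -⟩ := hunit m
    exact ⟨cl, h⟩
  · intro c c' hcc β X X' hX hX'
    obtain ⟨Z, rfl⟩ := exists_mfderiv_chart_symm_eq c X
    obtain ⟨Z', rfl⟩ := exists_mfderiv_chart_symm_eq c' X'
    -- `T` inverts the derivative of the base chart, so `β ∘ T` represents `β` in the chart and the
    -- comparison made there can be undone.
    obtain ⟨T, hT⟩ := exists_comp_mfderiv_chart (EM := EM) (s c) (mem_chart_source EM (s c))
    have hm' : s c' ∈ (chartAt EM (s c)).source := by rw [hcc]; exact mem_chart_source EM (s c)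
    have hT' : ∀ v : EM, T ((mfderiv 𝓘(ℝ, EM) 𝓘(ℝ, EM) (chartAt EM (s c)) (s c') :
        EM →L[ℝ] EM) v) = v := by rw [hcc]; exact hT
    have e := hcompat c c' hcc (β.comp T) Z Z' (fun v => by
        refine (chartForm_apply_self _ c Z v).trans ((hX _).trans ?_)
        rw [fderiv_locRep_self hs_smooth (mem_chart_source EM (s c))]
        exact congrArg β (hT _).symm) (fun v => by
        refine (chartForm_apply_self _ c' Z' v).trans ((hX' _).trans ?_)
        rw [fderiv_locRep_self hs_smooth hm']
        exact congrArg β (hT' _).symm)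
    rw [fderiv_locRep_self hs_smooth (mem_chart_source EM (s c)),
      fderiv_locRep_self hs_smooth hm'] at e
    exact (hT _).symm.trans ((congrArg T e).trans (hT' _))

end Reduction
end RSG

namespace RSG

/-! ### Exchange of source and target by the inversion -/

section Inversion

set_option linter.unusedSectionVars false

/-- An anti-isomorphism intertwining `f'` and `f` exchanges forward images up to the sign of the
covectors. -/
theorem mem_forwardImage_anti {V V' W : Type*} [AddCommGroup V] [Module ℝ V] [TopologicalSpace V]
    [AddCommGroup V'] [Module ℝ V'] [TopologicalSpace V'] [AddCommGroup W] [Module ℝ W]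
    [TopologicalSpace W] [IsTopologicalAddGroup W] {σ : V [⋀^Fin 2]→L[ℝ] ℝ}
    {σ' : V' [⋀^Fin 2]→L[ℝ] ℝ} {f : V →L[ℝ] W} {f' : V' →L[ℝ] W} {A : V → V'}
    (hA : Function.Surjective A) (hσ : ∀ v w, σ' ![A v, A w] = -σ ![v, w])
    (hf : ∀ v, f' (A v) = f v) (w : W) (β : W →L[ℝ] ℝ) :
    (w, β) ∈ forwardImage f (diracOfForm σ) ↔ (w, -β) ∈ forwardImage f' (diracOfForm σ') := by
  constructor
  · rintro ⟨v, hv, hβ⟩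
    refine ⟨A v, (hf v).trans hv, fun u' => ?_⟩
    obtain ⟨u, rfl⟩ := hA u'
    have h1 : β (f u) = σ ![v, u] := hβ u
    change -β (f' (A u)) = σ' ![A v, A u]
    rw [hσ, hf, h1]
  · rintro ⟨v', hv, hβ⟩
    obtain ⟨v, rfl⟩ := hA v'
    refine ⟨v, (hf v).symm.trans hv, fun u => ?_⟩
    have h1 : -β (f' (A u)) = σ' ![A v, A u] := hβ (A u)
    change β (f u) = σ ![v, u]
    rw [hσ, hf] at h1
    exact neg_injective h1

theorem mem_diracOfBivector_neg {V : Type*} [NormedAddCommGroup V] [NormedSpace ℝ V]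
    (π : (V →L[ℝ] ℝ) [⋀^Fin 2]→L[ℝ] ℝ) (v : V) (β : V →L[ℝ] ℝ) :
    (v, β) ∈ diracOfBivector (-π) ↔ (v, -β) ∈ diracOfBivector π := by
  refine forall_congr' fun γ => ?_
  have : π ![-β, γ] = -π ![β, γ] := by
    rw [form_swap, form_neg_right, form_swap]
    simp
  change γ v = -π ![β, γ] ↔ γ v = π ![-β, γ]
  rw [this]

variable {E : Type u} [NormedAddCommGroup E] [NormedSpace ℝ E] [CompleteSpace E]
  {𝒢 : Type u} [TopologicalSpace 𝒢] [T2Space 𝒢] [ChartedSpace E 𝒢] [IsManifold 𝓘(ℝ, E) ∞ 𝒢]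
  {D : RelData E 𝒢} (hD : D.IsRelationalSymplecticGroupoid)
  {EM : Type u} [NormedAddCommGroup EM] [NormedSpace ℝ EM]
  [TopologicalSpace D.Base] [ChartedSpace EM D.Base] [IsManifold 𝓘(ℝ, EM) ∞ D.Base]
  {C : BanachManifold.{u}} {φ : C.carrier → 𝒢} (hC : IsImmersedSubmanifold 𝓘(ℝ, E) C φ D.C)
  {s t : C.carrier → D.Base}
  (hs : ∀ c m, (φ c, m) ∈ D.S ↔ s c = m) (ht : ∀ c m, (φ c, m) ∈ D.T ↔ t c = m)
  (hs_smooth : ContMDiff 𝓘(ℝ, C.model) 𝓘(ℝ, EM) ∞ s)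

include hD hC in
/-- The derivative of the inversion along `C`. -/
theorem mfderiv_comp_lift_I {c : C.carrier} {G : C.carrier → C.carrier}
    (hG : MDifferentiableAt 𝓘(ℝ, C.model) 𝓘(ℝ, C.model) G c) (h : φ ∘ G =ᶠ[𝓝 c] D.I ∘ φ)
    (v : C.model) :
    (mfderiv 𝓘(ℝ, C.model) 𝓘(ℝ, E) φ (G c) : C.model →L[ℝ] E)
      (mfderiv 𝓘(ℝ, C.model) 𝓘(ℝ, C.model) G c v) =
    (mfderiv 𝓘(ℝ, E) 𝓘(ℝ, E) D.I (φ c) : E →L[ℝ] E)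
      (mfderiv 𝓘(ℝ, C.model) 𝓘(ℝ, E) φ c v) := by
  have hφ : ∀ a, MDifferentiableAt 𝓘(ℝ, C.model) 𝓘(ℝ, E) φ a := fun a =>
    hC.contMDiff.contMDiffAt.mdifferentiableAt (by simp)
  have h1 : (mfderiv 𝓘(ℝ, C.model) 𝓘(ℝ, E) (φ ∘ G) c : C.model →L[ℝ] E) =
    mfderiv 𝓘(ℝ, C.model) 𝓘(ℝ, E) (D.I ∘ φ) c := h.mfderiv_eq
  rw [mfderiv_comp c (hφ _) hG, mfderiv_comp c
    (hD.smooth_I.contMDiffAt.mdifferentiableAt (by simp)) (hφ c)] at h1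
  exact DFunLike.congr_fun h1 v

include hD in
theorem form_mfderiv_I (x : 𝒢) (v w : E) :
    (D.σ (D.I x) : E [⋀^Fin 2]→L[ℝ] ℝ) ![(mfderiv 𝓘(ℝ, E) 𝓘(ℝ, E) D.I x : E →L[ℝ] E) v,
      (mfderiv 𝓘(ℝ, E) 𝓘(ℝ, E) D.I x : E →L[ℝ] E) w] =
      -(D.σ x : E [⋀^Fin 2]→L[ℝ] ℝ) ![v, w] := by
  have h1 := congrFun hD.antisymplectic_I x
  have h2 : (pullbackForm 𝓘(ℝ, E) 𝓘(ℝ, E) D.I D.σ x : E [⋀^Fin 2]→L[ℝ] ℝ) ![v, w] = _ :=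
    pullbackForm_apply D.σ D.I x v w
  rw [h1] at h2
  exact h2.symm

include hD hC hs ht hs_smooth in
-- The derivative of a local lift of `I` is an anti-isomorphism of presymplectic tangent spaces that
-- carries `dt` to `ds`.
theorem mem_forwardImage_target {c c' : C.carrier} (hc : φ c' = D.I (φ c)) (w : EM)
    (β : EM →L[ℝ] ℝ) :
    (w, β) ∈ forwardImage (W := EM) (mfderiv 𝓘(ℝ, C.model) 𝓘(ℝ, EM) t c)
        (diracOfForm (pullbackForm 𝓘(ℝ, C.model) 𝓘(ℝ, E) φ D.σ c)) ↔
      (w, -β) ∈ forwardImage (W := EM) (mfderiv 𝓘(ℝ, C.model) 𝓘(ℝ, EM) s c')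
        (diracOfForm (pullbackForm 𝓘(ℝ, C.model) 𝓘(ℝ, E) φ D.σ c')) := by
  obtain ⟨G, hG, rfl, hφG⟩ := exists_lift_I hD hC hc
  have hGc : φ c = D.I (φ (G c)) := by rw [hc, hD.involutive]
  obtain ⟨G', hG', hGG, hφG'⟩ := exists_lift_I hD hC hGc
  have hGd : MDifferentiableAt 𝓘(ℝ, C.model) 𝓘(ℝ, C.model) G c := hG.mdifferentiableAt (by simp)
  have hGd' : MDifferentiableAt 𝓘(ℝ, C.model) 𝓘(ℝ, C.model) G' (G c) :=
    hG'.mdifferentiableAt (by simp)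
  have hA := mfderiv_comp_lift_I hD hC hGd hφG
  have hB := mfderiv_comp_lift_I hD hC hGd' hφG'
  refine mem_forwardImage_anti (V := C.model) (V' := C.model) (W := EM)
    (A := (mfderiv 𝓘(ℝ, C.model) 𝓘(ℝ, C.model) G c : C.model →L[ℝ] C.model)) ?_ ?_ ?_ w β
  · intro v
    refine ⟨(mfderiv 𝓘(ℝ, C.model) 𝓘(ℝ, C.model) G' (G c) : C.model →L[ℝ] C.model) v, ?_⟩
    -- A lift `G'` in the opposite direction supplies the preimage: after the injective derivative
    -- of `φ`, the composite of the two lifts becomes the derivative of `I ∘ I`, the identity.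
    refine injective_mfderiv_of_isImmersionAt (hC.immersion (G c)) ?_
    refine (hA _).trans ?_
    have hB' := hB v
    rw [hGG] at hB'
    refine (congrArg _ hB').trans ?_
    have h1 := mfderiv_comp (φ (G c)) (hD.smooth_I.contMDiffAt.mdifferentiableAt (by simp) :
      MDifferentiableAt 𝓘(ℝ, E) 𝓘(ℝ, E) D.I (D.I (φ (G c))))
      (hD.smooth_I.contMDiffAt.mdifferentiableAt (by simp))
    rw [hD.involutive.comp_self, mfderiv_id] at h1
    rw [hGc]
    exact (DFunLike.congr_fun h1 _).symm
  · intro v w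
    refine (pullbackForm_apply D.σ φ (G c) _ _).trans ?_
    refine Eq.trans ?_ (congrArg Neg.neg (pullbackForm_apply D.σ φ c v w).symm)
    refine Eq.trans ?_ (form_mfderiv_I hD (φ c) _ _)
    exact form_congr D.σ hc (hA v) (hA w)
  · intro v
    have h1 : t =ᶠ[𝓝 c] s ∘ G := by
      filter_upwards [hφG] with a ha using target_eq_source hD hs ht ha
    have h2 : (mfderiv 𝓘(ℝ, C.model) 𝓘(ℝ, EM) t c : C.model →L[ℝ] EM) =
      mfderiv 𝓘(ℝ, C.model) 𝓘(ℝ, EM) (s ∘ G) c := h1.mfderiv_eq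
    rw [mfderiv_comp c (hs_smooth.contMDiffAt.mdifferentiableAt (by simp)) hGd] at h2
    exact (DFunLike.congr_fun h2 v).symm

include hD hC hs ht hs_smooth in
theorem isForwardDirac_target_iff (P : Bivector EM D.Base) :
    IsForwardDirac C (pullbackForm 𝓘(ℝ, C.model) 𝓘(ℝ, E) φ D.σ) P s ↔
      IsForwardDirac C (pullbackForm 𝓘(ℝ, C.model) 𝓘(ℝ, E) φ D.σ) (-P) t := by
  have key : ∀ c c', φ c' = D.I (φ c) →
      (diracOfBivector (P (s c')) =
        forwardImage (mfderiv 𝓘(ℝ, C.model) 𝓘(ℝ, EM) s c')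
          (diracOfForm (pullbackForm 𝓘(ℝ, C.model) 𝓘(ℝ, E) φ D.σ c')) ↔
      diracOfBivector ((-P) (t c)) =
        forwardImage (mfderiv 𝓘(ℝ, C.model) 𝓘(ℝ, EM) t c)
          (diracOfForm (pullbackForm 𝓘(ℝ, C.model) 𝓘(ℝ, E) φ D.σ c))) := by
    intro c c' hc
    have h1 := mem_forwardImage_target hD hC hs ht hs_smooth hc
    have h2 := mem_diracOfBivector_neg (V := EM) (P (s c'))
    have h3 : ((-P) (t c) : (EM →L[ℝ] ℝ) [⋀^Fin 2]→L[ℝ] ℝ) =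
        -(P (s c') : (EM →L[ℝ] ℝ) [⋀^Fin 2]→L[ℝ] ℝ) := by
      rw [target_eq_source hD hs ht hc]; rfl
    constructor
    · intro h
      ext ⟨v, β⟩
      refine Iff.trans ?_ (h1 v β).symm
      refine Iff.trans ?_ (Set.ext_iff.1 h (v, -β))
      refine Iff.trans ?_ (h2 v β)
      exact Set.ext_iff.1 (congrArg (diracOfBivector (V := EM)) h3) (v, β)
    · intro h
      ext ⟨v, β⟩
      obtain ⟨γ, rfl⟩ : ∃ γ : EM →L[ℝ] ℝ, β = -γ := ⟨-β, (neg_neg (G := EM →L[ℝ] ℝ) β).symm⟩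
      refine Iff.trans ?_ (h1 v γ)
      refine Iff.trans ?_ (Set.ext_iff.1 h (v, γ))
      refine (h2 v γ).symm.trans ?_
      exact (Set.ext_iff.1 (congrArg (diracOfBivector (V := EM)) h3) (v, γ)).symm
  constructor
  · rintro ⟨-, h⟩
    refine ⟨contMDiff_target hD hC hs ht hs_smooth, fun c => ?_⟩
    obtain ⟨c', hc'⟩ := exists_apply_eq_I hD hC c
    exact (key c c' hc').1 (h c')
  · rintro ⟨-, h⟩
    refine ⟨hs_smooth, fun c' => ?_⟩
    obtain ⟨c, hc⟩ := exists_apply_eq_I hD hC c'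
    exact (key c c' (by rw [hc, hD.involutive])).2 (h c)

end Inversion
end RSG

end

theorem mainTheorem3
    {E : Type u} [NormedAddCommGroup E] [NormedSpace ℝ E] [CompleteSpace E]
    {𝒢 : Type u} [TopologicalSpace 𝒢] [T2Space 𝒢] [ChartedSpace E 𝒢] [IsManifold 𝓘(ℝ, E) ∞ 𝒢]
    (D : RSG.RelData E 𝒢) (hD : D.IsRelationalSymplecticGroupoid)
    {EM : Type u} [NormedAddCommGroup EM] [NormedSpace ℝ EM]
    [TopologicalSpace D.Base] [T2Space D.Base] [ChartedSpace EM D.Base]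
    [IsManifold 𝓘(ℝ, EM) ∞ D.Base]
    (C : RSG.BanachManifold.{u}) (φ : C.carrier → 𝒢) (hreg : D.IsRegular C φ EM)
    (s t : C.carrier → D.Base)
    (hs : ∀ c m, (φ c, m) ∈ D.S ↔ s c = m) (ht : ∀ c m, (φ c, m) ∈ D.T ↔ t c = m)
    (hs_smooth : ContMDiff 𝓘(ℝ, C.model) 𝓘(ℝ, EM) ∞ s)
    (hs_fibers : ∀ m, IsConnected (s ⁻¹' {m})) :
    (∃! P : RSG.Bivector EM D.Base, RSG.IsPoisson P ∧
      RSG.IsForwardDirac C (RSG.pullbackForm 𝓘(ℝ, C.model) 𝓘(ℝ, E) φ D.σ) P s) ∧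
    (∃! P : RSG.Bivector EM D.Base, RSG.IsPoisson P ∧
      RSG.IsForwardDirac C (RSG.pullbackForm 𝓘(ℝ, C.model) 𝓘(ℝ, E) φ D.σ) P t) ∧
    (∀ P : RSG.Bivector EM D.Base, RSG.IsPoisson P →
      (RSG.IsForwardDirac C (RSG.pullbackForm 𝓘(ℝ, C.model) 𝓘(ℝ, E) φ D.σ) P s ↔
       RSG.IsForwardDirac C (RSG.pullbackForm 𝓘(ℝ, C.model) 𝓘(ℝ, E) φ D.σ) (-P) t)) := by
  obtain ⟨N₁, ψ₁, q, hψ₁, hqcls, hq, hqsurj⟩ := hreg.quotient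
  obtain ⟨NS, ψ, hψ, hψsurj⟩ := hreg.immersed_S
  have : FiniteDimensional ℝ EM := hreg.finiteDimensional
  have hC := hreg.immersed_C
  have hred := RSG.isReduction_source hD hs ht hs_smooth hC hψ₁ hqcls hq hqsurj
    (RSG.surjective_mfderiv_source hC hs hs_smooth hψ hψsurj)
  have hiff := RSG.isForwardDirac_target_iff hD hC hs ht hs_smooth
  obtain ⟨P, hP, hPs⟩ := hred.exists_isPoisson
  refine ⟨⟨P, ⟨hP, hPs⟩, fun P' h => h.2.unique hred.surjective hPs⟩,
    ⟨-P, ⟨hP.neg, (hiff P).1 hPs⟩, fun P' h => ?_⟩, fun P' _ => hiff P'⟩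
  have hneg : - -P' = P' := funext fun m => neg_neg (G := (EM →L[ℝ] ℝ) [⋀^Fin 2]→L[ℝ] ℝ) (P' m)
  -- Uniqueness for `t` reduces to uniqueness for `s`, applied to `-P'`.
  have h1 := (hiff (-P')).2 (by rw [hneg]; exact h.2)
  rw [← h1.unique hred.surjective hPs, hneg]
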